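/- Let $\mathbb R^3_1$ be $\mathbb R^3$ with $\langle u,v\rangle=u_0v_0+u_1v_1-u_2v_2$. For a local parametrisation $\mathbf x(u,v)$ of a smooth surface $M\subset\mathbb R^3_1$ let $E,F,G$ be the coefficients of the first fundamental form and $\bar l,\bar m,\bar n=\langle \mathbf x_u\times \mathbf x_v,\mathbf x_{uu}\rangle,\langle \mathbf x_u\times \mathbf x_v,\mathbf x_{uv}\rangle,\langle \mathbf x_u\times \mathbf x_v,\mathbf x_{vv}\rangle$. The $LD$, the $LPL$ and the $MCNC$ are the zero sets of $$\delta=F^2-EG,\qquad \tilde\delta=(E\bar n-G\bar l)^2-4(F\bar n-G\bar m)(E\bar m-F\bar l),\qquad \bar H=\bar lG-2\bar mF+\bar nE ;$$ the Lorentzian (Riemannian) region is $\delta>0$ ($\delta<0$). The order of contact $m(\gamma_1,\gamma_2:p)$ of a curve $\gamma_1$, regular at $p$, with the curve $\gamma_2$ (one of the loci above) is the order of vanishing at $p$ of the displayed function defining $\gamma_2$ along a regular parametrisation of $\gamma_1$ (so $1$ means transverse and $2$ an ordinary tangency). The germs $(M,p)$ of smooth surfaces are the germs of local parametrisations $(\mathbb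 R^2,0)\to(\mathbb R^3_1,p)$ modulo diffeomorphisms of $(\mathbb R^2,0)$, with the quotient of the topology given by the jets at $0$. Let $\mathcal G_6$ be the space of germs $(M,p)$ such that $p$ is a regular point of the $LD$ and $m(LD,LPL:p)>2$. A 1-parameter family $M_t$, $t\in(\mathbb R,0)$, with $M_0=M$ is given by parametrisations $\mathbf x_t$ depending smoothly on $t$, with $\mathbf x_0=\mathbf x$ a parametrisation of $M$; "for generic families" means: for all families in a set which is open and dense in the topology given by the jets at the origin and which is invariant under changes of parameters depending smoothly on $t$. **Theorem.** The germs $(M,p)\in\mathcal G_6$ for which, for some sign $s\in\{1,-1\}$, the following (1) and (2) hold in every local parametrisation form an open and dense subset of $\mathcal G_6$, and both signs $s$ occur. 1. $m(LD,LPL:p)=4$ and $m(LD,MCNC:p)=2$. Near $p$ the three curves are regular and meet only at $p$. Away from $p$, the $LPL$ is in the Lorentzian region, and the $MCNC$ is in the Lorentzian region, with the $LPL$ strictly between it and the $LD$, if $s=1$, and in the Riemannian region if $s=-1$. 2. For a generic 1-parameter family $M_t$ with $M_0=M$ there is a sign $\sigma\in\{1,-1\}$ such that, in arbitrarily small parallelogram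 neighbourhoods $V$ of $p$ in the parameter plane (the same for all small $|t|$), the curves $LD_t$, $LPL_t$, $MCNC_t$ are regular arcs, graphs over the same side of $V$ of functions that depend smoothly on $t$, with the Lorentzian region on one fixed side (called above) of the $LD_t$; at $t=0$ the configuration is that of (1), and: - if $\sigma t<0$, the three curves are pairwise disjoint in $V$, and the $MCNC_t$ is in the Lorentzian region if $s=1$, in the Riemannian region if $s=-1$; - if $\sigma t>0$, any two of the three curves meet in $V$ in exactly two points, the same two points for each pair; there the $MCNC_t$ is transverse to the $LD_t$ and to the $LPL_t$, while the $LD_t$ and the $LPL_t$ have an ordinary tangency ($m(LD_t,LPL_t)=2$). The $MCNC_t$ is, outside of the arc between these points, in the Lorentzian region if $s=1$ and in the Riemannian region if $s=-1$, and inside the arc in the other region; - for all small $t$, over the points where the $MCNC_t$ is above the $LD_t$ the $LPL_t$ lies strictly between the $LD_t$ and the $MCNC_t$; over the points where the $MCNC_t$ is below the $LD_t$ the $LPL_t$ is strictly above the $LD_t$; over the points where the $MCNC_t$ meets the $LD_t$, so does the $LPL_t$. -/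

import Mathlib

open Set Filter Topology
open scoped ContDiff

noncomputable section

namespace MinkowskiSurface

/-- Minkowski 3-space as a vector space; the metric is `mink`. -/
abbrev R31 : Type := Fin 3 → ℝ

/-- The parameter plane with coordinates `(u, v)`. -/
abbrev Plane : Type := ℝ × ℝ

/-- The Lorentzian product of signature `(+, +, -)`. -/
def mink (a b : R31) : ℝ := a 0 * b 0 + a 1 * b 1 - a 2 * b 2

/-- The Lorentzian vector product: the vector with `mink (mcross a b) c = det (a, b, c)`. -/
def mcross (a b : R31) : R31 :=
  ![a 1 * b 2 - a 2 * b 1, a 2 * b 0 - a 0 * b 2, -(a 0 * b 1 - a 1 * b 0)]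

theorem mink_mcross (a b c : R31) :
    mink (mcross a b) c = (Matrix.of ![a, b, c]).det := by
  simp [mink, mcross, Matrix.det_fin_three]
  ring

/-- Smoothness on a neighbourhood of a point. -/
def SmoothNear {E F : Type*} [NormedAddCommGroup E] [NormedSpace ℝ E]
    [NormedAddCommGroup F] [NormedSpace ℝ F] (f : E → F) (a : E) : Prop :=
  ∀ᶠ z in 𝓝 a, ContDiffAt ℝ ∞ f z

/-! Fundamental forms of a parametrised surface. -/

/-- Partial derivative in `u`. -/
def du (x : Plane → R31) (q : Plane) : R31 := fderiv ℝ x q (1, 0)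

/-- Partial derivative in `v`. -/
def dv (x : Plane → R31) (q : Plane) : R31 := fderiv ℝ x q (0, 1)

def coeffE (x : Plane → R31) (q : Plane) : ℝ := mink (du x q) (du x q)
def coeffF (x : Plane → R31) (q : Plane) : ℝ := mink (du x q) (dv x q)
def coeffG (x : Plane → R31) (q : Plane) : ℝ := mink (dv x q) (dv x q)

/-- The coefficients of the second fundamental form, multiplied by the norm of the normal vector
`x_u × x_v`; they are defined also where the induced metric is degenerate. -/
def coeffL (x : Plane → R31) (q : Plane) : ℝ := mink (mcross (du x q) (dv x q)) (du (du x) q)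
def coeffM (x : Plane → R31) (q : Plane) : ℝ := mink (mcross (du x q) (dv x q)) (dv (du x) q)
def coeffN (x : Plane → R31) (q : Plane) : ℝ := mink (mcross (du x q) (dv x q)) (dv (dv x) q)

/-- `δ = F² - EG`. The `LD` is its zero set, the Lorentzian region is `δ > 0` and the Riemannian
region is `δ < 0`. -/
def ldFun (x : Plane → R31) (q : Plane) : ℝ := coeffF x q ^ 2 - coeffE x q * coeffG x q

/-- The discriminant of the equation of the lines of principal curvature. The `LPL` is its zero
set. -/
def lplFun (x : Plane → R31) (q : Plane) : ℝ :=
  (coeffE x q * coeffN x q - coeffG x q * coeffL x q) ^ 2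
    - 4 * (coeffF x q * coeffN x q - coeffG x q * coeffM x q)
      * (coeffE x q * coeffM x q - coeffF x q * coeffL x q)

/-- The numerator of the mean curvature. The `MCNC` is its zero set. -/
def mcncFun (x : Plane → R31) (q : Plane) : ℝ :=
  coeffL x q * coeffG x q - 2 * coeffM x q * coeffF x q + coeffN x q * coeffE x q

/-- The locus of degeneracy, in the parameter plane. -/
def LD (x : Plane → R31) : Set Plane := {q | ldFun x q = 0}

/-- The lightlike principal locus, in the parameter plane. -/
def LPL (x : Plane → R31) : Set Plane := {q | lplFun x q = 0}

/-- The mean curvature null curve, in the parameter plane. -/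
def MCNC (x : Plane → R31) : Set Plane := {q | mcncFun x q = 0}

/-- The order of contact at `q` of the curve `φ = 0`, regular at `q`, with the curve `ψ = 0`: the
order of vanishing of `ψ` along a regular parametrisation `γ` of the first curve (`0` if `q` is not
on both curves, `1` for transverse curves, `2` for an ordinary tangency). -/
def contactOrder (φ ψ : Plane → ℝ) (q : Plane) : ℕ∞ :=
  sSup {k : ℕ∞ | ∃ γ : ℝ → Plane, SmoothNear γ 0 ∧ γ 0 = q ∧ deriv γ 0 ≠ 0 ∧
    (∀ᶠ s in 𝓝 (0 : ℝ), φ (γ s) = 0) ∧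
    ∀ j : ℕ, (j : ℕ∞) < k → iteratedDeriv j (fun s => ψ (γ s)) 0 = 0}

/-! The space of germs of surfaces. -/

/-- A representative of a germ at the origin of a local parametrisation of a smooth surface. -/
structure LocalParam where
  toFun : Plane → R31
  smooth : SmoothNear toFun 0
  immersion : Function.Injective (fderiv ℝ toFun 0)

/-- The jet topology on (germs at the origin of) local parametrisations: the coarsest one for which
all the jets at the origin depend continuously on the germ. -/
instance : TopologicalSpace LocalParam :=
  TopologicalSpace.induced
    (fun (x : LocalParam) (k : ℕ) => iteratedFDeriv ℝ k x.toFun 0) inferInstance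

/-- `h` and `k` are germs of diffeomorphisms of `(ℝ², 0)`, inverse to each other. -/
def InverseDiffeoGerms (h k : Plane → Plane) : Prop :=
  SmoothNear h 0 ∧ SmoothNear k 0 ∧ h 0 = 0 ∧ k 0 = 0 ∧
    (∀ᶠ q in 𝓝 (0 : Plane), h (k q) = q) ∧ (∀ᶠ q in 𝓝 (0 : Plane), k (h q) = q)

theorem SmoothNear.comp_zero {E F G : Type*} [NormedAddCommGroup E] [NormedSpace ℝ E]
    [NormedAddCommGroup F] [NormedSpace ℝ F] [NormedAddCommGroup G] [NormedSpace ℝ G]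
    {g : F → G} {f : E → F} (hg : SmoothNear g 0) (hf : SmoothNear f 0) (h0 : f 0 = 0) :
    SmoothNear (fun z => g (f z)) 0 := by
  have hc : Tendsto f (𝓝 0) (𝓝 0) := by
    have := hf.self_of_nhds.continuousAt
    rwa [ContinuousAt, h0] at this
  unfold SmoothNear
  filter_upwards [hf, hc.eventually hg] with z h1 h2
  exact ContDiffAt.comp z h2 h1

theorem SmoothNear.tendsto_zero {E F : Type*} [NormedAddCommGroup E] [NormedSpace ℝ E]
    [NormedAddCommGroup F] [NormedSpace ℝ F] {f : E → F} (hf : SmoothNear f 0) (h0 : f 0 = 0) :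
    Tendsto f (𝓝 0) (𝓝 0) := by
  have := hf.self_of_nhds.continuousAt
  rwa [ContinuousAt, h0] at this

/-- `x ~ y` if `y = x ∘ h` for a germ of a diffeomorphism `h`, i.e. if `x` and `y` parametrise the
same germ of a surface at the same point. -/
instance paramSetoid : Setoid LocalParam where
  r x y := ∃ h k : Plane → Plane, InverseDiffeoGerms h k ∧
    ∀ᶠ q in 𝓝 (0 : Plane), y.toFun q = x.toFun (h q)
  iseqv :=
    { refl := fun x => ⟨id, id, ⟨.of_forall fun _ => contDiffAt_id, .of_forall fun _ => contDiffAt_id,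
        rfl, rfl, .of_forall fun _ => rfl, .of_forall fun _ => rfl⟩, .of_forall fun _ => rfl⟩
      symm := by
        rintro x y ⟨h, k, ⟨hh, hk, h0, k0, hhk, hkh⟩, e⟩
        refine ⟨k, h, ⟨hk, hh, k0, h0, hkh, hhk⟩, ?_⟩
        filter_upwards [(hk.tendsto_zero k0).eventually e, hhk] with q h1 h2
        rw [h1, h2]
      trans := by
        rintro x y z ⟨h, k, ⟨hh, hk, h0, k0, hhk, hkh⟩, e⟩ ⟨h', k', ⟨hh', hk', h0', k0', hhk', hkh'⟩, e'⟩
        refine ⟨fun q => h (h' q), fun q => k' (k q), ⟨hh.comp_zero hh' h0', hk'.comp_zero hk k0,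
          by simp [h0, h0'], by simp [k0, k0'], ?_, ?_⟩, ?_⟩
        · filter_upwards [(hk.tendsto_zero k0).eventually hhk', hhk] with q h1 h2
          rw [h1, h2]
        · filter_upwards [(hh'.tendsto_zero h0').eventually hkh, hkh'] with q h1 h2
          rw [h1, h2]
        · filter_upwards [(hh'.tendsto_zero h0').eventually e, e'] with q h1 h2
          rw [h2, h1] }

/-- The germs `(M, p)` of smooth surfaces in Minkowski 3-space, with the quotient topology. -/
def SurfaceGerm : Type := Quotient paramSetoid

instance : TopologicalSpace SurfaceGerm := inferInstanceAs (TopologicalSpace (Quotient paramSetoid))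

/-- `x` is a local parametrisation of the germ `g`. -/
def Parametrizes (x : LocalParam) (g : SurfaceGerm) : Prop := (Quotient.mk paramSetoid x) = g

/-- The point `p` is a regular point of the `LD` and `m(LD, LPL : p) > 2`. -/
def DegenerateContact (x : LocalParam) : Prop :=
  ldFun x.toFun 0 = 0 ∧ fderiv ℝ (ldFun x.toFun) 0 ≠ 0 ∧
    2 < contactOrder (ldFun x.toFun) (lplFun x.toFun) 0

/-- The space of germs `(M, p)` such that `p` is a regular point of the `LD` and
`m(LD, LPL : p) > 2`. -/
def degenerateGerms : Set SurfaceGerm := {g | ∃ x, Parametrizes x g ∧ DegenerateContact x}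

/-! Configurations of the three curves. -/

/-- The box `|X| < r`, `|Y| < ρ` around the origin, in the linear coordinates `(X, Y)` on the
parameter plane given by `A`. -/
def box (A : Plane ≃L[ℝ] Plane) (r ρ : ℝ) : Set Plane :=
  {q | ∃ X Y : ℝ, |X| < r ∧ |Y| < ρ ∧ q = A (X, Y)}

/-- In the box, the `LD`, the `LPL` and the `MCNC` are regular curves, the graphs `Y = α X`,
`Y = β X` and `Y = η X` of smooth functions; the Lorentzian region lies above the `LD`; the `LPL`
meets the `LD` only on the `MCNC`; it lies strictly between the `LD` and the `MCNC` where the `MCNC`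
is on the Lorentzian side of the `LD`, and it lies on the Lorentzian side where the `MCNC` is on
the Riemannian side. -/
structure LocalPicture (x : Plane → R31) (A : Plane ≃L[ℝ] Plane) (r ρ : ℝ) (α β η : ℝ → ℝ) :
    Prop where
  ld_regular : ∀ q ∈ box A r ρ, fderiv ℝ (ldFun x) q ≠ 0
  lpl_regular : ∀ q ∈ box A r ρ, fderiv ℝ (lplFun x) q ≠ 0
  mcnc_regular : ∀ q ∈ box A r ρ, fderiv ℝ (mcncFun x) q ≠ 0
  smooth_ld : ContDiffOn ℝ ∞ α (Ioo (-r) r)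
  smooth_lpl : ContDiffOn ℝ ∞ β (Ioo (-r) r)
  smooth_mcnc : ContDiffOn ℝ ∞ η (Ioo (-r) r)
  mem_box : ∀ X, |X| < r → |α X| < ρ ∧ |β X| < ρ ∧ |η X| < ρ
  ld_iff : ∀ X Y, |X| < r → |Y| < ρ → (A (X, Y) ∈ LD x ↔ Y = α X)
  lpl_iff : ∀ X Y, |X| < r → |Y| < ρ → (A (X, Y) ∈ LPL x ↔ Y = β X)
  mcnc_iff : ∀ X Y, |X| < r → |Y| < ρ → (A (X, Y) ∈ MCNC x ↔ Y = η X)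
  lorentzian_iff : ∀ X Y, |X| < r → |Y| < ρ → (0 < ldFun x (A (X, Y)) ↔ α X < Y)
  order_pos : ∀ X, |X| < r → α X < η X → α X < β X ∧ β X < η X
  order_neg : ∀ X, |X| < r → η X < α X → α X < β X
  order_zero : ∀ X, |X| < r → η X = α X → β X = α X

/-- The configuration of type `s` at the point `p` (the origin of the parameter plane): near `p` the
three curves are regular and meet only at `p`, and the rest of the `MCNC` is in the Lorentzian
region if `s = 1`, in the Riemannian region if `s = -1`. -/
def Configuration (x : Plane → R31) (s : ℝ) : Prop :=
  ∃ A : Plane ≃L[ℝ] Plane, ∀ κ : ℝ, 0 < κ → ∃ r ρ : ℝ, 0 < r ∧ r < κ ∧ 0 < ρ ∧ ρ < κ ∧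
    ∃ α β η : ℝ → ℝ, LocalPicture x A r ρ α β η ∧
      α 0 = 0 ∧ β 0 = 0 ∧ η 0 = 0 ∧ ∀ X, |X| < r → X ≠ 0 → 0 < s * (η X - α X)

/-! One-parameter families. -/

/-- A representative of a germ of a smooth 1-parameter family of surfaces `M_t`, given by
parametrisations `x_t = X (t, ·)` with `x_0 = x`. -/
structure Deformation (x : LocalParam) where
  toFun : ℝ × Plane → R31
  smooth : SmoothNear toFun 0
  at_zero : ∀ᶠ q in 𝓝 (0 : Plane), toFun (0, q) = x.toFun q

/-- The jet topology on the deformations of `x`. -/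
instance (x : LocalParam) : TopologicalSpace (Deformation x) :=
  TopologicalSpace.induced
    (fun (X : Deformation x) (k : ℕ) => iteratedFDeriv ℝ k X.toFun 0) inferInstance

/-- The parametrisation `x_t` of the surface `M_t`. -/
def Deformation.slice {x : LocalParam} (X : Deformation x) (t : ℝ) : Plane → R31 :=
  fun q => X.toFun (t, q)

/-- `Y` parametrises the same family of surfaces as `X`, by a change of parameters depending
smoothly on `t`. -/
def SameFamily {x : LocalParam} (X Y : Deformation x) : Prop :=
  ∃ ψ : ℝ × Plane → Plane, SmoothNear ψ 0 ∧ ψ 0 = 0 ∧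
    ∀ᶠ z in 𝓝 (0 : ℝ × Plane), Y.toFun z = X.toFun (z.1, ψ z)

/-- The configuration of type `s` bifurcates in the family `X`: in arbitrarily small boxes, the
three curves of `M_t` are regular and deform smoothly; for `t = 0` the configuration is of type `s`;
for `σ t < 0` they are pairwise disjoint; for `σ t > 0` any two of them meet exactly in the same two
points, where the `MCNC_t` crosses the `LD_t` and the `LPL_t` transversally and the `LD_t` and
the `LPL_t` have an ordinary tangency. -/
def Bifurcates {x : LocalParam} (X : Deformation x) (s σ : ℝ) : Prop :=
  ∃ A : Plane ≃L[ℝ] Plane, ∀ κ : ℝ, 0 < κ →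
    ∃ r ρ ε : ℝ, 0 < r ∧ r < κ ∧ 0 < ρ ∧ ρ < κ ∧ 0 < ε ∧ ε < κ ∧
    ∃ α β η : ℝ → ℝ → ℝ,
      ContDiffOn ℝ ∞ (fun z : ℝ × ℝ => α z.1 z.2) (Ioo (-ε) ε ×ˢ Ioo (-r) r) ∧
      ContDiffOn ℝ ∞ (fun z : ℝ × ℝ => β z.1 z.2) (Ioo (-ε) ε ×ˢ Ioo (-r) r) ∧
      ContDiffOn ℝ ∞ (fun z : ℝ × ℝ => η z.1 z.2) (Ioo (-ε) ε ×ˢ Ioo (-r) r) ∧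
      (∀ t, |t| < ε → LocalPicture (X.slice t) A r ρ (α t) (β t) (η t)) ∧
      (α 0 0 = 0 ∧ β 0 0 = 0 ∧ η 0 0 = 0 ∧
        ∀ y, |y| < r → y ≠ 0 → 0 < s * (η 0 y - α 0 y)) ∧
      (∀ t, |t| < ε → σ * t < 0 →
        (∀ y, |y| < r → 0 < s * (η t y - α t y)) ∧
        LD (X.slice t) ∩ MCNC (X.slice t) ∩ box A r ρ = ∅ ∧
        LD (X.slice t) ∩ LPL (X.slice t) ∩ box A r ρ = ∅ ∧
        LPL (X.slice t) ∩ MCNC (X.slice t) ∩ box A r ρ = ∅) ∧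
      (∀ t, |t| < ε → 0 < σ * t → ∃ a b : ℝ, -r < a ∧ a < b ∧ b < r ∧
        (∀ y, |y| < r → y < a ∨ b < y → 0 < s * (η t y - α t y)) ∧
        (∀ y, a < y → y < b → s * (η t y - α t y) < 0) ∧
        LD (X.slice t) ∩ MCNC (X.slice t) ∩ box A r ρ = {A (a, α t a), A (b, α t b)} ∧
        LD (X.slice t) ∩ LPL (X.slice t) ∩ box A r ρ = {A (a, α t a), A (b, α t b)} ∧
        LPL (X.slice t) ∩ MCNC (X.slice t) ∩ box A r ρ = {A (a, α t a), A (b, α t b)} ∧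
        ∀ q, q = A (a, α t a) ∨ q = A (b, α t b) →
          contactOrder (ldFun (X.slice t)) (mcncFun (X.slice t)) q = 1 ∧
          contactOrder (lplFun (X.slice t)) (mcncFun (X.slice t)) q = 1 ∧
          contactOrder (ldFun (X.slice t)) (lplFun (X.slice t)) q = 2)

/-- A property of 1-parameter families deforming `x` holds generically: it holds on an open dense
set of families, which does not depend on how the surfaces of the family are parametrised. -/
def GenericFamily (x : LocalParam) (P : Deformation x → Prop) : Prop :=
  ∃ O : Set (Deformation x), IsOpen O ∧ Dense O ∧
    (∀ X ∈ O, ∀ Y, SameFamily X Y → Y ∈ O) ∧ ∀ X ∈ O, P X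

/-- A property of germs of surfaces is generic in `S` if the germs of `S` which have it form an open
dense subset of `S`. -/
def GenericIn (S : Set SurfaceGerm) (P : SurfaceGerm → Prop) : Prop :=
  IsOpen {g : S | P g} ∧ Dense {g : S | P g}

/-- In every parametrisation, `m(LD, LPL : p) = 4`, `m(LD, MCNC : p) = 2`, the three curves have the
configuration of type `s` at `p`, and this configuration bifurcates, at `t = 0`, in generic
1-parameter families. -/
def ContactBifurcation (s : ℝ) (g : SurfaceGerm) : Prop :=
  ∀ x : LocalParam, Parametrizes x g →
    contactOrder (ldFun x.toFun) (lplFun x.toFun) 0 = 4 ∧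
    contactOrder (ldFun x.toFun) (mcncFun x.toFun) 0 = 2 ∧
    Configuration x.toFun s ∧
    GenericFamily x fun X => ∃ σ : ℝ, (σ = 1 ∨ σ = -1) ∧ Bifurcates X s σ

end MinkowskiSurface

end

open MinkowskiSurface

/-! Write δ for the function defining the `LD`, H for the one defining the `MCNC`, and L, M, N for
the coefficients of the second fundamental form. Everything rests on `lplFun_eq`: the function
defining the `LPL` is H² + 4δκ, where κ = LN - M². On the `LD` it reduces to H², so the `LD` has
twice as much contact with the `LPL` as with the `MCNC`. In particular, contact greater than 2 with
the `LPL` means that H = 0 and dH = l dδ at p for some number l (`degenerateContact_iff`).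

At such a point κ < 0 (`DegenerateContact.kapFun_neg`): if x_u spans the kernel of the metric, then
H = 0 forces L = 0 and dδ ≠ 0 forces M ≠ 0. Where δ = H = 0, the differential of H² + 4δκ is 4κ dδ,
so the `LPL` is regular and tangent to the `LD`. Its position is read off from the value H² of the
discriminant on the `LD` and its value 4δκ on the `MCNC` (`exists_curveData`). Only the relative
position of the `LD` and the `MCNC` remains to be understood.

The generic condition is `FoldContact`: l ≠ 0, and H restricted to the `LD` vanishes to order
exactly two. Equivalently, δ restricted to the `MCNC` has a nondegenerate extremum at p; the sign s
tells a minimum from a maximum. In a family, δ restricted to the moving `MCNC` is a function of t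
and of the position on the curve. If its t-derivative at the origin is nonzero, it has no zeros for
one sign of t and two simple zeros for the other (`exists_fold`); `bifurcates_of_fold` translates
this into the three curves. Up to a nonzero factor that derivative is `splitting`, the t-derivative
of H - lδ. It depends continuously on jets, is unchanged by t-dependent changes of parameters
because dH = l dδ (`splitting_eq_of_sameFamily`), and becomes nonzero after adding t times a
quadratic form in a transverse direction (`dense_splitting_ne_zero`).

A change of parameters with jacobian J multiplies δ, H, κ by J², J³, J⁴. The quantity whose sign
decides `FoldContact` is then multiplied by an even power of J, so s belongs to the germ
(`FoldContact.of_reparam`). Density comes from a cubic and a quartic perturbation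
(`exists_foldContact_mem`). Openness holds because the condition is the nonvanishing of a polynomial
in 2-jets of δ and H (`tangency_ne_zero_iff`). Two graphs over a lightlike plane realise both signs.
-/

noncomputable section

namespace MinkowskiSurface

/-! Graphs of implicit functions, and fold points of functions of two variables. -/

/-! ### Calculus of maps that are smooth near a point. -/

section SmoothNear

variable {E F G : Type*} [NormedAddCommGroup E] [NormedSpace ℝ E]
  [NormedAddCommGroup F] [NormedSpace ℝ F] [NormedAddCommGroup G] [NormedSpace ℝ G]

theorem SmoothNear.contDiffAt {f : E → F} {a : E} (hf : SmoothNear f a) : ContDiffAt ℝ ∞ f a :=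
  hf.self_of_nhds

theorem SmoothNear.differentiableAt {f : E → F} {a : E} (hf : SmoothNear f a) :
    DifferentiableAt ℝ f a :=
  hf.contDiffAt.differentiableAt (by simp)

theorem SmoothNear.eventually_differentiableAt {f : E → F} {a : E} (hf : SmoothNear f a) :
    ∀ᶠ z in 𝓝 a, DifferentiableAt ℝ f z :=
  hf.mono fun _ h => h.differentiableAt (by simp)

theorem SmoothNear.congr {f g : E → F} {a : E} (hf : SmoothNear f a) (h : f =ᶠ[𝓝 a] g) :
    SmoothNear g a := by
  unfold SmoothNear
  filter_upwards [hf, h.eventuallyEq_nhds] with z h1 h2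
  exact h1.congr_of_eventuallyEq h2.symm

theorem SmoothNear.comp {g : F → G} {f : E → F} {a : E} (hg : SmoothNear g (f a))
    (hf : SmoothNear f a) : SmoothNear (fun z => g (f z)) a := by
  unfold SmoothNear
  filter_upwards [hf, hf.contDiffAt.continuousAt.eventually hg] with z h1 h2
  exact ContDiffAt.comp z h2 h1

theorem contDiffAt_fderiv {f : E → F} {a : E} (hf : ContDiffAt ℝ ∞ f a) :
    ContDiffAt ℝ ∞ (fderiv ℝ f) a := hf.fderiv_right (by simp)

theorem SmoothNear.fderiv {f : E → F} {a : E} (hf : SmoothNear f a) :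
    SmoothNear (fderiv ℝ f) a :=
  hf.mono fun _ h => contDiffAt_fderiv h

theorem SmoothNear.fderiv_apply {f : E → F} {a : E} (hf : SmoothNear f a) (v : E) :
    SmoothNear (fun z => _root_.fderiv ℝ f z v) a :=
  hf.fderiv.mono fun _ h => h.clm_apply contDiffAt_const

theorem smoothNear_of_contDiff {f : E → F} (hf : ContDiff ℝ ∞ f) (a : E) : SmoothNear f a :=
  .of_forall fun _ => hf.contDiffAt

theorem SmoothNear.deriv {f : ℝ → F} {a : ℝ} (hf : SmoothNear f a) : SmoothNear (deriv f) a := by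
  have := hf.fderiv_apply (1 : ℝ)
  simpa using this

end SmoothNear

/-- A function which is increasing in the last variable and changes sign has a smooth root. -/
theorem exists_graph {f : ℝ × Plane → ℝ} {ε r ρ : ℝ} (hρ : 0 < ρ)
    (hsm : ∀ t X Y, |t| < ε → |X| < r → |Y| ≤ ρ → ContDiffAt ℝ ∞ f (t, X, Y))
    (hpos : ∀ t X Y, |t| < ε → |X| < r → |Y| ≤ ρ → 0 < fderiv ℝ f (t, X, Y) (0, 0, 1))
    (hlo : ∀ t X, |t| < ε → |X| < r → f (t, X, -ρ) < 0)
    (hhi : ∀ t X, |t| < ε → |X| < r → 0 < f (t, X, ρ)) :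
    ∃ α : ℝ → ℝ → ℝ,
      ContDiffOn ℝ ∞ (fun z : ℝ × ℝ => α z.1 z.2) (Ioo (-ε) ε ×ˢ Ioo (-r) r) ∧
      ∀ t X, |t| < ε → |X| < r → |α t X| < ρ ∧
        ∀ Y, |Y| ≤ ρ → (f (t, X, Y) = 0 ↔ Y = α t X) ∧ (0 < f (t, X, Y) ↔ α t X < Y) := by
  have hmono : ∀ t X, |t| < ε → |X| < r → StrictMonoOn (fun Y => f (t, X, Y)) (Icc (-ρ) ρ) := by
    intro t X ht hX
    have hd : ∀ Y ∈ Icc (-ρ) ρ, HasDerivAt (fun Y => f (t, X, Y))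
        (fderiv ℝ f (t, X, Y) (0, 0, 1)) Y := by
      intro Y hY
      have h1 : HasDerivAt (fun Y : ℝ => (t, X, Y)) ((0 : ℝ), (0 : ℝ), (1 : ℝ)) Y :=
        (hasDerivAt_const Y t).prodMk ((hasDerivAt_const Y X).prodMk (hasDerivAt_id Y))
      exact ((hsm t X Y ht hX (abs_le.2 hY)).differentiableAt (by simp)).hasFDerivAt.comp_hasDerivAt
        Y h1
    refine strictMonoOn_of_deriv_pos (convex_Icc _ _)
      (fun Y hY => (hd Y hY).continuousAt.continuousWithinAt) ?_
    intro Y hY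
    have hY := interior_subset (s := Icc (-ρ) ρ) hY
    rw [(hd Y hY).deriv]
    exact hpos t X Y ht hX (abs_le.2 hY)
  have hex : ∀ t X, ∃ Y, |t| < ε → |X| < r → Y ∈ Ioo (-ρ) ρ ∧ f (t, X, Y) = 0 := by
    intro t X
    by_cases ht : |t| < ε
    · by_cases hX : |X| < r
      · have hc : ContinuousOn (fun Y => f (t, X, Y)) (Icc (-ρ) ρ) := by
          intro Y hY
          have := (hsm t X Y ht hX (abs_le.2 hY)).continuousAt
          exact (this.comp (f := fun Y : ℝ => (t, X, Y)) (by fun_prop)).continuousWithinAt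
        obtain ⟨Y, hY, h0⟩ := intermediate_value_Ioo (by linarith) hc
          ⟨hlo t X ht hX, hhi t X ht hX⟩
        exact ⟨Y, fun _ _ => ⟨hY, h0⟩⟩
      · exact ⟨0, fun _ h => absurd h hX⟩
    · exact ⟨0, fun h => absurd h ht⟩
  choose α hα using hex
  have key : ∀ t X, |t| < ε → |X| < r → |α t X| < ρ ∧
        ∀ Y, |Y| ≤ ρ → (f (t, X, Y) = 0 ↔ Y = α t X) ∧ (0 < f (t, X, Y) ↔ α t X < Y) := by
    intro t X ht hX
    obtain ⟨hI, h0⟩ := hα t X ht hX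
    refine ⟨abs_lt.2 hI, fun Y hY => ?_⟩
    have hm := hmono t X ht hX
    have hY' := abs_le.1 hY
    have hI' := Ioo_subset_Icc_self hI
    refine ⟨⟨fun h => hm.injOn hY' hI' (h.trans h0.symm), fun h => h ▸ h0⟩, ?_⟩
    rw [← hm.lt_iff_lt hI' hY']
    simp [h0]
  refine ⟨α, ?_, key⟩
  rintro ⟨t, X⟩ ⟨ht, hX⟩
  have ht' := abs_lt.2 ht
  have hX' := abs_lt.2 hX
  apply ContDiffAt.contDiffWithinAt
  -- Reassociated so that the variable to be solved for is the second factor of a product, as the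
  -- implicit function theorem requires.
  let g : (ℝ × ℝ) × ℝ → ℝ := fun z => f (z.1.1, z.1.2, z.2)
  have hαρ := (key t X ht' hX').1
  have hf := hsm t X (α t X) ht' hX' hαρ.le
  have hg : ContDiffAt ℝ ∞ g ((t, X), α t X) :=
    ContDiffAt.comp ((t, X), α t X) (g := f) (f := fun z : (ℝ × ℝ) × ℝ => (z.1.1, z.1.2, z.2)) hf
      (by fun_prop)
  have hgd : fderiv ℝ g ((t, X), α t X) ∘L .inr ℝ (ℝ × ℝ) ℝ =
      (fderiv ℝ f (t, X, α t X) (0, 0, 1)) • ContinuousLinearMap.id ℝ ℝ := by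
    have h1 := (((ContinuousLinearMap.fst ℝ ℝ ℝ).comp (ContinuousLinearMap.fst ℝ (ℝ × ℝ) ℝ)).prod
      (((ContinuousLinearMap.snd ℝ ℝ ℝ).comp (ContinuousLinearMap.fst ℝ (ℝ × ℝ) ℝ)).prod
        (ContinuousLinearMap.snd ℝ (ℝ × ℝ) ℝ))).hasFDerivAt (x := ((t, X), α t X))
    have h2 := HasFDerivAt.comp (g := f) ((t, X), α t X)
      (hf.differentiableAt (by simp)).hasFDerivAt h1
    have h3 : fderiv ℝ g ((t, X), α t X) = _ := h2.fderiv
    rw [h3]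
    ext
    simp
  have hinv : (fderiv ℝ g ((t, X), α t X) ∘L .inr ℝ (ℝ × ℝ) ℝ).IsInvertible := by
    rw [hgd]
    have hne := (hpos t X (α t X) ht' hX' hαρ.le).ne'
    exact ContinuousLinearMap.IsInvertible.of_inverse
      (g := (fderiv ℝ f (t, X, α t X) (0, 0, 1))⁻¹ • ContinuousLinearMap.id ℝ ℝ)
      (by ext; simp [hne]) (by ext; simp [hne])
  have hn : (∞ : WithTop ℕ∞) ≠ 0 := by simp
  have c1 := hg.contDiffAt_implicitFunction hn hinv
  have c2 := hg.implicitFunction_apply_self hn hinv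
  have c3 := hg.eventually_apply_implicitFunction hn hinv
  -- The implicit function is smooth and stays in |Y| < ρ near (t, X). The root there is unique, so
  -- it coincides with `α`.
  refine c1.congr_of_eventuallyEq ?_
  have c4 : ∀ᶠ z in 𝓝 (t, X), |hg.implicitFunction hn hinv z| < ρ := by
    refine (c1.continuousAt.abs).eventually (gt_mem_nhds ?_)
    simpa [c2] using hαρ
  have c5 : ∀ᶠ z in 𝓝 (t, X), z ∈ Ioo (-ε) ε ×ˢ Ioo (-r) r :=
    (isOpen_Ioo.prod isOpen_Ioo).mem_nhds ⟨ht, hX⟩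
  filter_upwards [c3, c4, c5] with z z3 z4 z5
  have h0 : g ((t, X), α t X) = 0 := (hα t X ht' hX').2
  rw [h0] at z3
  exact ((((key z.1 z.2 (abs_lt.2 z5.1) (abs_lt.2 z5.2)).2 _ z4.le).1).1 z3).symm

/-- Boxes form a basis of neighbourhoods of the origin. -/
theorem exists_box_of_eventually {P : ℝ × Plane → Prop} (h : ∀ᶠ z in 𝓝 (0 : ℝ × Plane), P z) :
    ∃ ρ > 0, ∀ t X Y : ℝ, |t| ≤ ρ → |X| ≤ ρ → |Y| ≤ ρ → P (t, X, Y) := by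
  obtain ⟨ρ, hρ, h⟩ := Metric.eventually_nhds_iff.1 h
  refine ⟨ρ / 2, by positivity, fun t X Y ht hX hY => h ?_⟩
  rw [dist_zero_right, Prod.norm_def, Prod.norm_def]
  simp only [Real.norm_eq_abs, max_lt_iff]
  exact ⟨by linarith, by linarith, by linarith⟩

/-- Near a zero at which it increases in the last variable, a function changes sign across
suitable boxes. -/
theorem exists_sign_box {f : ℝ × Plane → ℝ} {ρ : ℝ} (hρ : 0 < ρ) (h0 : f 0 = 0)
    (hsm : ∀ t X Y : ℝ, |t| ≤ ρ → |X| ≤ ρ → |Y| ≤ ρ → ContDiffAt ℝ ∞ f (t, X, Y))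
    (hpos : ∀ t X Y : ℝ, |t| ≤ ρ → |X| ≤ ρ → |Y| ≤ ρ → 0 < fderiv ℝ f (t, X, Y) (0, 0, 1)) :
    ∃ r > 0, r ≤ ρ ∧ ∀ t X, |t| < r → |X| < r → f (t, X, -ρ) < 0 ∧ 0 < f (t, X, ρ) := by
  have hd : ∀ Y ∈ Icc (-ρ) ρ, HasDerivAt (fun Y => f (0, 0, Y))
      (fderiv ℝ f (0, 0, Y) (0, 0, 1)) Y := by
    intro Y hY
    have h1 : HasDerivAt (fun Y : ℝ => ((0 : ℝ), (0 : ℝ), Y)) ((0 : ℝ), (0 : ℝ), (1 : ℝ)) Y :=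
      (hasDerivAt_const Y _).prodMk ((hasDerivAt_const Y _).prodMk (hasDerivAt_id Y))
    exact ((hsm 0 0 Y (by simpa using hρ.le) (by simpa using hρ.le) (abs_le.2 hY)).differentiableAt
      (by simp)).hasFDerivAt.comp_hasDerivAt Y h1
  have hm : StrictMonoOn (fun Y => f (0, 0, Y)) (Icc (-ρ) ρ) := by
    refine strictMonoOn_of_deriv_pos (convex_Icc _ _)
      (fun Y hY => (hd Y hY).continuousAt.continuousWithinAt) ?_
    intro Y hY
    have hY := interior_subset (s := Icc (-ρ) ρ) hY
    rw [(hd Y hY).deriv]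
    exact hpos 0 0 Y (by simpa using hρ.le) (by simpa using hρ.le) (abs_le.2 hY)
  have h0' : f (0, 0, 0) = 0 := h0
  have hlo : f (0, 0, -ρ) < 0 := by
    have := hm (a := -ρ) (b := 0) ⟨le_rfl, by linarith⟩ ⟨by linarith, hρ.le⟩ (by linarith)
    simpa [h0'] using this
  have hhi : 0 < f (0, 0, ρ) := by
    have := hm (a := 0) (b := ρ) ⟨by linarith, hρ.le⟩ ⟨by linarith, le_rfl⟩ hρ
    simpa [h0'] using this
  have c : ∀ Y, |Y| ≤ ρ → ContinuousAt (fun z : ℝ × ℝ => f (z.1, z.2, Y)) 0 := by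
    intro Y hY
    have := (hsm 0 0 Y (by simpa using hρ.le) (by simpa using hρ.le) hY).continuousAt
    exact ContinuousAt.comp (g := f) (f := fun z : ℝ × ℝ => (z.1, z.2, Y)) (x := 0) this
      (by fun_prop)
  -- The signs at the two end points of the vertical segment over (0, 0) persist for nearby (t, X).
  have e1 := (c (-ρ) (by simp [abs_of_pos hρ])).eventually (gt_mem_nhds hlo)
  have e2 := (c ρ (by simp [abs_of_pos hρ])).eventually (lt_mem_nhds hhi)
  obtain ⟨r, hr, h⟩ := Metric.eventually_nhds_iff.1 (e1.and e2)
  refine ⟨min r ρ, lt_min hr hρ, min_le_right _ _, fun t X ht hX => ?_⟩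
  refine h (y := (t, X)) ?_
  rw [dist_zero_right, Prod.norm_def]
  simp only [Real.norm_eq_abs, max_lt_iff]
  exact ⟨ht.trans_le (min_le_left _ _), hX.trans_le (min_le_left _ _)⟩

/-- The unfolding of a fold point: a function `W` with a nondegenerate minimum of value `0` in the
second variable, whose derivative in the first variable does not vanish, has no zeros or
two simple zeros according to the sign of the first variable. -/
theorem exists_fold {W : ℝ × ℝ → ℝ} (hW : SmoothNear W 0) (h0 : W 0 = 0)
    (hX : fderiv ℝ W 0 (0, 1) = 0) (hXX : 0 < fderiv ℝ (fderiv ℝ W) 0 (0, 1) (0, 1))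
    {σ : ℝ} (hσ : σ = 1 ∨ σ = -1) (ht : σ * fderiv ℝ W 0 (1, 0) < 0) {r₀ : ℝ} (hr₀ : 0 < r₀) :
    ∃ r, 0 < r ∧ r < r₀ ∧ ∃ ε, 0 < ε ∧ ε < r₀ ∧
      (∀ X, |X| < r → X ≠ 0 → 0 < W (0, X)) ∧
      (∀ t, |t| < ε → σ * t < 0 → ∀ X, |X| < r → 0 < W (t, X)) ∧
      ∀ t, |t| < ε → 0 < σ * t → ∃ a b, -r < a ∧ a < b ∧ b < r ∧
        (∀ X, |X| < r → X < a ∨ b < X → 0 < W (t, X)) ∧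
        (∀ X, a < X → X < b → W (t, X) < 0) ∧
        W (t, a) = 0 ∧ W (t, b) = 0 ∧
        fderiv ℝ W (t, a) (0, 1) ≠ 0 ∧ fderiv ℝ W (t, b) (0, 1) ≠ 0 := by
  have hW1 : SmoothNear (fun z => fderiv ℝ W z (1, 0)) 0 := hW.fderiv_apply _
  have hW2 : SmoothNear (fun z => fderiv ℝ W z (0, 1)) 0 := hW.fderiv_apply _
  have hW3 : SmoothNear (fun z => fderiv ℝ (fun z => fderiv ℝ W z (0, 1)) z (0, 1)) 0 :=
    hW2.fderiv_apply _
  have hXX' : 0 < fderiv ℝ (fun z => fderiv ℝ W z (0, 1)) 0 (0, 1) := by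
    rw [fderiv_clm_apply hW.fderiv.differentiableAt (differentiableAt_const _)]
    simpa using hXX
  have e1 := hW3.contDiffAt.continuousAt.eventually (lt_mem_nhds hXX')
  have e2 := (continuousAt_const.mul hW1.contDiffAt.continuousAt).eventually (gt_mem_nhds ht)
  obtain ⟨r₁, hr₁, h⟩ := Metric.eventually_nhds_iff.1
    (((hW.and hW2).and (e1.and e2)))
  set r := min (r₁ / 2) (r₀ / 2) with hr
  have hr0 : 0 < r := lt_min (by positivity) (by positivity)
  have hrr : r < r₁ := (min_le_left _ _).trans_lt (by linarith)
  have hbox : ∀ t X : ℝ, |t| ≤ r → |X| ≤ r → dist (t, X) (0 : ℝ × ℝ) < r₁ := by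
    intro t X h1 h2
    rw [dist_zero_right, Prod.norm_def]
    simp only [Real.norm_eq_abs, max_lt_iff]
    exact ⟨by linarith, by linarith⟩
  have hdX : ∀ t X : ℝ, |t| ≤ r → |X| ≤ r →
      HasDerivAt (fun X => W (t, X)) (fderiv ℝ W (t, X) (0, 1)) X := by
    intro t X h1 h2
    exact ((h (hbox t X h1 h2)).1.1.differentiableAt (by simp)).hasFDerivAt.comp_hasDerivAt X
      ((hasDerivAt_const X t).prodMk (hasDerivAt_id X))
  have hdt : ∀ t X : ℝ, |t| ≤ r → |X| ≤ r →
      HasDerivAt (fun t => W (t, X)) (fderiv ℝ W (t, X) (1, 0)) t := by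
    intro t X h1 h2
    exact ((h (hbox t X h1 h2)).1.1.differentiableAt (by simp)).hasFDerivAt.comp_hasDerivAt t
      ((hasDerivAt_id t).prodMk (hasDerivAt_const t X))
  have hdXX : ∀ t X : ℝ, |t| ≤ r → |X| ≤ r →
      HasDerivAt (fun X => fderiv ℝ W (t, X) (0, 1))
        (fderiv ℝ (fun z => fderiv ℝ W z (0, 1)) (t, X) (0, 1)) X := by
    intro t X h1 h2
    exact HasFDerivAt.comp_hasDerivAt (l := fun z => fderiv ℝ W z (0, 1)) X
      ((h (hbox t X h1 h2)).1.2.differentiableAt (by simp)).hasFDerivAt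
      ((hasDerivAt_const X t).prodMk (hasDerivAt_id X))
  -- The second X-derivative is positive on the whole box, so every `W (t, ·)` is strictly convex.
  have hmono : ∀ t, |t| ≤ r → StrictMonoOn (fun X => fderiv ℝ W (t, X) (0, 1)) (Icc (-r) r) := by
    intro t ht'
    refine strictMonoOn_of_deriv_pos (convex_Icc _ _)
      (fun X hX => (hdXX t X ht' (abs_le.2 hX)).continuousAt.continuousWithinAt) fun X hX => ?_
    have hX := abs_le.2 (interior_subset (s := Icc (-r) r) hX)
    rw [(hdXX t X ht' hX).deriv]
    exact (h (hbox t X ht' hX)).2.1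
  have hcont : ∀ t, |t| ≤ r → ContinuousOn (fun X => W (t, X)) (Icc (-r) r) := fun t ht' X hX =>
    (hdX t X ht' (abs_le.2 hX)).continuousAt.continuousWithinAt
  have hconv : ∀ t, |t| ≤ r → StrictConvexOn ℝ (Icc (-r) r) (fun X => W (t, X)) := by
    intro t ht'
    refine StrictMonoOn.strictConvexOn_of_deriv (convex_Icc _ _) (hcont t ht') ?_
    intro X hX Y hY hXY
    have hX := interior_subset (s := Icc (-r) r) hX
    have hY := interior_subset (s := Icc (-r) r) hY
    rw [(hdX t X ht' (abs_le.2 hX)).deriv, (hdX t Y ht' (abs_le.2 hY)).deriv]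
    exact hmono t ht' hX hY hXY
  have hr' : |r| ≤ r := (abs_of_pos hr0).le
  have hnr' : |-r| ≤ r := by simp [abs_of_pos hr0]
  have h00 : |(0 : ℝ)| ≤ r := by simpa using hr0.le
  have m0 : (0 : ℝ) ∈ Icc (-r) r := ⟨by linarith, hr0.le⟩
  -- By the mean value theorem: the X-derivative of `W (0, ·)` vanishes at 0 and is increasing.
  have hpos0 : ∀ X, |X| ≤ r → X ≠ 0 → 0 < W (0, X) := by
    intro X hXr hX0
    have hX' := abs_le.1 hXr
    rcases lt_or_gt_of_ne hX0 with hlt | hgt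
    · obtain ⟨ξ, hξ, he⟩ := exists_hasDerivAt_eq_slope (fun X => W (0, X)) _ hlt
        ((hcont 0 h00).mono (Icc_subset_Icc hX'.1 hr0.le))
        (fun ξ hξ => hdX 0 ξ h00 (abs_le.2 ⟨by linarith [hξ.1], by linarith [hξ.2]⟩))
      have := hmono 0 h00 (a := ξ) (b := 0) ⟨by linarith [hξ.1], by linarith [hξ.2]⟩ m0 hξ.2
      have hX2 : fderiv ℝ W (0, 0) (0, 1) = 0 := hX
      have h02 : W (0, 0) = 0 := h0
      simp only [hX2] at this
      rw [he, h02, div_neg_iff] at this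
      rcases this with h | h <;> linarith
    · obtain ⟨ξ, hξ, he⟩ := exists_hasDerivAt_eq_slope (fun X => W (0, X)) _ hgt
        ((hcont 0 h00).mono (Icc_subset_Icc (by linarith) hX'.2))
        (fun ξ hξ => hdX 0 ξ h00 (abs_le.2 ⟨by linarith [hξ.1], by linarith [hξ.2]⟩))
      have := hmono 0 h00 (a := 0) (b := ξ) m0 ⟨by linarith [hξ.1], by linarith [hξ.2]⟩ hξ.1
      have hX2 : fderiv ℝ W (0, 0) (0, 1) = 0 := hX
      have h02 : W (0, 0) = 0 := h0
      simp only [hX2] at this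
      rw [he, h02, div_pos_iff] at this
      rcases this with h | h <;> linarith
  have hpos0' : ∀ X, |X| ≤ r → 0 ≤ W (0, X) := by
    intro X hXr
    rcases eq_or_ne X 0 with rfl | hne
    · exact le_of_eq h0.symm
    · exact (hpos0 X hXr hne).le
  -- The t-derivative of `W` has the sign of -σ on the box. Hence the graph of `W (t, ·)` lies above
  -- that of `W (0, ·)` when σ t < 0 and below it when σ t > 0.
  have hmt : ∀ X, |X| ≤ r → StrictMonoOn (fun t => -σ * W (t, X)) (Icc (-r) r) := by
    intro X hXr
    refine strictMonoOn_of_deriv_pos (convex_Icc _ _)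
      (fun t ht' => ((hdt t X (abs_le.2 ht') hXr).const_mul (-σ)).continuousAt.continuousWithinAt)
      fun t ht' => ?_
    have ht' := abs_le.2 (interior_subset (s := Icc (-r) r) ht')
    rw [((hdt t X ht' hXr).const_mul (-σ)).deriv]
    have : σ * fderiv ℝ W (t, X) (1, 0) < 0 := (h (hbox t X ht' hXr)).2.2
    linarith
  have hmt1 : ∀ t X, |t| ≤ r → |X| ≤ r → σ * t < 0 → W (0, X) < W (t, X) := by
    intro t X ht' hXr hs
    rcases hσ with rfl | rfl
    · have := hmt X hXr (abs_le.1 ht') m0 (by linarith)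
      simp only at this; linarith
    · have := hmt X hXr m0 (abs_le.1 ht') (by linarith)
      simp only at this; linarith
  have hmt2 : ∀ t X, |t| ≤ r → |X| ≤ r → 0 < σ * t → W (t, X) < W (0, X) := by
    intro t X ht' hXr hs
    rcases hσ with rfl | rfl
    · have := hmt X hXr m0 (abs_le.1 ht') (by linarith)
      simp only at this; linarith
    · have := hmt X hXr (abs_le.1 ht') m0 (by linarith)
      simp only at this; linarith
  -- For small t, `W (t, ·)` stays positive at ±r. When σ t > 0 it is negative at 0, which gives a
  -- zero on either side.
  have f1 := (hdt 0 r h00 hr').continuousAt.eventually (lt_mem_nhds (hpos0 r hr' hr0.ne'))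
  have f2 := (hdt 0 (-r) h00 hnr').continuousAt.eventually
    (lt_mem_nhds (hpos0 (-r) hnr' (by simpa using hr0.ne')))
  obtain ⟨ε, hε, hεt⟩ := Metric.eventually_nhds_iff.1 (f1.and f2)
  refine ⟨r, hr0, (min_le_right _ _).trans_lt (by linarith), min ε r, lt_min hε hr0,
    (min_le_right _ _).trans_lt ((min_le_right _ _).trans_lt (by linarith)),
    fun X hXr => hpos0 X hXr.le, fun t ht' hs X hXr => ?_, fun t ht' hs => ?_⟩
  · exact (hpos0' X hXr.le).trans_lt (hmt1 t X (ht'.le.trans (min_le_right _ _)) hXr.le hs)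
  have htr : |t| ≤ r := ht'.le.trans (min_le_right _ _)
  obtain ⟨g1, g2⟩ := hεt (y := t) (by simpa using ht'.trans_le (min_le_left _ _))
  have g0 : W (t, 0) < 0 := (hmt2 t 0 htr h00 hs).trans_le h0.le
  obtain ⟨a, ⟨ha1, ha2⟩, ha0⟩ := intermediate_value_Ioo' (by linarith : -r ≤ 0)
    ((hcont t htr).mono (Icc_subset_Icc le_rfl hr0.le)) ⟨g0, g2⟩
  obtain ⟨b, ⟨hb1, hb2⟩, hb0⟩ := intermediate_value_Ioo hr0.le
    ((hcont t htr).mono (Icc_subset_Icc (by linarith) le_rfl)) ⟨g0, g1⟩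
  simp only at ha0 hb0
  have ma : a ∈ Icc (-r) r := ⟨ha1.le, by linarith⟩
  have mb : b ∈ Icc (-r) r := ⟨by linarith, hb2.le⟩
  -- The chord from a to 0 has negative slope, attained as a derivative at some ξ > a; the
  -- derivative at a is smaller still. The zero b is treated symmetrically.
  have da : fderiv ℝ W (t, a) (0, 1) < 0 := by
    obtain ⟨ξ, hξ, he⟩ := exists_hasDerivAt_eq_slope (fun X => W (t, X)) _ ha2
        ((hcont t htr).mono (Icc_subset_Icc ha1.le hr0.le))
        (fun ξ hξ => hdX t ξ htr (abs_le.2 ⟨by linarith [hξ.1], by linarith [hξ.2]⟩))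
    refine (hmono t htr ma ⟨by linarith [hξ.1], by linarith [hξ.2]⟩ hξ.1).trans ?_
    simp only
    rw [he, ha0]
    exact div_neg_of_neg_of_pos (by linarith) (by linarith)
  have db : 0 < fderiv ℝ W (t, b) (0, 1) := by
    obtain ⟨ξ, hξ, he⟩ := exists_hasDerivAt_eq_slope (fun X => W (t, X)) _ hb1
        ((hcont t htr).mono (Icc_subset_Icc (by linarith) hb2.le))
        (fun ξ hξ => hdX t ξ htr (abs_le.2 ⟨by linarith [hξ.1], by linarith [hξ.2]⟩))
    refine lt_trans ?_ (hmono t htr ⟨by linarith [hξ.1], by linarith [hξ.2]⟩ mb hξ.2)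
    simp only
    rw [he, hb0]
    exact div_pos (by linarith) (by linarith)
  refine ⟨a, b, ha1, by linarith, hb2, ?_, ?_, ha0, hb0, da.ne, db.ne'⟩
  · rintro X hXr (hlt | hgt)
    · have hX' := abs_lt.1 hXr
      obtain ⟨ξ, hξ, he⟩ := exists_hasDerivAt_eq_slope (fun X => W (t, X)) _ hlt
        ((hcont t htr).mono (Icc_subset_Icc hX'.1.le (by linarith)))
        (fun ξ hξ => hdX t ξ htr (abs_le.2 ⟨by linarith [hξ.1], by linarith [hξ.2]⟩))
      have := (hmono t htr ⟨by linarith [hξ.1], by linarith [hξ.2]⟩ ma hξ.2).trans da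
      simp only at this
      rw [he, ha0, div_neg_iff] at this
      rcases this with h | h <;> linarith
    · have hX' := abs_lt.1 hXr
      obtain ⟨ξ, hξ, he⟩ := exists_hasDerivAt_eq_slope (fun X => W (t, X)) _ hgt
        ((hcont t htr).mono (Icc_subset_Icc (by linarith) hX'.2.le))
        (fun ξ hξ => hdX t ξ htr (abs_le.2 ⟨by linarith [hξ.1], by linarith [hξ.2]⟩))
      have := db.trans (hmono t htr mb ⟨by linarith [hξ.1], by linarith [hξ.2]⟩ hξ.1)
      simp only at this
      rw [he, hb0, div_pos_iff] at this
      rcases this with h | h <;> linarith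
  · intro X hXa hXb
    have := (hconv t htr).lt_on_openSegment ma mb (show a < b by linarith).ne
      (by rw [openSegment_eq_Ioo (by linarith)]; exact ⟨hXa, hXb⟩)
    simpa [ha0, hb0] using this


/-! Parametrised curves and orders of contact. -/

/-- `γ` is a regular parametrisation at `q` of the curve `φ = 0`. -/
def IsCurveParam (φ : Plane → ℝ) (q : Plane) (γ : ℝ → Plane) : Prop :=
  SmoothNear γ 0 ∧ γ 0 = q ∧ deriv γ 0 ≠ 0 ∧ ∀ᶠ s in 𝓝 (0 : ℝ), φ (γ s) = 0

/-- The linear map with `(1, 0) ↦ (p, q)` which is conformal for the Euclidean metric. -/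
theorem exists_conformal {p q : ℝ} (h : p ≠ 0 ∨ q ≠ 0) :
    ∃ A : Plane ≃L[ℝ] Plane, ∀ X Y, A (X, Y) = (p * X - q * Y, q * X + p * Y) := by
  have hD : p ^ 2 + q ^ 2 ≠ 0 := by
    rcases h with h | h
    · have := sq_pos_of_ne_zero h; positivity
    · have := sq_pos_of_ne_zero h; positivity
  let e : Plane ≃ₗ[ℝ] Plane :=
    { toFun := fun z => (p * z.1 - q * z.2, q * z.1 + p * z.2)
      invFun := fun z => ((p * z.1 + q * z.2) / (p ^ 2 + q ^ 2),
        (p * z.2 - q * z.1) / (p ^ 2 + q ^ 2))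
      map_add' := fun x y => by ext <;> simp <;> ring
      map_smul' := fun c x => by ext <;> simp <;> ring
      left_inv := fun z => by ext <;> simp <;> field_simp <;> ring
      right_inv := fun z => by ext <;> simp <;> field_simp <;> ring }
  exact ⟨e.toContinuousLinearEquiv, fun X Y => rfl⟩

theorem clm_plane_apply (L : Plane →L[ℝ] ℝ) (e : Plane) :
    L e = e.1 * L (1, 0) + e.2 * L (0, 1) := by
  have : e = e.1 • ((1, 0) : Plane) + e.2 • ((0, 1) : Plane) := by ext <;> simp
  conv_lhs => rw [this, map_add, map_smul, map_smul]
  rfl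

theorem clm_plane_ne_zero {L : Plane →L[ℝ] ℝ} : L ≠ 0 ↔ L (1, 0) ≠ 0 ∨ L (0, 1) ≠ 0 := by
  rw [← not_and_or, not_iff_not]
  constructor
  · rintro rfl; simp
  · rintro ⟨h1, h2⟩; refine ContinuousLinearMap.ext fun e => ?_; rw [clm_plane_apply]; simp [h1, h2]

/-- The vectors in the kernel of a nonzero functional on the plane. -/
theorem exists_smul_of_ker {L : Plane →L[ℝ] ℝ} (hL : L ≠ 0) {e e' : Plane} (he : L e = 0)
    (he' : L e' = 0) (h : e ≠ 0) : ∃ c : ℝ, e' = c • e := by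
  obtain ⟨a, b⟩ := e
  obtain ⟨a', b'⟩ := e'
  rw [clm_plane_apply] at he he'
  simp only at he he'
  have hdet : a * b' - b * a' = 0 := by
    rcases clm_plane_ne_zero.1 hL with h | h
    · refine (mul_eq_zero.1 (?_ : (a * b' - b * a') * L (1, 0) = 0)).resolve_right h
      linear_combination b' * he - b * he'
    · refine (mul_eq_zero.1 (?_ : (a * b' - b * a') * L (0, 1) = 0)).resolve_right h
      linear_combination a * he' - a' * he
  by_cases ha : a = 0
  · have hb : b ≠ 0 := fun hb => h (by simp [ha, hb])
    refine ⟨b' / b, ?_⟩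
    have : a' = 0 := by
      simpa [ha, hb] using hdet
    ext <;> simp [ha, this, hb]
  · refine ⟨a' / a, ?_⟩
    ext
    · simp [ha]
    · simp; field_simp; linarith

/-- Linear coordinates adapted to a nonzero functional. -/
theorem exists_adapted_coords {L : Plane →L[ℝ] ℝ} (hL : L ≠ 0) :
    ∃ A : Plane ≃L[ℝ] Plane, L (A (1, 0)) = 0 ∧ 0 < L (A (0, 1)) := by
  have h := clm_plane_ne_zero.1 hL
  obtain ⟨A, hA⟩ := exists_conformal (p := L (0, 1)) (q := -L (1, 0)) (by
    rcases h with h | h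
    · exact Or.inr (neg_ne_zero.2 h)
    · exact Or.inl h)
  refine ⟨A, ?_, ?_⟩
  · rw [hA, clm_plane_apply]; simp; ring
  · rw [hA, clm_plane_apply]; simp
    rcases h with h | h
    · have := mul_self_pos.2 h
      nlinarith [mul_self_nonneg (L (0, 1))]
    · have := mul_self_pos.2 h
      nlinarith [mul_self_nonneg (L (1, 0))]

theorem exists_isCurveParam {φ : Plane → ℝ} {q : Plane} (hφ : SmoothNear φ q) (h0 : φ q = 0)
    (hd : fderiv ℝ φ q ≠ 0) : ∃ γ, IsCurveParam φ q γ := by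
  obtain ⟨A, hA1, hA2⟩ := exists_adapted_coords hd
  -- The first coordinate is a dummy time, present only so that `exists_graph` applies; the curve is
  -- the graph over the tangent line at time 0.
  let ι : ℝ × Plane → Plane := fun z => q + A z.2
  have hι0 : ι 0 = q := by simp [ι]
  have hι : ContDiff ℝ ∞ ι := contDiff_const.add (A.contDiff.comp contDiff_snd)
  let f : ℝ × Plane → ℝ := fun z => φ (ι z)
  have hf : SmoothNear f 0 := SmoothNear.comp (by rw [hι0]; exact hφ) (smoothNear_of_contDiff hι 0)
  have hfd : fderiv ℝ f 0 (0, 0, 1) = fderiv ℝ φ q (A (0, 1)) := by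
    have h1 : HasFDerivAt ι ((A : Plane →L[ℝ] Plane).comp (ContinuousLinearMap.snd ℝ ℝ Plane)) 0 :=
      (((A : Plane →L[ℝ] Plane).comp (ContinuousLinearMap.snd ℝ ℝ Plane)).hasFDerivAt).const_add q
    have h2 : HasFDerivAt φ (fderiv ℝ φ q) (ι 0) := by
      rw [hι0]; exact hφ.differentiableAt.hasFDerivAt
    have h3 : fderiv ℝ f 0 = _ := (h2.comp 0 h1).fderiv
    rw [h3]; rfl
  have e : ∀ᶠ z in 𝓝 (0 : ℝ × Plane), ContDiffAt ℝ ∞ f z ∧ 0 < fderiv ℝ f z (0, 0, 1) := by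
    refine hf.and ((hf.fderiv_apply _).contDiffAt.continuousAt.eventually (lt_mem_nhds ?_))
    simpa only [hfd] using hA2
  obtain ⟨ρ, hρ, hP⟩ := exists_box_of_eventually e
  obtain ⟨r, hr, hrρ, hs⟩ := exists_sign_box (f := f) hρ (by simp [f, hι0, h0])
    (fun t X Y h1 h2 h3 => (hP t X Y h1 h2 h3).1) (fun t X Y h1 h2 h3 => (hP t X Y h1 h2 h3).2)
  obtain ⟨α, hα, hroot⟩ := exists_graph (f := f) (ε := r) (r := r) hρ
    (fun t X Y h1 h2 h3 => (hP t X Y (h1.le.trans hrρ) (h2.le.trans hrρ) h3).1)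
    (fun t X Y h1 h2 h3 => (hP t X Y (h1.le.trans hrρ) (h2.le.trans hrρ) h3).2)
    (fun t X h1 h2 => (hs t X h1 h2).1) (fun t X h1 h2 => (hs t X h1 h2).2)
  have hball : ∀ᶠ s in 𝓝 (0 : ℝ), |s| < r := by
    filter_upwards [Metric.ball_mem_nhds (0 : ℝ) hr] with s hs
    simpa using hs
  have hsm : SmoothNear (fun s => α 0 s) 0 := by
    filter_upwards [hball] with s hs
    have : ContDiffAt ℝ ∞ (fun z : ℝ × ℝ => α z.1 z.2) (0, s) :=
      hα.contDiffAt ((isOpen_Ioo.prod isOpen_Ioo).mem_nhds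
        ⟨by simp [hr], abs_lt.1 hs⟩)
    exact ContDiffAt.comp (g := fun z : ℝ × ℝ => α z.1 z.2) s this
      (contDiffAt_const.prodMk contDiffAt_id)
  have hz : |(0 : ℝ)| < r := by simpa using hr
  have hα0 : α 0 0 = 0 := by
    refine (((hroot 0 0 hz hz).2 0 (by simpa using hρ.le)).1.1 ?_).symm
    change φ (ι 0) = 0
    rw [hι0, h0]
  have hd : HasDerivAt (fun s => q + A (s, α 0 s)) (A (1, deriv (fun s => α 0 s) 0)) 0 := by
    have h1 := (hasDerivAt_id (0 : ℝ)).prodMk hsm.differentiableAt.hasDerivAt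
    exact (A.hasFDerivAt.comp_hasDerivAt (0 : ℝ) h1).const_add q
  refine ⟨fun s => q + A (s, α 0 s), ?_, ?_, ?_, ?_⟩
  · filter_upwards [hsm] with s hs
    exact contDiffAt_const.add (A.contDiff.contDiffAt.comp s (contDiffAt_id.prodMk hs))
  · have h00 : ((0 : ℝ), (0 : ℝ)) = 0 := rfl
    simp [hα0, h00]
  · rw [hd.deriv]
    intro h
    have := congrArg Prod.fst (A.map_eq_zero_iff.1 h)
    simp at this
  · filter_upwards [hball] with s hs
    obtain ⟨h1, h2⟩ := hroot 0 s hz hs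
    exact ((h2 (α 0 s) h1.le).1).2 rfl

section Curves

variable {E : Type*} [NormedAddCommGroup E] [NormedSpace ℝ E]

theorem deriv_comp_curve {g : E → ℝ} {γ : ℝ → E} {a : ℝ} (hγ : DifferentiableAt ℝ γ a)
    (hg : DifferentiableAt ℝ g (γ a)) :
    deriv (fun s => g (γ s)) a = fderiv ℝ g (γ a) (deriv γ a) :=
  (hg.hasFDerivAt.comp_hasDerivAt a hγ.hasDerivAt).deriv

theorem iteratedDeriv_two_comp_curve {g : E → ℝ} {γ : ℝ → E} {a : ℝ} (hγ : SmoothNear γ a)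
    (hg : SmoothNear g (γ a)) :
    iteratedDeriv 2 (fun s => g (γ s)) a =
      fderiv ℝ (fderiv ℝ g) (γ a) (deriv γ a) (deriv γ a)
        + fderiv ℝ g (γ a) (deriv (deriv γ) a) := by
  rw [iteratedDeriv_succ, iteratedDeriv_one]
  have h1 : deriv (fun s => g (γ s)) =ᶠ[𝓝 a] fun s => fderiv ℝ g (γ s) (deriv γ s) := by
    filter_upwards [hγ.eventually_differentiableAt,
      hγ.contDiffAt.continuousAt.eventually hg.eventually_differentiableAt] with s h1 h2
    exact deriv_comp_curve h1 h2
  rw [h1.deriv_eq]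
  have h2 : HasDerivAt (fun s => fderiv ℝ g (γ s)) (fderiv ℝ (fderiv ℝ g) (γ a) (deriv γ a)) a :=
    hg.fderiv.differentiableAt.hasFDerivAt.comp_hasDerivAt a hγ.differentiableAt.hasDerivAt
  exact (h2.clm_apply hγ.deriv.differentiableAt.hasDerivAt).deriv

end Curves

theorem iteratedDeriv_sq {w : ℝ → ℝ} (hw : SmoothNear w 0) (n : ℕ) :
    iteratedDeriv n (fun s => w s ^ 2) 0 = ∑ i ∈ Finset.range (n + 1),
      n.choose i * iteratedDeriv i w 0 * iteratedDeriv (n - i) w 0 := by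
  have h : ContDiffAt ℝ n w 0 := hw.contDiffAt.of_le (by exact_mod_cast le_top)
  simp_rw [pow_two]
  exact iteratedDeriv_fun_mul h h

/-- `contactOrder` is a supremum over all regular parametrisations. The upper bound needs a nonzero
n-th derivative along every one of them, the lower bound a single one, which `exists_isCurveParam`
provides. -/
theorem contactOrder_eq {φ ψ : Plane → ℝ} {q : Plane} {n : ℕ} (hφ : SmoothNear φ q)
    (h0 : φ q = 0) (hd : fderiv ℝ φ q ≠ 0)
    (h : ∀ γ, IsCurveParam φ q γ → (∀ j < n, iteratedDeriv j (fun s => ψ (γ s)) 0 = 0) ∧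
      iteratedDeriv n (fun s => ψ (γ s)) 0 ≠ 0) : contactOrder φ ψ q = n := by
  apply le_antisymm
  · refine sSup_le ?_
    rintro k ⟨γ, h1, h2, h3, h4, h5⟩
    by_contra hk
    exact (h γ ⟨h1, h2, h3, h4⟩).2 (h5 n (not_le.1 hk))
  · obtain ⟨γ, hγ⟩ := exists_isCurveParam hφ h0 hd
    refine le_sSup ⟨γ, hγ.1, hγ.2.1, hγ.2.2.1, hγ.2.2.2, fun j hj => ?_⟩
    exact (h γ hγ).1 j (by exact_mod_cast hj)

theorem le_contactOrder {φ ψ : Plane → ℝ} {q : Plane} {n : ℕ} {γ : ℝ → Plane}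
    (hγ : IsCurveParam φ q γ) (h : ∀ j < n, iteratedDeriv j (fun s => ψ (γ s)) 0 = 0) :
    n ≤ contactOrder φ ψ q :=
  le_sSup ⟨γ, hγ.1, hγ.2.1, hγ.2.2.1, hγ.2.2.2, fun j hj => h j (by exact_mod_cast hj)⟩

theorem exists_of_lt_contactOrder {φ ψ : Plane → ℝ} {q : Plane} {n : ℕ}
    (h : n < contactOrder φ ψ q) :
    ∃ γ, IsCurveParam φ q γ ∧ ∀ j ≤ n, iteratedDeriv j (fun s => ψ (γ s)) 0 = 0 := by
  obtain ⟨k, ⟨γ, h1, h2, h3, h4, h5⟩, hk⟩ := lt_sSup_iff.1 h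
  exact ⟨γ, ⟨h1, h2, h3, h4⟩, fun j hj => h5 j (lt_of_le_of_lt (by exact_mod_cast hj) hk)⟩

section Contact

variable {φ ψ χ : Plane → ℝ} {q : Plane} {γ : ℝ → Plane}

theorem IsCurveParam.fderiv_deriv (hγ : IsCurveParam φ q γ) (hφ : SmoothNear φ q) :
    fderiv ℝ φ q (deriv γ 0) = 0 := by
  have h1 := deriv_comp_curve (g := φ) hγ.1.differentiableAt
    (by rw [hγ.2.1]; exact hφ.differentiableAt)
  rw [hγ.2.1] at h1
  have h2 : (fun s => φ (γ s)) =ᶠ[𝓝 0] fun _ => 0 := hγ.2.2.2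
  rw [← h1, h2.deriv_eq, deriv_const]

theorem IsCurveParam.deriv_comp (hγ : IsCurveParam φ q γ) (hψ : SmoothNear ψ q) :
    deriv (fun s => ψ (γ s)) 0 = fderiv ℝ ψ q (deriv γ 0) := by
  have h1 := deriv_comp_curve (g := ψ) hγ.1.differentiableAt
    (by rw [hγ.2.1]; exact hψ.differentiableAt)
  rwa [hγ.2.1] at h1

theorem IsCurveParam.smoothNear_comp (hγ : IsCurveParam φ q γ) (hψ : SmoothNear ψ q) :
    SmoothNear (fun s => ψ (γ s)) 0 :=
  SmoothNear.comp (by rw [hγ.2.1]; exact hψ) hγ.1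

/-- Differentiating φ ∘ γ = 0 twice expresses dφ(γ'') through the second derivative of φ. Since dψ =
l dφ, this removes the acceleration of γ and leaves a quadratic form in the tangent vector. -/
theorem IsCurveParam.iteratedDeriv_two (hγ : IsCurveParam φ q γ) (hφ : SmoothNear φ q)
    (hψ : SmoothNear ψ q) {l : ℝ} (hl : ∀ e, fderiv ℝ ψ q e = l * fderiv ℝ φ q e) :
    iteratedDeriv 2 (fun s => ψ (γ s)) 0 =
      fderiv ℝ (fderiv ℝ ψ) q (deriv γ 0) (deriv γ 0)
        - l * fderiv ℝ (fderiv ℝ φ) q (deriv γ 0) (deriv γ 0) := by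
  have h1 := iteratedDeriv_two_comp_curve hγ.1 (by rw [hγ.2.1]; exact hψ)
  have h2 := iteratedDeriv_two_comp_curve hγ.1 (by rw [hγ.2.1]; exact hφ)
  have h3 : (fun s => φ (γ s)) =ᶠ[𝓝 0] fun _ => 0 := hγ.2.2.2
  rw [h3.iteratedDeriv_eq] at h2
  simp only [hγ.2.1, hl] at h1 h2
  simp at h2
  rw [h1]
  linear_combination -l * h2

theorem contactOrder_eq_one (hφ : SmoothNear φ q) (hψ : SmoothNear ψ q) (h0 : φ q = 0)
    (hψ0 : ψ q = 0) (hd : fderiv ℝ φ q ≠ 0)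
    (ht : ∀ e, fderiv ℝ φ q e = 0 → fderiv ℝ ψ q e = 0 → e = 0) : contactOrder φ ψ q = 1 := by
  refine contactOrder_eq (n := 1) hφ h0 hd fun γ hγ => ⟨fun j hj => ?_, ?_⟩
  · obtain rfl : j = 0 := by omega
    simp [hγ.2.1, hψ0]
  · rw [iteratedDeriv_one, hγ.deriv_comp hψ]
    exact fun h => hγ.2.2.1 (ht _ (hγ.fderiv_deriv hφ) h)

theorem IsCurveParam.comp_eq_sq (hγ : IsCurveParam φ q γ)
    (h : ∀ᶠ z in 𝓝 q, φ z = 0 → χ z = ψ z ^ 2) :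
    (fun s => χ (γ s)) =ᶠ[𝓝 0] fun s => ψ (γ s) ^ 2 := by
  have hc := hγ.1.contDiffAt.continuousAt
  rw [ContinuousAt, hγ.2.1] at hc
  filter_upwards [hc.eventually h, hγ.2.2.2] with s h1 h2
  exact h1 h2

/-- Along the curve, χ is the square of a function with a simple zero. -/
theorem contactOrder_sq_eq_two (hφ : SmoothNear φ q) (hψ : SmoothNear ψ q) (h0 : φ q = 0)
    (hψ0 : ψ q = 0) (hd : fderiv ℝ φ q ≠ 0)
    (ht : ∀ e, fderiv ℝ φ q e = 0 → fderiv ℝ ψ q e = 0 → e = 0)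
    (h : ∀ᶠ z in 𝓝 q, φ z = 0 → χ z = ψ z ^ 2) : contactOrder φ χ q = 2 := by
  refine contactOrder_eq (n := 2) hφ h0 hd fun γ hγ => ?_
  have h1 : deriv (fun s => ψ (γ s)) 0 ≠ 0 := by
    rw [hγ.deriv_comp hψ]
    exact fun h => hγ.2.2.1 (ht _ (hγ.fderiv_deriv hφ) h)
  have hw := hγ.smoothNear_comp hψ
  have hw0 : ψ (γ 0) = 0 := by rw [hγ.2.1, hψ0]
  refine ⟨fun j hj => ?_, ?_⟩
  · rw [(hγ.comp_eq_sq h).iteratedDeriv_eq, iteratedDeriv_sq hw]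
    interval_cases j <;> simp [Finset.sum_range_succ, hw0]
  · rw [(hγ.comp_eq_sq h).iteratedDeriv_eq, iteratedDeriv_sq hw]
    simp [Finset.sum_range_succ, hw0, iteratedDeriv_one, h1]

/-- At the origin, the curve `ψ = 0` is regular and has an ordinary tangency with the regular curve
`φ = 0`, and near the origin `s φ ≥ 0` on it. -/
def FoldContact (s : ℝ) (φ ψ : Plane → ℝ) : Prop :=
  φ 0 = 0 ∧ fderiv ℝ φ 0 ≠ 0 ∧ ψ 0 = 0 ∧ ∃ l : ℝ, (∀ e, fderiv ℝ ψ 0 e = l * fderiv ℝ φ 0 e) ∧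
    ∃ γ, IsCurveParam φ 0 γ ∧ s * l * iteratedDeriv 2 (fun a => ψ (γ a)) 0 < 0

/-- The condition involves a curve only through its tangent vector, by
`IsCurveParam.iteratedDeriv_two`. The kernel of dφ is a line and the quadratic form scales by a
positive square on it, so one curve is as good as all. -/
theorem foldContact_iff {s : ℝ} (hφ : SmoothNear φ 0) (hψ : SmoothNear ψ 0) :
    FoldContact s φ ψ ↔ φ 0 = 0 ∧ fderiv ℝ φ 0 ≠ 0 ∧ ψ 0 = 0 ∧
      ∃ l : ℝ, (∀ e, fderiv ℝ ψ 0 e = l * fderiv ℝ φ 0 e) ∧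
        ∀ e, e ≠ 0 → fderiv ℝ φ 0 e = 0 →
          s * l * (fderiv ℝ (fderiv ℝ ψ) 0 e e - l * fderiv ℝ (fderiv ℝ φ) 0 e e) < 0 := by
  constructor
  · rintro ⟨h1, h2, h3, l, hl, γ, hγ, hs⟩
    refine ⟨h1, h2, h3, l, hl, fun e he hφe => ?_⟩
    rw [hγ.iteratedDeriv_two hφ hψ hl] at hs
    obtain ⟨c, rfl⟩ := exists_smul_of_ker h2 (hγ.fderiv_deriv hφ) hφe hγ.2.2.1
    have hc : c ≠ 0 := fun hc => he (by simp [hc])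
    have hc2 := sq_pos_of_ne_zero hc
    simp only [map_smul, _root_.smul_apply, smul_eq_mul]
    nlinarith
  · rintro ⟨h1, h2, h3, l, hl, h⟩
    obtain ⟨γ, hγ⟩ := exists_isCurveParam hφ h1 h2
    refine ⟨h1, h2, h3, l, hl, γ, hγ, ?_⟩
    rw [hγ.iteratedDeriv_two hφ hψ hl]
    exact h _ hγ.2.2.1 (hγ.fderiv_deriv hφ)

theorem FoldContact.exists_forall {s : ℝ} (hφ : SmoothNear φ 0) (hψ : SmoothNear ψ 0)
    (h : FoldContact s φ ψ) : ∀ γ, IsCurveParam φ 0 γ →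
      (∀ j < 2, iteratedDeriv j (fun a => ψ (γ a)) 0 = 0) ∧
        iteratedDeriv 2 (fun a => ψ (γ a)) 0 ≠ 0 := by
  obtain ⟨h1, h2, h3, l, hl, h⟩ := (foldContact_iff hφ hψ).1 h
  intro γ hγ
  refine ⟨fun j hj => ?_, ?_⟩
  · interval_cases j
    · simp [hγ.2.1, h3]
    · rw [iteratedDeriv_one, hγ.deriv_comp hψ, hl, hγ.fderiv_deriv hφ, mul_zero]
  · intro h0
    have := h _ hγ.2.2.1 (hγ.fderiv_deriv hφ)
    rw [← hγ.iteratedDeriv_two hφ hψ hl, h0] at this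
    simp at this

theorem FoldContact.contactOrder_eq_two {s : ℝ} (hφ : SmoothNear φ 0) (hψ : SmoothNear ψ 0)
    (h : FoldContact s φ ψ) : contactOrder φ ψ 0 = 2 :=
  contactOrder_eq (n := 2) hφ h.1 h.2.1 (h.exists_forall hφ hψ)

/-- Along φ = 0 the function χ is the square of one vanishing to order exactly two. In the Leibniz
formula for the fourth derivative only the middle term survives. -/
theorem FoldContact.contactOrder_sq_eq_four {s : ℝ} (hφ : SmoothNear φ 0) (hψ : SmoothNear ψ 0)
    (h : FoldContact s φ ψ) (hχ : ∀ᶠ z in 𝓝 (0 : Plane), φ z = 0 → χ z = ψ z ^ 2) :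
    contactOrder φ χ 0 = 4 := by
  refine contactOrder_eq (n := 4) hφ h.1 h.2.1 fun γ hγ => ?_
  obtain ⟨h1, h2⟩ := h.exists_forall hφ hψ γ hγ
  have hw := hγ.smoothNear_comp hψ
  have w0 := h1 0 (by norm_num)
  have w1 := h1 1 (by norm_num)
  refine ⟨fun j hj => ?_, ?_⟩
  · rw [(hγ.comp_eq_sq hχ).iteratedDeriv_eq, iteratedDeriv_sq hw]
    interval_cases j <;> simp only [Finset.sum_range_succ, w0, w1] <;> simp [w0]
  · rw [(hγ.comp_eq_sq hχ).iteratedDeriv_eq, iteratedDeriv_sq hw]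
    simp only [Finset.sum_range_succ, w0, w1]
    simp [h2, Nat.choose]

/-- `m(φ, ψ²) > 2` if and only if `m(φ, ψ) > 1`. -/
theorem two_lt_contactOrder_sq_iff (hφ : SmoothNear φ q) (hψ : SmoothNear ψ q) (h0 : φ q = 0)
    (hd : fderiv ℝ φ q ≠ 0) (hχ : ∀ᶠ z in 𝓝 q, φ z = 0 → χ z = ψ z ^ 2) :
    2 < contactOrder φ χ q ↔ ψ q = 0 ∧ ∃ l : ℝ, ∀ e, fderiv ℝ ψ q e = l * fderiv ℝ φ q e := by
  constructor
  · intro h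
    obtain ⟨γ, hγ, hj⟩ := exists_of_lt_contactOrder (n := 2) h
    have hw := hγ.smoothNear_comp hψ
    have h1 := hj 0 (by norm_num)
    have h2 := hj 2 le_rfl
    rw [(hγ.comp_eq_sq hχ).iteratedDeriv_eq] at h1 h2
    have w0 : ψ q = 0 := by simpa [hγ.2.1] using h1
    rw [iteratedDeriv_sq hw] at h2
    -- At a zero of w the second derivative of w² is 2 (w')².
    have w1 : fderiv ℝ ψ q (deriv γ 0) = 0 := by
      simpa [Finset.sum_range_succ, hγ.2.1, w0, iteratedDeriv_one, hγ.deriv_comp hψ] using h2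
    refine ⟨w0, ?_⟩
    obtain ⟨v, hv⟩ : ∃ v, fderiv ℝ φ q v ≠ 0 := by
      by_contra! hc
      exact hd (ContinuousLinearMap.ext fun v => by simpa using hc v)
    refine ⟨fderiv ℝ ψ q v / fderiv ℝ φ q v, fun e => ?_⟩
    -- Removing from e its component along v leaves a vector in the kernel of dφ, a multiple of the
    -- tangent vector, on which dψ vanishes too.
    have he : fderiv ℝ φ q (e - (fderiv ℝ φ q e / fderiv ℝ φ q v) • v) = 0 := by
      simp [hv]
    obtain ⟨c, hc⟩ := exists_smul_of_ker hd (hγ.fderiv_deriv hφ) he hγ.2.2.1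
    have h3 := congrArg (fderiv ℝ ψ q) hc
    simp only [map_sub, map_smul, w1, smul_eq_mul, mul_zero] at h3
    rw [sub_eq_zero.1 h3]
    ring
  · rintro ⟨w0, l, hl⟩
    obtain ⟨γ, hγ⟩ := exists_isCurveParam hφ h0 hd
    have hw := hγ.smoothNear_comp hψ
    have w0' : ψ (γ 0) = 0 := by rw [hγ.2.1, w0]
    have w1 : deriv (fun s => ψ (γ s)) 0 = 0 := by
      rw [hγ.deriv_comp hψ, hl, hγ.fderiv_deriv hφ, mul_zero]
    -- Vanishing of the derivatives of orders 0, 1, 2 is contact at least 3.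
    refine lt_of_lt_of_le (b := ((3 : ℕ) : ℕ∞)) (by norm_num) (le_contactOrder hγ fun j hj => ?_)
    rw [(hγ.comp_eq_sq hχ).iteratedDeriv_eq, iteratedDeriv_sq hw]
    interval_cases j <;> simp [Finset.sum_range_succ, w0', iteratedDeriv_one, w1]

/-- An ordinary tangency with a regular curve is a contact of order two. -/
theorem exists_foldContact (hφ : SmoothNear φ 0) (hψ : SmoothNear ψ 0) (h0 : φ 0 = 0)
    (hd : fderiv ℝ φ 0 ≠ 0) (hψ0 : ψ 0 = 0) (hψd : fderiv ℝ ψ 0 ≠ 0) {l : ℝ}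
    (hl : ∀ e, fderiv ℝ ψ 0 e = l * fderiv ℝ φ 0 e) (h : contactOrder φ ψ 0 = 2) :
    FoldContact 1 φ ψ ∨ FoldContact (-1) φ ψ := by
  have hl0 : l ≠ 0 := by
    rintro rfl
    exact hψd (ContinuousLinearMap.ext fun e => by simpa using hl e)
  obtain ⟨γ, hγ⟩ := exists_isCurveParam hφ h0 hd
  have h2 : iteratedDeriv 2 (fun a => ψ (γ a)) 0 ≠ 0 := by
    intro h2
    have := le_contactOrder (n := 3) (ψ := ψ) hγ fun j hj => by
      interval_cases j
      · simp [hγ.2.1, hψ0]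
      · rw [iteratedDeriv_one, hγ.deriv_comp hψ, hl, hγ.fderiv_deriv hφ, mul_zero]
      · exact h2
    rw [h] at this
    norm_cast at this
  rcases lt_or_gt_of_ne (mul_ne_zero hl0 h2) with hlt | hgt
  · exact Or.inl ⟨h0, hd, hψ0, l, hl, γ, hγ, by linarith⟩
  · exact Or.inr ⟨h0, hd, hψ0, l, hl, γ, hγ, by linarith⟩

end Contact


/-! The three functions of a surface, along two directions of an arbitrary parameter space. -/

section Forms

variable {E E' F : Type*} [NormedAddCommGroup E] [NormedSpace ℝ E]
  [NormedAddCommGroup E'] [NormedSpace ℝ E'] [NormedAddCommGroup F] [NormedSpace ℝ F]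

/-- The derivative in the direction `a`. -/
def dirD (a : E) (f : E → F) (z : E) : F := fderiv ℝ f z a

def ldForm (P Q : R31) : ℝ := mink P Q ^ 2 - mink P P * mink Q Q

/-- `P`, `Q` stand for the first derivatives x_u, x_v and `R`, `S`, `T` for x_uu, x_uv, x_vv.
Treating them as free vectors turns the transformation rules into polynomial identities. -/
def mcForm (P Q R S T : R31) : ℝ :=
  mink (mcross P Q) R * mink Q Q - 2 * mink (mcross P Q) S * mink P Q
    + mink (mcross P Q) T * mink P P

def kapForm (P Q R S T : R31) : ℝ :=
  mink (mcross P Q) R * mink (mcross P Q) T - mink (mcross P Q) S ^ 2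

/-- The function defining the `LD`, for the directions `a` and `b`. -/
def gLd (a b : E) (X : E → R31) (z : E) : ℝ := ldForm (dirD a X z) (dirD b X z)

/-- The function defining the `MCNC`, for the directions `a` and `b`. -/
def gMc (a b : E) (X : E → R31) (z : E) : ℝ :=
  mcForm (dirD a X z) (dirD b X z) (dirD a (dirD a X) z) (dirD b (dirD a X) z)
    (dirD b (dirD b X) z)

/-- The determinant of the second fundamental form, for the directions `a` and `b`. -/
def gKap (a b : E) (X : E → R31) (z : E) : ℝ :=
  kapForm (dirD a X z) (dirD b X z) (dirD a (dirD a X) z) (dirD b (dirD a X) z)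
    (dirD b (dirD b X) z)

def kapFun (x : Plane → R31) : Plane → ℝ := gKap (1, 0) (0, 1) x

theorem ldFun_eq (x : Plane → R31) : ldFun x = gLd (1, 0) (0, 1) x := rfl

theorem mcncFun_eq (x : Plane → R31) : mcncFun x = gMc (1, 0) (0, 1) x := rfl

/-- The discriminant of the pencil generated by the two fundamental forms. -/
theorem lplFun_eq (x : Plane → R31) (q : Plane) :
    lplFun x q = mcncFun x q ^ 2 + 4 * ldFun x q * kapFun x q := by
  have hk : kapFun x q = coeffL x q * coeffN x q - coeffM x q ^ 2 := rfl
  rw [hk, lplFun, mcncFun, ldFun]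
  ring

theorem mink_comb (P Q : R31) (p q r s : ℝ) :
    mink (p • P + q • Q) (r • P + s • Q) =
      p * r * mink P P + (p * s + q * r) * mink P Q + q * s * mink Q Q := by
  simp [mink]; ring

/-- The tangential part c P + d Q is killed by the determinant, and replacing the basis of the plane
multiplies the normal by the determinant of the change. -/
theorem mcross_comb (P Q R S T : R31) (p q r s α β γ c d : ℝ) :
    mink (mcross (p • P + q • Q) (r • P + s • Q)) (α • R + β • S + γ • T + (c • P + d • Q)) =
      (p * s - q * r) * (α * mink (mcross P Q) R + β * mink (mcross P Q) S
        + γ * mink (mcross P Q) T) := by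
  simp [mink, mcross]; ring

theorem ldForm_comb (P Q : R31) (p q r s : ℝ) :
    ldForm (p • P + q • Q) (r • P + s • Q) = (p * s - q * r) ^ 2 * ldForm P Q := by
  simp only [ldForm, mink_comb]; ring

/-- The three second-order vectors have the shape given by the chain rule; the free coefficients cᵢ,
dᵢ absorb the second derivatives of the change of parameters. The exponent is 1 for the normal and 2
for the trace-like contraction of two quadratic forms. -/
theorem mcForm_comb (P Q R S T : R31) (p q r s c₁ d₁ c₂ d₂ c₃ d₃ : ℝ) :
    mcForm (p • P + q • Q) (r • P + s • Q)
      ((p * p) • R + (2 * p * q) • S + (q * q) • T + (c₁ • P + d₁ • Q))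
      ((p * r) • R + (p * s + q * r) • S + (q * s) • T + (c₂ • P + d₂ • Q))
      ((r * r) • R + (2 * r * s) • S + (s * s) • T + (c₃ • P + d₃ • Q)) =
      (p * s - q * r) ^ 3 * mcForm P Q R S T := by
  simp only [mcForm, mcross_comb, mink_comb]; ring

theorem kapForm_comb (P Q R S T : R31) (p q r s c₁ d₁ c₂ d₂ c₃ d₃ : ℝ) :
    kapForm (p • P + q • Q) (r • P + s • Q)
      ((p * p) • R + (2 * p * q) • S + (q * q) • T + (c₁ • P + d₁ • Q))
      ((p * r) • R + (p * s + q * r) • S + (q * s) • T + (c₂ • P + d₂ • Q))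
      ((r * r) • R + (2 * r * s) • S + (s * s) • T + (c₃ • P + d₃ • Q)) =
      (p * s - q * r) ^ 4 * kapForm P Q R S T := by
  simp only [kapForm, mcross_comb]; ring

theorem SmoothNear.dirD {f : E → F} {z : E} (hf : SmoothNear f z) (a : E) :
    SmoothNear (dirD a f) z := hf.fderiv_apply a

theorem dirD_congr {f g : E → F} {z : E} (h : f =ᶠ[𝓝 z] g) (a : E) :
    dirD a f =ᶠ[𝓝 z] dirD a g := by
  filter_upwards [h.fderiv (𝕜 := ℝ)] with y hy
  rw [dirD, dirD, hy]

theorem dirD_comm {f : E → F} {z : E} (hf : SmoothNear f z) (a b : E) :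
    dirD a (dirD b f) z = dirD b (dirD a f) z := by
  have key : ∀ a b : E, dirD a (dirD b f) z = fderiv ℝ (fderiv ℝ f) z a b := by
    intro a b
    have : dirD b f = fun y => fderiv ℝ f y b := rfl
    rw [dirD, this, fderiv_clm_apply hf.fderiv.differentiableAt (differentiableAt_const _)]
    simp
  rw [key, key]
  exact hf.contDiffAt.isSymmSndFDerivAt (by simpa using ENat.LEInfty.out) a b

theorem gLd_congr {X Y : E → R31} {z : E} (h : X =ᶠ[𝓝 z] Y) (a b : E) :
    gLd a b X =ᶠ[𝓝 z] gLd a b Y := by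
  filter_upwards [dirD_congr h a, dirD_congr h b] with y h1 h2
  rw [gLd, gLd, h1, h2]

theorem gMc_congr {X Y : E → R31} {z : E} (h : X =ᶠ[𝓝 z] Y) (a b : E) :
    gMc a b X =ᶠ[𝓝 z] gMc a b Y := by
  filter_upwards [dirD_congr h a, dirD_congr h b, dirD_congr (dirD_congr h a) a,
    dirD_congr (dirD_congr h a) b, dirD_congr (dirD_congr h b) b] with y h1 h2 h3 h4 h5
  rw [gMc, gMc, h1, h2, h3, h4, h5]

theorem gKap_congr {X Y : E → R31} {z : E} (h : X =ᶠ[𝓝 z] Y) (a b : E) :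
    gKap a b X =ᶠ[𝓝 z] gKap a b Y := by
  filter_upwards [dirD_congr h a, dirD_congr h b, dirD_congr (dirD_congr h a) a,
    dirD_congr (dirD_congr h a) b, dirD_congr (dirD_congr h b) b] with y h1 h2 h3 h4 h5
  rw [gKap, gKap, h1, h2, h3, h4, h5]

theorem dirD_comp {X : E' → F} {Ψ : E → E'} {z : E} (hX : DifferentiableAt ℝ X (Ψ z))
    (hΨ : DifferentiableAt ℝ Ψ z) (a : E) {a' b' : E'} {p q : ℝ}
    (h : dirD a Ψ z = p • a' + q • b') :
    dirD a (fun y => X (Ψ y)) z = p • dirD a' X (Ψ z) + q • dirD b' X (Ψ z) := by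
  have : fderiv ℝ (fun y => X (Ψ y)) z = (fderiv ℝ X (Ψ z)).comp (fderiv ℝ Ψ z) :=
    fderiv_comp z hX hΨ
  rw [dirD, this, ContinuousLinearMap.comp_apply]
  change fderiv ℝ X (Ψ z) (dirD a Ψ z) = _
  rw [h, map_add, map_smul, map_smul]
  rfl

theorem dirD_smul {p : E → ℝ} {U : E → F} {z : E} (hp : DifferentiableAt ℝ p z)
    (hU : DifferentiableAt ℝ U z) (c : E) :
    dirD c (fun y => p y • U y) z = p z • dirD c U z + dirD c p z • U z := by
  have := fderiv_fun_smul hp hU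
  rw [dirD, this]
  simp [dirD]

theorem dirD_add {U V : E → F} {z : E} (hU : DifferentiableAt ℝ U z)
    (hV : DifferentiableAt ℝ V z) (c : E) :
    dirD c (fun y => U y + V y) z = dirD c U z + dirD c V z := by
  have := fderiv_fun_add hU hV
  rw [dirD, this]
  simp [dirD]

/-- The effect of a change of parameters on the three functions. -/
theorem forms_reparam {X : E' → R31} {Ψ : E → E'} {z : E} {a b : E} {a' b' : E'}
    {p q r s : E → ℝ} (hX : SmoothNear X (Ψ z)) (hΨ : SmoothNear Ψ z)
    (hp : DifferentiableAt ℝ p z) (hq : DifferentiableAt ℝ q z) (hr : DifferentiableAt ℝ r z)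
    (hs : DifferentiableAt ℝ s z)
    (ha : ∀ᶠ y in 𝓝 z, dirD a Ψ y = p y • a' + q y • b')
    (hb : ∀ᶠ y in 𝓝 z, dirD b Ψ y = r y • a' + s y • b') :
    gLd a b (fun y => X (Ψ y)) z = (p z * s z - q z * r z) ^ 2 * gLd a' b' X (Ψ z) ∧
    gMc a b (fun y => X (Ψ y)) z = (p z * s z - q z * r z) ^ 3 * gMc a' b' X (Ψ z) ∧
    gKap a b (fun y => X (Ψ y)) z = (p z * s z - q z * r z) ^ 4 * gKap a' b' X (Ψ z) := by
  have hX' := hΨ.contDiffAt.continuousAt.eventually hX.eventually_differentiableAt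
  have ea : dirD a (fun y => X (Ψ y)) =ᶠ[𝓝 z]
      fun y => p y • dirD a' X (Ψ y) + q y • dirD b' X (Ψ y) := by
    filter_upwards [hX', hΨ.eventually_differentiableAt, ha] with y h1 h2 h3
    exact dirD_comp h1 h2 a h3
  have eb : dirD b (fun y => X (Ψ y)) =ᶠ[𝓝 z]
      fun y => r y • dirD a' X (Ψ y) + s y • dirD b' X (Ψ y) := by
    filter_upwards [hX', hΨ.eventually_differentiableAt, hb] with y h1 h2 h3
    exact dirD_comp h1 h2 b h3
  have dU := ((hX.dirD a').comp hΨ).differentiableAt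
  have dV := ((hX.dirD b').comp hΨ).differentiableAt
  have comb : ∀ {u v : E → ℝ} (c : E), DifferentiableAt ℝ u z → DifferentiableAt ℝ v z →
      dirD c (fun y => u y • dirD a' X (Ψ y) + v y • dirD b' X (Ψ y)) z =
        (u z • dirD c (fun y => dirD a' X (Ψ y)) z + dirD c u z • dirD a' X (Ψ z)) +
        (v z • dirD c (fun y => dirD b' X (Ψ y)) z + dirD c v z • dirD b' X (Ψ z)) := by
    intro u v c hu hv
    rw [dirD_add (hu.fun_smul dU) (hv.fun_smul dV), dirD_smul hu dU, dirD_smul hv dV]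
  have sym := dirD_comm hX a' b'
  have hUa := dirD_comp (hX.dirD a').differentiableAt hΨ.differentiableAt a ha.self_of_nhds
  have hUb := dirD_comp (hX.dirD a').differentiableAt hΨ.differentiableAt b hb.self_of_nhds
  have hVa := dirD_comp (hX.dirD b').differentiableAt hΨ.differentiableAt a ha.self_of_nhds
  have hVb := dirD_comp (hX.dirD b').differentiableAt hΨ.differentiableAt b hb.self_of_nhds
  -- The derivatives of the coefficients `p`, `q`, `r`, `s` multiply first derivatives of `X` only,
  -- so they land in the tangential slot ignored by the forms. `sym` merges the two mixed
  -- derivatives.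
  have eaa : dirD a (dirD a (fun y => X (Ψ y))) z =
      (p z * p z) • dirD a' (dirD a' X) (Ψ z) + (2 * p z * q z) • dirD b' (dirD a' X) (Ψ z)
        + (q z * q z) • dirD b' (dirD b' X) (Ψ z)
        + (dirD a p z • dirD a' X (Ψ z) + dirD a q z • dirD b' X (Ψ z)) := by
    rw [(dirD_congr ea a).eq_of_nhds, comb a hp hq, hUa, hVa, sym]
    module
  have eba : dirD b (dirD a (fun y => X (Ψ y))) z =
      (p z * r z) • dirD a' (dirD a' X) (Ψ z)
        + (p z * s z + q z * r z) • dirD b' (dirD a' X) (Ψ z)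
        + (q z * s z) • dirD b' (dirD b' X) (Ψ z)
        + (dirD b p z • dirD a' X (Ψ z) + dirD b q z • dirD b' X (Ψ z)) := by
    rw [(dirD_congr ea b).eq_of_nhds, comb b hp hq, hUb, hVb, sym]
    module
  have ebb : dirD b (dirD b (fun y => X (Ψ y))) z =
      (r z * r z) • dirD a' (dirD a' X) (Ψ z) + (2 * r z * s z) • dirD b' (dirD a' X) (Ψ z)
        + (s z * s z) • dirD b' (dirD b' X) (Ψ z)
        + (dirD b r z • dirD a' X (Ψ z) + dirD b s z • dirD b' X (Ψ z)) := by
    rw [(dirD_congr eb b).eq_of_nhds, comb b hr hs, hUb, hVb, sym]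
    module
  refine ⟨?_, ?_, ?_⟩
  · rw [gLd, ea.eq_of_nhds, eb.eq_of_nhds, ldForm_comb]; rfl
  · rw [gMc, ea.eq_of_nhds, eb.eq_of_nhds, eaa, eba, ebb, mcForm_comb]; rfl
  · rw [gKap, ea.eq_of_nhds, eb.eq_of_nhds, eaa, eba, ebb, kapForm_comb]; rfl

theorem dirD_slice {f : ℝ × Plane → F} {z : ℝ × Plane} (hf : DifferentiableAt ℝ f z) (e : Plane) :
    dirD e (fun q => f (z.1, q)) z.2 = dirD (0, e) f z := by
  have h1 : HasFDerivAt (fun q : Plane => (z.1, q)) (ContinuousLinearMap.inr ℝ ℝ Plane) z.2 :=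
    hasFDerivAt_prodMk_right z.1 z.2
  have h2 := HasFDerivAt.comp (g := f) z.2 hf.hasFDerivAt h1
  have h3 : fderiv ℝ (fun q => f (z.1, q)) z.2 = _ := h2.fderiv
  rw [dirD, h3]
  rfl

theorem dirD_slice_eventuallyEq {f : ℝ × Plane → F} {z : ℝ × Plane} (hf : SmoothNear f z)
    (e : Plane) : dirD e (fun q => f (z.1, q)) =ᶠ[𝓝 z.2] fun q => dirD (0, e) f (z.1, q) := by
  have hc : ContinuousAt (fun q : Plane => (z.1, q)) z.2 := by fun_prop
  filter_upwards [hc.eventually hf.eventually_differentiableAt] with q hq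
  exact dirD_slice (z := (z.1, q)) hq e

/-- Derivatives in the directions (0, 1, 0) and (0, 0, 1) never leave a slice. The functions of all
surfaces M_t are therefore restrictions of single functions on ℝ × Plane, which can also be
differentiated in t. -/
theorem forms_slice {X : ℝ × Plane → R31} {z : ℝ × Plane} (hX : SmoothNear X z) :
    ldFun (fun q => X (z.1, q)) z.2 = gLd (0, 1, 0) (0, 0, 1) X z ∧
    mcncFun (fun q => X (z.1, q)) z.2 = gMc (0, 1, 0) (0, 0, 1) X z ∧
    kapFun (fun q => X (z.1, q)) z.2 = gKap (0, 1, 0) (0, 0, 1) X z := by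
  have h1 : ∀ e, dirD e (fun q => X (z.1, q)) z.2 = dirD (0, e) X z :=
    fun e => dirD_slice hX.differentiableAt e
  have h2 : ∀ e e', dirD e' (dirD e (fun q => X (z.1, q))) z.2 = dirD (0, e') (dirD (0, e) X) z := by
    intro e e'
    rw [(dirD_congr (dirD_slice_eventuallyEq hX e) e').eq_of_nhds]
    exact dirD_slice (hX.dirD _).differentiableAt e'
  refine ⟨?_, ?_, ?_⟩
  · rw [ldFun_eq, gLd, h1, h1]; rfl
  · rw [mcncFun_eq, gMc, h1, h1, h2, h2, h2]; rfl
  · rw [kapFun, gKap, h1, h1, h2, h2, h2]; rfl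

end Forms


/-! Families of functions whose jets at the origin depend continuously on a parameter. -/

section JetCont

variable {T : Type*} [TopologicalSpace T] {E : Type*} [NormedAddCommGroup E] [NormedSpace ℝ E]

/-- The derivatives of order at most `n` of `f τ` at the origin depend continuously on `τ`. -/
def JetContN : ℕ → (T → E → ℝ) → Prop
  | 0, f => Continuous fun τ => f τ 0
  | n + 1, f => (Continuous fun τ => f τ 0) ∧ ∀ v, JetContN n fun τ => dirD v (f τ)

/-- A family of smooth functions, all the derivatives of which at the origin depend continuously on
the parameter. -/
structure JetCont (f : T → E → ℝ) : Prop where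
  smooth : ∀ τ, SmoothNear (f τ) 0
  cont : ∀ n, JetContN n f

theorem JetContN.continuous : ∀ {n : ℕ} {f : T → E → ℝ}, JetContN n f → Continuous fun τ => f τ 0
  | 0, _, h => h
  | _ + 1, _, h => h.1

theorem JetContN.congr : ∀ {n : ℕ} {f g : T → E → ℝ}, JetContN n f →
    (∀ τ, f τ =ᶠ[𝓝 0] g τ) → JetContN n g
  | 0, f, g, h, e => by
    have : (fun τ => g τ 0) = fun τ => f τ 0 := funext fun τ => ((e τ).eq_of_nhds).symm
    unfold JetContN; rw [this]; exact h
  | n + 1, f, g, h, e => by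
    have : (fun τ => g τ 0) = fun τ => f τ 0 := funext fun τ => ((e τ).eq_of_nhds).symm
    exact ⟨by rw [this]; exact h.1, fun v => (h.2 v).congr fun τ => dirD_congr (e τ) v⟩

theorem JetContN.pred : ∀ {n : ℕ} {f : T → E → ℝ}, JetContN (n + 1) f → JetContN n f
  | 0, _, h => h.1
  | _ + 1, _, h => ⟨h.1, fun v => (h.2 v).pred⟩

theorem JetContN.add : ∀ {n : ℕ} {f g : T → E → ℝ}, JetContN n f → JetContN n g →
    (∀ τ, SmoothNear (f τ) 0) → (∀ τ, SmoothNear (g τ) 0) → JetContN n fun τ z => f τ z + g τ z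
  | 0, _, _, h, h', _, _ => Continuous.add h h'
  | n + 1, f, g, h, h', s, s' => by
    refine ⟨h.1.add h'.1, fun v => ?_⟩
    refine ((h.2 v).add (h'.2 v) (fun τ => (s τ).dirD v) (fun τ => (s' τ).dirD v)).congr fun τ => ?_
    filter_upwards [(s τ).eventually_differentiableAt, (s' τ).eventually_differentiableAt]
      with z h1 h2
    exact (dirD_add h1 h2 v).symm

theorem SmoothNear.add {F : Type*} [NormedAddCommGroup F] [NormedSpace ℝ F] {f g : E → F} {a : E}
    (hf : SmoothNear f a) (hg : SmoothNear g a) : SmoothNear (fun z => f z + g z) a := by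
  unfold SmoothNear
  filter_upwards [hf, hg] with z h1 h2 using h1.add h2

theorem SmoothNear.mul {f g : E → ℝ} {a : E}
    (hf : SmoothNear f a) (hg : SmoothNear g a) : SmoothNear (fun z => f z * g z) a := by
  unfold SmoothNear
  filter_upwards [hf, hg] with z h1 h2 using h1.mul h2

theorem smoothNear_const {F : Type*} [NormedAddCommGroup F] [NormedSpace ℝ F] (c : F) (a : E) :
    SmoothNear (fun _ : E => c) a :=
  .of_forall fun _ => contDiffAt_const

theorem JetContN.mul : ∀ {n : ℕ} {f g : T → E → ℝ}, JetContN n f → JetContN n g →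
    (∀ τ, SmoothNear (f τ) 0) → (∀ τ, SmoothNear (g τ) 0) → JetContN n fun τ z => f τ z * g τ z
  | 0, _, _, h, h', _, _ => Continuous.mul h h'
  | n + 1, f, g, h, h', s, s' => by
    refine ⟨h.1.mul h'.1, fun v => ?_⟩
    have s1 : ∀ τ, SmoothNear (dirD v (f τ)) 0 := fun τ => (s τ).dirD v
    have s1' : ∀ τ, SmoothNear (dirD v (g τ)) 0 := fun τ => (s' τ).dirD v
    refine ((h.pred.mul (h'.2 v) s s1').add ((h.2 v).mul h'.pred s1 s')
      (fun τ => (s τ).mul (s1' τ)) (fun τ => (s1 τ).mul (s' τ))).congr fun τ => ?_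
    filter_upwards [(s τ).eventually_differentiableAt, (s' τ).eventually_differentiableAt]
      with z h1 h2
    have := dirD_smul h1 h2 v
    simp only [smul_eq_mul] at this
    exact this.symm

theorem jetContN_fixed : ∀ (n : ℕ) (f : E → ℝ), JetContN n fun _ : T => f
  | 0, _ => continuous_const
  | n + 1, f => ⟨continuous_const, fun v => jetContN_fixed n (dirD v f)⟩

theorem jetCont_fixed {f : E → ℝ} (hf : SmoothNear f 0) : JetCont fun _ : T => f :=
  ⟨fun _ => hf, fun n => jetContN_fixed n f⟩

theorem JetCont.continuous {f : T → E → ℝ} (h : JetCont f) : Continuous fun τ => f τ 0 :=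
  h.cont 0

theorem JetCont.congr {f g : T → E → ℝ} (h : JetCont f) (e : ∀ τ, f τ =ᶠ[𝓝 0] g τ) : JetCont g :=
  ⟨fun τ => (h.smooth τ).congr (e τ), fun n => (h.cont n).congr e⟩

theorem JetCont.add {f g : T → E → ℝ} (h : JetCont f) (h' : JetCont g) :
    JetCont fun τ z => f τ z + g τ z :=
  ⟨fun τ => (h.smooth τ).add (h'.smooth τ), fun n => (h.cont n).add (h'.cont n) h.smooth h'.smooth⟩

theorem JetCont.mul {f g : T → E → ℝ} (h : JetCont f) (h' : JetCont g) :
    JetCont fun τ z => f τ z * g τ z :=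
  ⟨fun τ => (h.smooth τ).mul (h'.smooth τ), fun n => (h.cont n).mul (h'.cont n) h.smooth h'.smooth⟩

theorem JetCont.const_mul {f : T → E → ℝ} (h : JetCont f) (c : ℝ) : JetCont fun τ z => c * f τ z :=
  (jetCont_fixed (smoothNear_const c 0)).mul h

theorem JetCont.sub {f g : T → E → ℝ} (h : JetCont f) (h' : JetCont g) :
    JetCont fun τ z => f τ z - g τ z :=
  (h.add (h'.const_mul (-1))).congr fun τ => .of_forall fun z => by ring

theorem JetCont.dirD {f : T → E → ℝ} (h : JetCont f) (v : E) : JetCont fun τ => dirD v (f τ) :=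
  ⟨fun τ => (h.smooth τ).dirD v, fun n => (h.cont (n + 1)).2 v⟩

/-- Composition with a fixed map of the plane. -/
theorem JetContN.comp {h : Plane → Plane} (hh : SmoothNear h 0) (h0 : h 0 = 0) :
    ∀ {n : ℕ} {f : T → Plane → ℝ}, JetContN n f → (∀ τ, SmoothNear (f τ) 0) →
      JetContN n fun τ z => f τ (h z)
  | 0, f, hf, _ => by
    unfold JetContN; simp only [h0]; exact hf
  | n + 1, f, hf, s => by
    refine ⟨by simp only [h0]; exact hf.1, fun v => ?_⟩
    have s1 : ∀ v τ, SmoothNear (MinkowskiSurface.dirD v (f τ)) 0 := fun v τ => (s τ).dirD v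
    have c1 : ∀ v τ, SmoothNear (fun z => MinkowskiSurface.dirD v (f τ) (h z)) 0 :=
      fun v τ => (s1 v τ).comp_zero hh h0
    have d : SmoothNear (MinkowskiSurface.dirD v h) 0 := hh.dirD v
    have d1 : SmoothNear (fun z => (MinkowskiSurface.dirD v h z).1) 0 :=
      d.mono fun _ h => contDiffAt_fst.comp _ h
    have d2 : SmoothNear (fun z => (MinkowskiSurface.dirD v h z).2) 0 :=
      d.mono fun _ h => contDiffAt_snd.comp _ h
    -- Chain rule in coordinates: the components of dh do not depend on the parameter, and the
    -- induction hypothesis covers the partial derivatives of `f τ` composed with `h`.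
    refine (((jetContN_fixed n _).mul (JetContN.comp hh h0 (hf.2 (1, 0)) (s1 _)) (fun _ => d1)
      (c1 _)).add ((jetContN_fixed n _).mul (JetContN.comp hh h0 (hf.2 (0, 1)) (s1 _))
      (fun _ => d2) (c1 _)) (fun τ => d1.mul (c1 _ τ)) (fun τ => d2.mul (c1 _ τ))).congr fun τ => ?_
    filter_upwards [(hh.tendsto_zero h0).eventually (s τ).eventually_differentiableAt,
      hh.eventually_differentiableAt] with z h1 h2
    refine (dirD_comp (a' := ((1, 0) : Plane)) (b' := (0, 1)) h1 h2 v ?_).symm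
    ext <;> simp

theorem JetCont.comp {f : T → Plane → ℝ} (hf : JetCont f) {h : Plane → Plane}
    (hh : SmoothNear h 0) (h0 : h 0 = 0) : JetCont fun τ z => f τ (h z) :=
  ⟨fun τ => (hf.smooth τ).comp_zero hh h0, fun n => (hf.cont n).comp hh h0 hf.smooth⟩

/-- A family of maps into Minkowski space whose jets at the origin depend continuously on the
parameter. -/
def VecJetCont (X : T → E → R31) : Prop := ∀ i, JetCont fun τ z => X τ z i

theorem dirD_apply {X : E → R31} {z : E} (hX : DifferentiableAt ℝ X z) (v : E) (i : Fin 3) :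
    dirD v (fun z => X z i) z = dirD v X z i := by
  have := fderiv_apply hX i
  rw [dirD, this]
  rfl

theorem smoothNear_pi {X : E → R31} {z : E} : SmoothNear X z ↔ ∀ i, SmoothNear (fun z => X z i) z := by
  unfold SmoothNear
  rw [← eventually_all]
  simp only [contDiffAt_pi]

theorem VecJetCont.smooth {X : T → E → R31} (h : VecJetCont X) (τ : T) : SmoothNear (X τ) 0 :=
  smoothNear_pi.2 fun i => (h i).smooth τ

theorem VecJetCont.dirD {X : T → E → R31} (h : VecJetCont X) (v : E) :
    VecJetCont fun τ => dirD v (X τ) := fun i =>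
  ((h i).dirD v).congr fun τ => by
    filter_upwards [(h.smooth τ).eventually_differentiableAt] with z hz
    exact dirD_apply hz v i

theorem VecJetCont.mink {X Y : T → E → R31} (h : VecJetCont X) (h' : VecJetCont Y) :
    JetCont fun τ z => mink (X τ z) (Y τ z) :=
  (((h 0).mul (h' 0)).add ((h 1).mul (h' 1))).sub ((h 2).mul (h' 2))

theorem VecJetCont.mcross {X Y : T → E → R31} (h : VecJetCont X) (h' : VecJetCont Y) :
    VecJetCont fun τ z => mcross (X τ z) (Y τ z) := by
  intro i
  fin_cases i
  · exact ((h 1).mul (h' 2)).sub ((h 2).mul (h' 1))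
  · exact ((h 2).mul (h' 0)).sub ((h 0).mul (h' 2))
  · exact (((h 0).mul (h' 1)).sub ((h 1).mul (h' 0))).const_mul (-1) |>.congr
      fun τ => .of_forall fun z => by simp [MinkowskiSurface.mcross]

theorem VecJetCont.gLd {X : T → E → R31} (h : VecJetCont X) (a b : E) :
    JetCont fun τ => gLd a b (X τ) :=
  ((((h.dirD a).mink (h.dirD b)).mul ((h.dirD a).mink (h.dirD b))).sub
    (((h.dirD a).mink (h.dirD a)).mul ((h.dirD b).mink (h.dirD b)))).congr
    fun τ => .of_forall fun z => by simp only [MinkowskiSurface.gLd, ldForm]; ring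

theorem VecJetCont.gMc {X : T → E → R31} (h : VecJetCont X) (a b : E) :
    JetCont fun τ => gMc a b (X τ) :=
  have n := (h.dirD a).mcross (h.dirD b)
  ((((n.mink ((h.dirD a).dirD a)).mul ((h.dirD b).mink (h.dirD b))).sub
    (((n.mink ((h.dirD a).dirD b)).mul ((h.dirD a).mink (h.dirD b))).const_mul 2)).add
    ((n.mink ((h.dirD b).dirD b)).mul ((h.dirD a).mink (h.dirD a)))).congr
    fun τ => .of_forall fun z => by simp only [MinkowskiSurface.gMc, mcForm]; ring

/-- Continuity of the jets, in the sense of iterated Fréchet derivatives. -/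
theorem vecJetCont_of_iteratedFDeriv {X : T → E → R31} (hs : ∀ τ, SmoothNear (X τ) 0)
    (hc : ∀ k, Continuous fun τ => iteratedFDeriv ℝ k (X τ) 0) : VecJetCont X := by
  -- The statement is taken for all k at once, because differentiating in the direction v prepends v
  -- to `m` and raises k by one. Only k = 0 is used at the end.
  have key : ∀ (n k : ℕ) (m : Fin k → E) (i : Fin 3),
      JetContN n fun τ z => iteratedFDeriv ℝ k (X τ) z m i := by
    intro n
    induction n with
    | zero =>
      intro k m i
      have : Continuous fun τ => iteratedFDeriv ℝ k (X τ) 0 m :=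
        (ContinuousMultilinearMap.apply ℝ (fun _ : Fin k => E) R31 m).continuous.comp (hc k)
      exact (continuous_apply i).comp this
    | succ n ih =>
      intro k m i
      refine ⟨(ih k m i).continuous, fun v => (ih (k + 1) (Fin.cons v m) i).congr fun τ => ?_⟩
      filter_upwards [hs τ] with z hz
      have hd : DifferentiableAt ℝ (iteratedFDeriv ℝ k (X τ)) z :=
        hz.differentiableAt_iteratedFDeriv (by exact_mod_cast WithTop.coe_lt_top k)
      have h1 : HasFDerivAt (fun z => iteratedFDeriv ℝ k (X τ) z m)
          ((ContinuousMultilinearMap.apply ℝ (fun _ : Fin k => E) R31 m).comp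
            (fderiv ℝ (iteratedFDeriv ℝ k (X τ)) z)) z :=
        (ContinuousMultilinearMap.apply ℝ (fun _ : Fin k => E) R31 m).hasFDerivAt.comp z
          hd.hasFDerivAt
      rw [dirD_apply h1.differentiableAt, MinkowskiSurface.dirD, h1.fderiv,
        iteratedFDeriv_succ_apply_left]
      simp
  intro i
  exact ⟨fun τ => smoothNear_pi.1 (hs τ) i, fun n =>
    (key n 0 ![] i).congr fun τ => .of_forall fun z => by simp⟩

end JetCont

/-! ### The jet topologies on parametrisations and on deformations. -/

theorem continuous_jets_localParam :
    Continuous fun (x : LocalParam) (k : ℕ) => iteratedFDeriv ℝ k x.toFun 0 :=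
  continuous_induced_dom

theorem continuous_jets_deformation (x : LocalParam) :
    Continuous fun (X : Deformation x) (k : ℕ) => iteratedFDeriv ℝ k X.toFun 0 :=
  continuous_induced_dom

theorem vecJetCont_localParam : VecJetCont LocalParam.toFun :=
  vecJetCont_of_iteratedFDeriv (fun x => x.smooth) fun k =>
    continuous_pi_iff.1 continuous_jets_localParam k

theorem vecJetCont_deformation (x : LocalParam) :
    VecJetCont (Deformation.toFun : Deformation x → ℝ × Plane → R31) :=
  vecJetCont_of_iteratedFDeriv (fun X => X.smooth) fun k =>
    continuous_pi_iff.1 (continuous_jets_deformation x) k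


/-! The three curves near a point where they meet. -/

theorem SmoothNear.neg {E : Type*} [NormedAddCommGroup E] [NormedSpace ℝ E] {f : E → ℝ} {a : E}
    (hf : SmoothNear f a) : SmoothNear (fun z => -f z) a :=
  ((smoothNear_const (-1 : ℝ) a).mul hf).congr (.of_forall fun z => by simp)

/-- The function defining the `LPL`, in terms of those defining the `LD` and the `MCNC`. -/
def pencilDisc {E : Type*} (f h k : E → ℝ) (z : E) : ℝ := h z ^ 2 + 4 * f z * k z

theorem SmoothNear.pencilDisc {E : Type*} [NormedAddCommGroup E] [NormedSpace ℝ E]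
    {f h k : E → ℝ} {a : E} (hf : SmoothNear f a) (hh : SmoothNear h a) (hk : SmoothNear k a) :
    SmoothNear (pencilDisc f h k) a :=
  ((hh.mul hh).add (((smoothNear_const 4 a).mul hf).mul hk)).congr
    (.of_forall fun z => by simp [MinkowskiSurface.pencilDisc, pow_two])

/-- At a common zero of `f` and `h` the square contributes nothing to first order. For k ≠ 0 this
makes the `LPL` regular there and tangent to the `LD`. -/
theorem fderiv_pencilDisc {E : Type*} [NormedAddCommGroup E] [NormedSpace ℝ E] {f h k : E → ℝ}
    {a : E} (hf : SmoothNear f a) (hh : SmoothNear h a) (hk : SmoothNear k a) (h1 : f a = 0)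
    (h2 : h a = 0) (e : E) : fderiv ℝ (pencilDisc f h k) a e = 4 * k a * fderiv ℝ f a e := by
  have := (hh.differentiableAt.hasFDerivAt.pow 2).add
    ((hf.differentiableAt.hasFDerivAt.const_mul 4).mul hk.differentiableAt.hasFDerivAt)
  have h3 : fderiv ℝ (pencilDisc f h k) a = _ := this.fderiv
  rw [h3]
  simp [h1, h2]
  ring

/-- The roots `α`, `β`, `η` in the last variable of `f`, of `h² + 4 f k` and of `h`, over a box where
`P` holds. -/
structure CurveData (P : ℝ × Plane → Prop) (f h k : ℝ × Plane → ℝ) (r ρ : ℝ)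
    (α β η : ℝ → ℝ → ℝ) : Prop where
  smooth_ld : ContDiffOn ℝ ∞ (fun z : ℝ × ℝ => α z.1 z.2) (Ioo (-r) r ×ˢ Ioo (-r) r)
  smooth_lpl : ContDiffOn ℝ ∞ (fun z : ℝ × ℝ => β z.1 z.2) (Ioo (-r) r ×ˢ Ioo (-r) r)
  smooth_mcnc : ContDiffOn ℝ ∞ (fun z : ℝ × ℝ => η z.1 z.2) (Ioo (-r) r ×ˢ Ioo (-r) r)
  mem : ∀ t X, |t| < r → |X| < r → |α t X| < ρ ∧ |β t X| < ρ ∧ |η t X| < ρ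
  ld_iff : ∀ t X Y, |t| < r → |X| < r → |Y| < ρ → (f (t, X, Y) = 0 ↔ Y = α t X)
  pos_iff : ∀ t X Y, |t| < r → |X| < r → |Y| < ρ → (0 < f (t, X, Y) ↔ α t X < Y)
  lpl_iff : ∀ t X Y, |t| < r → |X| < r → |Y| < ρ → (pencilDisc f h k (t, X, Y) = 0 ↔ Y = β t X)
  mcnc_iff : ∀ t X Y, |t| < r → |X| < r → |Y| < ρ → (h (t, X, Y) = 0 ↔ Y = η t X)
  order_pos : ∀ t X, |t| < r → |X| < r → α t X < η t X → α t X < β t X ∧ β t X < η t X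
  order_neg : ∀ t X, |t| < r → |X| < r → η t X < α t X → α t X < β t X
  order_zero : ∀ t X, |t| < r → |X| < r → η t X = α t X → β t X = α t X
  prop : ∀ t X Y, |t| < r → |X| < r → |Y| < ρ → P (t, X, Y)
  ld_pos : ∀ t X Y, |t| < r → |X| < r → |Y| < ρ → 0 < fderiv ℝ f (t, X, Y) (0, 0, 1)
  mcnc_pos : ∀ t X Y, |t| < r → |X| < r → |Y| < ρ → 0 < fderiv ℝ h (t, X, Y) (0, 0, 1)
  lpl_neg : ∀ t X Y, |t| < r → |X| < r → |Y| < ρ →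
    fderiv ℝ (pencilDisc f h k) (t, X, Y) (0, 0, 1) < 0

/-- As k < 0, the functions f, h and -(h² + 4 f k) all increase in the last variable near the
origin, so the three zero sets are graphs. The discriminant equals h² on the first graph and 4 f k
on that of h; comparing signs gives the order of the three graphs over each point. -/
theorem exists_curveData {P : ℝ × Plane → Prop} {f h k : ℝ × Plane → ℝ}
    (hP : ∀ᶠ z in 𝓝 (0 : ℝ × Plane), P z) (hf : SmoothNear f 0) (hh : SmoothNear h 0)
    (hk : SmoothNear k 0) (f0 : f 0 = 0) (h0 : h 0 = 0) (k0 : k 0 < 0)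
    (fY : 0 < fderiv ℝ f 0 (0, 0, 1)) (hY : 0 < fderiv ℝ h 0 (0, 0, 1)) {κ : ℝ} (hκ : 0 < κ) :
    ∃ r ρ, 0 < r ∧ r < κ ∧ 0 < ρ ∧ ρ < κ ∧ ∃ α β η, CurveData P f h k r ρ α β η := by
  -- The sign makes `g` increasing in the last variable, as `exists_graph` expects.
  set g : ℝ × Plane → ℝ := fun z => -pencilDisc f h k z with hg
  have sg : SmoothNear g 0 := (hf.pencilDisc hh hk).neg
  have g0 : g 0 = 0 := by simp [hg, pencilDisc, f0, h0]
  have hgd : ∀ z e, fderiv ℝ g z e = -fderiv ℝ (pencilDisc f h k) z e := by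
    intro z e
    rw [hg, fderiv_fun_neg]; rfl
  have gY : 0 < fderiv ℝ g 0 (0, 0, 1) := by
    rw [hgd, fderiv_pencilDisc hf hh hk f0 h0]
    nlinarith
  have c1 := (hf.fderiv_apply (0, 0, 1)).contDiffAt.continuousAt.eventually (lt_mem_nhds fY)
  have c2 := (hh.fderiv_apply (0, 0, 1)).contDiffAt.continuousAt.eventually (lt_mem_nhds hY)
  have c3 := (sg.fderiv_apply (0, 0, 1)).contDiffAt.continuousAt.eventually (lt_mem_nhds gY)
  have c4 := hk.contDiffAt.continuousAt.eventually (gt_mem_nhds k0)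
  obtain ⟨ρ₀, hρ₀, hbox⟩ := exists_box_of_eventually
    (hP.and ((hf.and (hh.and sg)).and ((c1.and c2).and (c3.and c4))))
  set ρ := min ρ₀ (κ / 2) with hρdef
  have hρ : 0 < ρ := lt_min hρ₀ (by positivity)
  have hρ0 : ρ ≤ ρ₀ := min_le_left _ _
  have hρκ : ρ < κ := (min_le_right _ _).trans_lt (by linarith)
  have hb : ∀ t X Y : ℝ, |t| ≤ ρ → |X| ≤ ρ → |Y| ≤ ρ → _ := fun t X Y h1 h2 h3 =>
    hbox t X Y (h1.trans hρ0) (h2.trans hρ0) (h3.trans hρ0)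
  obtain ⟨r₁, hr₁, hr₁ρ, s₁⟩ := exists_sign_box hρ f0
    (fun t X Y h1 h2 h3 => (hb t X Y h1 h2 h3).2.1.1)
    (fun t X Y h1 h2 h3 => (hb t X Y h1 h2 h3).2.2.1.1)
  obtain ⟨r₂, hr₂, hr₂ρ, s₂⟩ := exists_sign_box hρ h0
    (fun t X Y h1 h2 h3 => (hb t X Y h1 h2 h3).2.1.2.1)
    (fun t X Y h1 h2 h3 => (hb t X Y h1 h2 h3).2.2.1.2)
  obtain ⟨r₃, hr₃, hr₃ρ, s₃⟩ := exists_sign_box hρ g0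
    (fun t X Y h1 h2 h3 => (hb t X Y h1 h2 h3).2.1.2.2)
    (fun t X Y h1 h2 h3 => (hb t X Y h1 h2 h3).2.2.2.1)
  set r := min r₁ (min r₂ r₃) with hr
  have hr0 : 0 < r := lt_min hr₁ (lt_min hr₂ hr₃)
  have hrr1 : r ≤ r₁ := min_le_left _ _
  have hrr2 : r ≤ r₂ := (min_le_right _ _).trans (min_le_left _ _)
  have hrr3 : r ≤ r₃ := (min_le_right _ _).trans (min_le_right _ _)
  have hrρ : r ≤ ρ := hrr1.trans hr₁ρ
  have hb' : ∀ t X Y : ℝ, |t| < r → |X| < r → |Y| ≤ ρ → _ := fun t X Y h1 h2 h3 =>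
    hb t X Y (h1.le.trans hrρ) (h2.le.trans hrρ) h3
  obtain ⟨α, sα, hα⟩ := exists_graph (ε := r) (r := r) hρ
    (fun t X Y h1 h2 h3 => (hb' t X Y h1 h2 h3).2.1.1)
    (fun t X Y h1 h2 h3 => (hb' t X Y h1 h2 h3).2.2.1.1)
    (fun t X h1 h2 => (s₁ t X (h1.trans_le hrr1) (h2.trans_le hrr1)).1)
    (fun t X h1 h2 => (s₁ t X (h1.trans_le hrr1) (h2.trans_le hrr1)).2)
  obtain ⟨η, sη, hη⟩ := exists_graph (ε := r) (r := r) hρ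
    (fun t X Y h1 h2 h3 => (hb' t X Y h1 h2 h3).2.1.2.1)
    (fun t X Y h1 h2 h3 => (hb' t X Y h1 h2 h3).2.2.1.2)
    (fun t X h1 h2 => (s₂ t X (h1.trans_le hrr2) (h2.trans_le hrr2)).1)
    (fun t X h1 h2 => (s₂ t X (h1.trans_le hrr2) (h2.trans_le hrr2)).2)
  obtain ⟨β, sβ, hβ⟩ := exists_graph (ε := r) (r := r) hρ
    (fun t X Y h1 h2 h3 => (hb' t X Y h1 h2 h3).2.1.2.2)
    (fun t X Y h1 h2 h3 => (hb' t X Y h1 h2 h3).2.2.2.1)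
    (fun t X h1 h2 => (s₃ t X (h1.trans_le hrr3) (h2.trans_le hrr3)).1)
    (fun t X h1 h2 => (s₃ t X (h1.trans_le hrr3) (h2.trans_le hrr3)).2)
  have fα : ∀ t X, |t| < r → |X| < r → f (t, X, α t X) = 0 := fun t X ht hX =>
    (((hα t X ht hX).2 _ (hα t X ht hX).1.le).1).2 rfl
  have hη0 : ∀ t X, |t| < r → |X| < r → h (t, X, η t X) = 0 := fun t X ht hX =>
    (((hη t X ht hX).2 _ (hη t X ht hX).1.le).1).2 rfl
  have neg : ∀ t X Y, |t| < r → |X| < r → |Y| ≤ ρ → (g (t, X, Y) < 0 ↔ Y < β t X) := by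
    intro t X Y ht hX hY
    obtain ⟨e1, e2⟩ := (hβ t X ht hX).2 Y hY
    rw [← not_le, ← not_le, not_iff_not, le_iff_lt_or_eq, le_iff_lt_or_eq, e2,
      eq_comm (a := (0 : ℝ)), e1, eq_comm (a := Y)]
  -- On the zero set of `f` the value of `g` is -h², negative away from the zeros of `h`; so that
  -- point lies below the root `β`, whichever side `η` is on.
  have lt_β : ∀ t X, |t| < r → |X| < r → η t X ≠ α t X → α t X < β t X := by
    intro t X ht hX hne
    rw [← neg t X _ ht hX (hα t X ht hX).1.le]
    have : h (t, X, α t X) ≠ 0 := fun hc =>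
      hne (((hη t X ht hX).2 _ (hα t X ht hX).1.le).1.1 hc).symm
    have := sq_pos_of_ne_zero this
    simp only [hg, pencilDisc, fα t X ht hX]
    linarith
  refine ⟨r, ρ, hr0, hrρ.trans_lt hρκ, hρ, hρκ, α, β, η, ?_⟩
  refine ⟨sα, sβ, sη, fun t X ht hX => ⟨(hα t X ht hX).1, (hβ t X ht hX).1, (hη t X ht hX).1⟩,
    fun t X Y ht hX hY => ((hα t X ht hX).2 Y hY.le).1,
    fun t X Y ht hX hY => ((hα t X ht hX).2 Y hY.le).2,
    fun t X Y ht hX hY => ?_,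
    fun t X Y ht hX hY => ((hη t X ht hX).2 Y hY.le).1,
    fun t X ht hX hlt => ⟨lt_β t X ht hX hlt.ne', ?_⟩,
    fun t X ht hX hlt => lt_β t X ht hX hlt.ne,
    fun t X ht hX he => ?_,
    fun t X Y ht hX hY => (hb' t X Y ht hX hY.le).1,
    fun t X Y ht hX hY => (hb' t X Y ht hX hY.le).2.2.1.1,
    fun t X Y ht hX hY => (hb' t X Y ht hX hY.le).2.2.1.2,
    fun t X Y ht hX hY => ?_⟩
  · rw [← ((hβ t X ht hX).2 Y hY.le).1]
    simp [hg]
  -- On the zero set of `h` the value of `g` is -4 f k, positive where f > 0; so `η` lies above `β`.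
  · rw [← ((hβ t X ht hX).2 _ (hη t X ht hX).1.le).2]
    have h1 := (((hα t X ht hX).2 _ (hη t X ht hX).1.le).2).2 hlt
    have h2 : k (t, X, η t X) < 0 := (hb' t X _ ht hX (hη t X ht hX).1.le).2.2.2.2
    simp only [hg, pencilDisc, hη0 t X ht hX]
    nlinarith [mul_pos h1 (neg_pos.2 h2)]
  · refine ((((hβ t X ht hX).2 _ (hα t X ht hX).1.le).1).1 ?_).symm
    have := hη0 t X ht hX
    rw [he] at this
    simp [hg, pencilDisc, fα t X ht hX, this]
  · have : 0 < fderiv ℝ g (t, X, Y) (0, 0, 1) := (hb' t X Y ht hX hY.le).2.2.2.1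
    rw [hgd] at this
    linarith

/-- In a local picture, any two of the curves meet where the `MCNC` meets the `LD`. -/
theorem LocalPicture.inter {x : Plane → R31} {A : Plane ≃L[ℝ] Plane} {r ρ : ℝ} {α β η : ℝ → ℝ}
    (h : LocalPicture x A r ρ α β η) {S : Set Plane}
    (hS : ∀ q, q ∈ S ↔ ∃ X, |X| < r ∧ η X = α X ∧ q = A (X, α X)) :
    LD x ∩ MCNC x ∩ box A r ρ = S ∧ LD x ∩ LPL x ∩ box A r ρ = S ∧
      LPL x ∩ MCNC x ∩ box A r ρ = S := by
  refine ⟨?_, ?_, ?_⟩ <;> ext q <;> rw [hS] <;> constructor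
  · rintro ⟨⟨h1, h2⟩, X, Y, hX, hY, rfl⟩
    rw [h.ld_iff X Y hX hY] at h1
    rw [h.mcnc_iff X Y hX hY] at h2
    exact ⟨X, hX, h2 ▸ h1, by rw [← h1]⟩
  · rintro ⟨X, hX, he, rfl⟩
    have hm := (h.mem_box X hX).1
    exact ⟨⟨(h.ld_iff X _ hX hm).2 rfl, (h.mcnc_iff X _ hX hm).2 he.symm⟩, X, _, hX, hm, rfl⟩
  · rintro ⟨⟨h1, h2⟩, X, Y, hX, hY, rfl⟩
    rw [h.ld_iff X Y hX hY] at h1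
    rw [h.lpl_iff X Y hX hY] at h2
    refine ⟨X, hX, ?_, by rw [← h1]⟩
    have he : α X = β X := h1 ▸ h2
    rcases lt_trichotomy (η X) (α X) with hlt | heq | hgt
    · exact absurd he (h.order_neg X hX hlt).ne
    · exact heq
    · exact absurd he (h.order_pos X hX hgt).1.ne
  · rintro ⟨X, hX, he, rfl⟩
    have hm := (h.mem_box X hX).1
    exact ⟨⟨(h.ld_iff X _ hX hm).2 rfl, (h.lpl_iff X _ hX hm).2 (h.order_zero X hX he).symm⟩,
      X, _, hX, hm, rfl⟩
  · rintro ⟨⟨h1, h2⟩, X, Y, hX, hY, rfl⟩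
    rw [h.lpl_iff X Y hX hY] at h1
    rw [h.mcnc_iff X Y hX hY] at h2
    have he : β X = η X := h1 ▸ h2
    rcases lt_trichotomy (η X) (α X) with hlt | heq | hgt
    · exact absurd he ((hlt.trans (h.order_neg X hX hlt)).ne')
    · exact ⟨X, hX, heq, by rw [h2, heq]⟩
    · exact absurd he (h.order_pos X hX hgt).2.ne
  · rintro ⟨X, hX, he, rfl⟩
    have hm := (h.mem_box X hX).1
    exact ⟨⟨(h.lpl_iff X _ hX hm).2 (h.order_zero X hX he).symm, (h.mcnc_iff X _ hX hm).2 he.symm⟩,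
      X, _, hX, hm, rfl⟩

/-- Transfer from the family to its members. -/
theorem smoothNear_member {φ : Plane → ℝ} {g : ℝ × Plane → ℝ} {A : Plane ≃L[ℝ] Plane}
    {z : ℝ × Plane} (hg : SmoothNear g z) (h : ∀ᶠ q in 𝓝 z.2, φ (A q) = g (z.1, q)) :
    SmoothNear φ (A z.2) ∧ ∀ e, fderiv ℝ φ (A z.2) (A e) = fderiv ℝ g z (0, e) := by
  have h1 : SmoothNear (fun q : Plane => g (z.1, q)) z.2 :=
    SmoothNear.comp (g := g) (f := fun q : Plane => (z.1, q)) hg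
      (smoothNear_of_contDiff (by fun_prop) _)
  have h2 : SmoothNear (fun q => φ (A q)) z.2 := h1.congr (by
    filter_upwards [h] with q hq using hq.symm)
  have h3 : SmoothNear φ (A z.2) := by
    have : SmoothNear (fun q => φ (A (A.symm q))) (A z.2) :=
      SmoothNear.comp (g := fun q => φ (A q)) (f := A.symm) (by simpa using h2)
        (smoothNear_of_contDiff A.symm.contDiff _)
    simpa using this
  refine ⟨h3, fun e => ?_⟩
  have h4 : fderiv ℝ (fun q => φ (A q)) z.2 e = fderiv ℝ φ (A z.2) (A e) := by
    have : fderiv ℝ (fun q => φ (A q)) z.2 = _ :=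
      (h3.differentiableAt.hasFDerivAt.comp z.2 A.hasFDerivAt).fderiv
    rw [this]; rfl
  rw [← h4]
  have h5 : (fun q => φ (A q)) =ᶠ[𝓝 z.2] fun q => g (z.1, q) := h
  rw [h5.fderiv_eq]
  exact dirD_slice hg.differentiableAt e


/-! The bifurcation in a family. -/

section Smooth

variable {E : Type*} [NormedAddCommGroup E] [NormedSpace ℝ E]

theorem SmoothNear.sub {f g : E → ℝ} {a : E} (hf : SmoothNear f a) (hg : SmoothNear g a) :
    SmoothNear (fun z => f z - g z) a := by
  unfold SmoothNear
  filter_upwards [hf, hg] with z h1 h2 using h1.sub h2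

theorem SmoothNear.mink {X Y : E → R31} {a : E} (hX : SmoothNear X a) (hY : SmoothNear Y a) :
    SmoothNear (fun z => mink (X z) (Y z)) a :=
  have h := smoothNear_pi.1 hX
  have h' := smoothNear_pi.1 hY
  (((h 0).mul (h' 0)).add ((h 1).mul (h' 1))).sub ((h 2).mul (h' 2))

theorem SmoothNear.mcross {X Y : E → R31} {a : E} (hX : SmoothNear X a) (hY : SmoothNear Y a) :
    SmoothNear (fun z => mcross (X z) (Y z)) a := by
  have h := smoothNear_pi.1 hX
  have h' := smoothNear_pi.1 hY
  refine smoothNear_pi.2 fun i => ?_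
  fin_cases i
  · exact ((h 1).mul (h' 2)).sub ((h 2).mul (h' 1))
  · exact ((h 2).mul (h' 0)).sub ((h 0).mul (h' 2))
  · exact (((h 0).mul (h' 1)).sub ((h 1).mul (h' 0))).neg

theorem SmoothNear.gLd {X : E → R31} {z : E} (h : SmoothNear X z) (a b : E) :
    SmoothNear (gLd a b X) z :=
  ((((h.dirD a).mink (h.dirD b)).mul ((h.dirD a).mink (h.dirD b))).sub
    (((h.dirD a).mink (h.dirD a)).mul ((h.dirD b).mink (h.dirD b)))).congr
    (.of_forall fun z => by simp only [MinkowskiSurface.gLd, ldForm]; ring)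

theorem SmoothNear.gMc {X : E → R31} {z : E} (h : SmoothNear X z) (a b : E) :
    SmoothNear (gMc a b X) z :=
  have n := (h.dirD a).mcross (h.dirD b)
  ((((n.mink ((h.dirD a).dirD a)).mul ((h.dirD b).mink (h.dirD b))).sub
    (((smoothNear_const 2 z).mul (n.mink ((h.dirD a).dirD b))).mul
      ((h.dirD a).mink (h.dirD b)))).add
    ((n.mink ((h.dirD b).dirD b)).mul ((h.dirD a).mink (h.dirD a)))).congr
    (.of_forall fun z => by simp only [MinkowskiSurface.gMc, mcForm])

theorem SmoothNear.gKap {X : E → R31} {z : E} (h : SmoothNear X z) (a b : E) :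
    SmoothNear (gKap a b X) z :=
  have n := (h.dirD a).mcross (h.dirD b)
  (((n.mink ((h.dirD a).dirD a)).mul (n.mink ((h.dirD b).dirD b))).sub
    ((n.mink ((h.dirD a).dirD b)).mul (n.mink ((h.dirD a).dirD b)))).congr
    (.of_forall fun z => by simp only [MinkowskiSurface.gKap, kapForm]; ring)

end Smooth

theorem SmoothNear.ldFun {x : Plane → R31} {q : Plane} (h : SmoothNear x q) :
    SmoothNear (ldFun x) q := h.gLd _ _

theorem SmoothNear.mcncFun {x : Plane → R31} {q : Plane} (h : SmoothNear x q) :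
    SmoothNear (mcncFun x) q := h.gMc _ _

theorem SmoothNear.kapFun {x : Plane → R31} {q : Plane} (h : SmoothNear x q) :
    SmoothNear (kapFun x) q := h.gKap _ _

theorem lplFun_eq_pencilDisc (x : Plane → R31) :
    lplFun x = pencilDisc (ldFun x) (mcncFun x) (kapFun x) := funext fun q => lplFun_eq x q

theorem SmoothNear.lplFun {x : Plane → R31} {q : Plane} (h : SmoothNear x q) :
    SmoothNear (lplFun x) q := by
  rw [lplFun_eq_pencilDisc]
  exact h.ldFun.pencilDisc h.mcncFun h.kapFun

theorem lplFun_eq_sq (x : Plane → R31) (q : Plane) :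
    ∀ᶠ z in 𝓝 q, ldFun x z = 0 → lplFun x z = mcncFun x z ^ 2 :=
  .of_forall fun z hz => by rw [lplFun_eq, hz]; ring

/-! ### Families in adapted linear coordinates. -/

section Family

variable (A : Plane ≃L[ℝ] Plane) (c : ℝ) (X : ℝ × Plane → R31)

/-- The linear change of parameters `A`, applied to the members of a family. -/
def paramMap : ℝ × Plane →L[ℝ] ℝ × Plane :=
  (ContinuousLinearMap.fst ℝ ℝ Plane).prod
    ((A : Plane →L[ℝ] Plane).comp (ContinuousLinearMap.snd ℝ ℝ Plane))

theorem paramMap_apply (z : ℝ × Plane) : paramMap A z = (z.1, A z.2) := rfl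

def famLd (z : ℝ × Plane) : ℝ := gLd (0, 1, 0) (0, 0, 1) X (paramMap A z)

/-- The factor c = ±1 will be the sign of l. It makes this function increase on the same side as the
one defining the `LD`. -/
def famMc (z : ℝ × Plane) : ℝ := c * gMc (0, 1, 0) (0, 0, 1) X (paramMap A z)

def famKap (z : ℝ × Plane) : ℝ := gKap (0, 1, 0) (0, 0, 1) X (paramMap A z)

variable {A c X}

theorem smoothNear_fam {z : ℝ × Plane} (hX : SmoothNear X (paramMap A z)) :
    SmoothNear (famLd A X) z ∧ SmoothNear (famMc A c X) z ∧ SmoothNear (famKap A X) z := by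
  have hι := smoothNear_of_contDiff (paramMap A).contDiff z
  exact ⟨(hX.gLd _ _).comp hι, (smoothNear_const c z).mul ((hX.gMc _ _).comp hι),
    (hX.gKap _ _).comp hι⟩

theorem fam_member (hc : c * c = 1) {z : ℝ × Plane} (hX : SmoothNear X (paramMap A z)) :
    ∀ᶠ q in 𝓝 z.2, ldFun (fun p => X (z.1, p)) (A q) = famLd A X (z.1, q) ∧
      c * mcncFun (fun p => X (z.1, p)) (A q) = famMc A c X (z.1, q) ∧
      lplFun (fun p => X (z.1, p)) (A q) =
        pencilDisc (famLd A X) (famMc A c X) (famKap A X) (z.1, q) := by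
  have hcont : ContinuousAt (fun q : Plane => paramMap A (z.1, q)) z.2 := by fun_prop
  have h : ∀ᶠ w in 𝓝 (paramMap A z), SmoothNear X w := eventually_eventually_nhds.2 hX
  filter_upwards [hcont.eventually h] with q hq
  obtain ⟨h1, h2, h3⟩ := forms_slice hq
  change ldFun (fun p => X (z.1, p)) (A q) = _ at h1
  change mcncFun (fun p => X (z.1, p)) (A q) = _ at h2
  change kapFun (fun p => X (z.1, p)) (A q) = _ at h3
  refine ⟨h1, by rw [h2]; rfl, ?_⟩
  rw [lplFun_eq, h1, h2, h3, pencilDisc, famMc, famLd, famKap]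
  -- The sign c drops out of the discriminant, where H enters squared.
  linear_combination (-gMc (0, 1, 0) (0, 0, 1) X (paramMap A (z.1, q)) ^ 2) * hc

end Family

theorem ldFun_congr {x y : Plane → R31} {q : Plane} (h : x =ᶠ[𝓝 q] y) :
    ldFun x =ᶠ[𝓝 q] ldFun y := gLd_congr h _ _

theorem mcncFun_congr {x y : Plane → R31} {q : Plane} (h : x =ᶠ[𝓝 q] y) :
    mcncFun x =ᶠ[𝓝 q] mcncFun y := gMc_congr h _ _

theorem kapFun_congr {x y : Plane → R31} {q : Plane} (h : x =ᶠ[𝓝 q] y) :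
    kapFun x =ᶠ[𝓝 q] kapFun y := gKap_congr h _ _

theorem lplFun_congr {x y : Plane → R31} {q : Plane} (h : x =ᶠ[𝓝 q] y) :
    lplFun x =ᶠ[𝓝 q] lplFun y := by
  filter_upwards [ldFun_congr h, mcncFun_congr h, kapFun_congr h] with p h1 h2 h3
  rw [lplFun_eq, lplFun_eq, h1, h2, h3]

/-- Derivatives along the graph of a function `u`. -/
theorem hasFDerivAt_graph {f : ℝ × Plane → ℝ} {u : ℝ × ℝ → ℝ} {z : ℝ × ℝ}
    (hu : DifferentiableAt ℝ u z) (hf : DifferentiableAt ℝ f (z.1, z.2, u z)) (e : ℝ × ℝ) :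
    fderiv ℝ (fun y : ℝ × ℝ => f (y.1, y.2, u y)) z e =
      fderiv ℝ f (z.1, z.2, u z) (e.1, e.2, fderiv ℝ u z e) := by
  have h1 : HasFDerivAt (fun y : ℝ × ℝ => (y.1, y.2, u y))
      ((ContinuousLinearMap.fst ℝ ℝ ℝ).prod ((ContinuousLinearMap.snd ℝ ℝ ℝ).prod
        (fderiv ℝ u z))) z :=
    hasFDerivAt_fst.prodMk (hasFDerivAt_snd.prodMk hu.hasFDerivAt)
  have h2 := HasFDerivAt.comp (g := f) z hf.hasFDerivAt h1
  have h3 : fderiv ℝ (fun y : ℝ × ℝ => f (y.1, y.2, u y)) z = _ := h2.fderiv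
  rw [h3]
  rfl

theorem clm_triple_apply (L : ℝ × Plane →L[ℝ] ℝ) (a b c : ℝ) :
    L (a, b, c) = a * L (1, 0) + b * L (0, 1, 0) + c * L (0, 0, 1) := by
  have : ((a, b, c) : ℝ × Plane) = a • ((1, 0) : ℝ × Plane) + b • ((0, 1, 0) : ℝ × Plane)
      + c • ((0, 0, 1) : ℝ × Plane) := by ext <;> simp
  rw [this, map_add, map_add, map_smul, map_smul, map_smul]
  rfl

/-- The function defining the `LD`, restricted to the `MCNC` of M_t and multiplied by s, is a
function W of t and the horizontal coordinate. The fold condition makes its second derivative along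
the curve positive, and `hτ` makes its t-derivative nonzero. Then `exists_fold` gives the zeros and
signs of W, that is, the position of the `MCNC` relative to the `LD`, and `CurveData` places the
`LPL`. -/
theorem bifurcates_of_fold {x : LocalParam} (X : Deformation x) {s : ℝ} (hs : s = 1 ∨ s = -1)
    (hfold : FoldContact s (ldFun x.toFun) (mcncFun x.toFun)) (hκ : kapFun x.toFun 0 < 0) {l : ℝ}
    (hl : ∀ e, fderiv ℝ (mcncFun x.toFun) 0 e = l * fderiv ℝ (ldFun x.toFun) 0 e)
    (hτ : dirD (1, 0) (gMc (0, 1, 0) (0, 0, 1) X.toFun) 0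
      - l * dirD (1, 0) (gLd (0, 1, 0) (0, 0, 1) X.toFun) 0 ≠ 0) :
    ∃ σ : ℝ, (σ = 1 ∨ σ = -1) ∧ Bifurcates X s σ := by
  have sδ := x.smooth.ldFun
  have sH := x.smooth.mcncFun
  obtain ⟨δ0, δd, H0, l', hl', hQ⟩ := (foldContact_iff sδ sH).1 hfold
  -- Coordinates in which the `LD` has a horizontal tangent and the Lorentzian region is above it.
  obtain ⟨A, hA1, hA2⟩ := exists_adapted_coords δd
  obtain rfl : l = l' := by
    have := (hl (A (0, 1))).symm.trans (hl' (A (0, 1)))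
    exact mul_right_cancel₀ hA2.ne' this
  have hAinj : ∀ e, A e = 0 → e = 0 := fun e he => A.map_eq_zero_iff.1 he
  have hl0 : l ≠ 0 := by
    rintro rfl
    have := hQ (A (1, 0)) (fun h => by simpa using congrArg Prod.fst (hAinj _ h)) hA1
    simp at this
  obtain ⟨c, hc, hcl⟩ : ∃ c : ℝ, c * c = 1 ∧ 0 < c * l := by
    rcases lt_or_gt_of_ne hl0 with h | h
    · exact ⟨-1, by norm_num, by linarith⟩
    · exact ⟨1, by norm_num, by linarith⟩
  have hc0 : c ≠ 0 := by rintro rfl; simp at hc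
  have hss : s * s = 1 := by rcases hs with rfl | rfl <;> norm_num
  set f := famLd A X.toFun with hf
  set h := famMc A c X.toFun with hh
  set k := famKap A X.toFun with hk
  have sX0 : SmoothNear X.toFun (paramMap A 0) := by rw [map_zero]; exact X.smooth
  obtain ⟨sf, sh, sk⟩ := smoothNear_fam (c := c) sX0
  have hmem0 := fam_member hc sX0
  have hslice : (fun p => X.toFun (0, p)) =ᶠ[𝓝 0] x.toFun := X.at_zero
  have hAc : Tendsto A (𝓝 0) (𝓝 0) := by simpa using A.continuous.tendsto 0
  have eδ : ∀ᶠ q in 𝓝 (0 : Plane), ldFun x.toFun (A q) = f (0, q) := by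
    filter_upwards [hmem0, hAc.eventually (ldFun_congr hslice)] with q h1 h2
    rw [← h2]; exact h1.1
  have eH : ∀ᶠ q in 𝓝 (0 : Plane), c * mcncFun x.toFun (A q) = h (0, q) := by
    filter_upwards [hmem0, hAc.eventually (mcncFun_congr hslice)] with q h1 h2
    rw [← h2]; exact h1.2.1
  have fd : ∀ e, fderiv ℝ (ldFun x.toFun) 0 (A e) = fderiv ℝ f 0 (0, e) := by
    have := (smoothNear_member (z := 0) sf eδ).2
    simpa using this
  have hd : ∀ e, c * (l * fderiv ℝ (ldFun x.toFun) 0 (A e)) = fderiv ℝ h 0 (0, e) := by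
    have h1 := (smoothNear_member (φ := fun q => c * mcncFun x.toFun q) (z := 0) sh eH).2
    intro e
    have h2 := h1 e
    rw [← h2, ← hl]
    simp only [Prod.snd_zero, map_zero]
    rw [fderiv_const_mul sH.differentiableAt]
    rfl
  have f0 : f 0 = 0 := by
    have := eδ.self_of_nhds
    rw [map_zero, δ0] at this
    exact this.symm
  have h0 : h 0 = 0 := by
    have := eH.self_of_nhds
    rw [map_zero, H0, mul_zero] at this
    exact this.symm
  have k0 : k 0 < 0 := by
    have h1 := (forms_slice (z := (0 : ℝ × Plane)) X.smooth).2.2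
    have h2 : kapFun (fun p => X.toFun (0, p)) 0 = kapFun x.toFun 0 :=
      (kapFun_congr hslice).eq_of_nhds
    have h3 : k 0 = gKap (0, 1, 0) (0, 0, 1) X.toFun 0 := by
      rw [hk, famKap, map_zero]
    rw [h3, ← h1]
    exact h2.trans_lt hκ
  have fY : 0 < fderiv ℝ f 0 (0, 0, 1) := by
    rw [← fd]; exact hA2
  have fX : fderiv ℝ f 0 (0, 1, 0) = 0 := by
    rw [← fd]; exact hA1
  have hYf : fderiv ℝ h 0 (0, 0, 1) = c * l * fderiv ℝ f 0 (0, 0, 1) := by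
    rw [← hd, ← fd]; ring
  have hY : 0 < fderiv ℝ h 0 (0, 0, 1) := by
    rw [hYf]; exact mul_pos hcl fY
  have hX : fderiv ℝ h 0 (0, 1, 0) = 0 := by
    rw [← hd, hA1]; ring
  have ht1 : fderiv ℝ f 0 (1, 0) = dirD (1, 0) (gLd (0, 1, 0) (0, 0, 1) X.toFun) 0 := by
    have h1 : DifferentiableAt ℝ (gLd (0, 1, 0) (0, 0, 1) X.toFun) (paramMap A 0) :=
      (sX0.gLd _ _).differentiableAt
    have h2 : fderiv ℝ f 0 = _ := (h1.hasFDerivAt.comp 0 (paramMap A).hasFDerivAt).fderiv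
    rw [h2, ContinuousLinearMap.comp_apply, map_zero, paramMap_apply]
    simp [dirD]
  have ht2 : fderiv ℝ h 0 (1, 0) = c * dirD (1, 0) (gMc (0, 1, 0) (0, 0, 1) X.toFun) 0 := by
    have h1 : DifferentiableAt ℝ (gMc (0, 1, 0) (0, 0, 1) X.toFun) (paramMap A 0) :=
      (sX0.gMc _ _).differentiableAt
    have h2 : fderiv ℝ h 0 = _ :=
      ((h1.hasFDerivAt.comp 0 (paramMap A).hasFDerivAt).const_mul c).fderiv
    rw [h2, _root_.smul_apply, ContinuousLinearMap.comp_apply, map_zero, paramMap_apply]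
    simp [dirD]
  set τ := dirD (1, 0) (gMc (0, 1, 0) (0, 0, 1) X.toFun) 0
      - l * dirD (1, 0) (gLd (0, 1, 0) (0, 0, 1) X.toFun) 0 with hτdef
  have hs0 : s ≠ 0 := by rintro rfl; simp at hss
  have hv : s * (-τ / l) ≠ 0 := mul_ne_zero hs0 (div_ne_zero (neg_ne_zero.2 hτ) hl0)
  -- The number s(-τ/l) is the t-derivative of W at the origin, see `Wt`; σ is opposite to its sign.
  obtain ⟨σ, hσ, hσv⟩ : ∃ σ : ℝ, (σ = 1 ∨ σ = -1) ∧ σ * (s * (-τ / l)) < 0 := by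
    rcases lt_or_gt_of_ne hv with h | h
    · exact ⟨1, Or.inl rfl, by linarith⟩
    · exact ⟨-1, Or.inr rfl, by linarith⟩
  refine ⟨σ, hσ, A, fun κ hκ0 => ?_⟩
  let P : ℝ × Plane → Prop := fun z => SmoothNear X.toFun (paramMap A z) ∧ k z < 0
  have hP : ∀ᶠ z in 𝓝 (0 : ℝ × Plane), P z := by
    refine Filter.Eventually.and ?_ (sk.contDiffAt.continuousAt.eventually (gt_mem_nhds k0))
    exact (paramMap A).continuous.continuousAt.eventually (eventually_eventually_nhds.2 sX0)
  obtain ⟨r₀, ρ, hr₀, hr₀κ, hρ, hρκ, α, β, η, D⟩ :=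
    exists_curveData hP sf sh sk f0 h0 k0 fY hY hκ0
  replace D : CurveData P f h k r₀ ρ α β η := D
  have z0 : |(0 : ℝ)| < r₀ := by simpa using hr₀
  have zρ : |(0 : ℝ)| < ρ := by simpa using hρ
  have α0 : α 0 0 = 0 := ((D.ld_iff 0 0 0 z0 z0 zρ).1 f0).symm
  have η0 : η 0 0 = 0 := ((D.mcnc_iff 0 0 0 z0 z0 zρ).1 h0).symm
  have β0 : β 0 0 = 0 := (D.order_zero 0 0 z0 z0 (by rw [α0, η0])).trans α0
  -- The letter X denotes the family, so from here on the horizontal and vertical coordinates are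
  -- mostly called Y and Z.
  let u : ℝ × ℝ → ℝ := fun z => η z.1 z.2
  have su : ∀ t Y, |t| < r₀ → |Y| < r₀ → SmoothNear u (t, Y) := by
    intro t Y ht hY
    have hop : IsOpen (Ioo (-r₀) r₀ ×ˢ Ioo (-r₀) r₀) := isOpen_Ioo.prod isOpen_Ioo
    filter_upwards [hop.mem_nhds (show (t, Y) ∈ _ from ⟨abs_lt.1 ht, abs_lt.1 hY⟩)] with z hz
    exact D.smooth_mcnc.contDiffAt (hop.mem_nhds hz)
  have sfam : ∀ t X Y, |t| < r₀ → |X| < r₀ → |Y| < ρ → _ := fun t Y Z h1 h2 h3 =>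
    smoothNear_fam (c := c) (D.prop t Y Z h1 h2 h3).1
  have hη : ∀ t Y, |t| < r₀ → |Y| < r₀ → h (t, Y, η t Y) = 0 := fun t Y h1 h2 =>
    (D.mcnc_iff t Y _ h1 h2 (D.mem t Y h1 h2).2.2).2 rfl
  have dh : ∀ t Y, |t| < r₀ → |Y| < r₀ → ∀ e : ℝ × ℝ,
      fderiv ℝ h (t, Y, η t Y) (e.1, e.2, fderiv ℝ u (t, Y) e) = 0 := by
    intro t Y ht hY e
    have h1 := hasFDerivAt_graph (f := h) (su t Y ht hY).differentiableAt
      (sfam t Y _ ht hY (D.mem t Y ht hY).2.2).2.1.differentiableAt e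
    refine h1.symm.trans ?_
    have hop : IsOpen (Ioo (-r₀) r₀ ×ˢ Ioo (-r₀) r₀) := isOpen_Ioo.prod isOpen_Ioo
    have h2 : (fun y : ℝ × ℝ => h (y.1, y.2, u y)) =ᶠ[𝓝 (t, Y)] fun _ => 0 := by
      filter_upwards [hop.mem_nhds (show (t, Y) ∈ _ from ⟨abs_lt.1 ht, abs_lt.1 hY⟩)] with z hz
      exact hη z.1 z.2 (abs_lt.2 hz.1) (abs_lt.2 hz.2)
    rw [h2.fderiv_eq]
    simp
  let W₀ : ℝ × ℝ → ℝ := fun z => f (z.1, z.2, u z)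
  have sW₀ : ∀ t Y, |t| < r₀ → |Y| < r₀ → SmoothNear W₀ (t, Y) := by
    intro t Y ht hY
    refine SmoothNear.comp (g := f) (f := fun z : ℝ × ℝ => (z.1, z.2, u z))
      (sfam t Y _ ht hY (D.mem t Y ht hY).2.2).1 ?_
    filter_upwards [su t Y ht hY] with z hz
    exact contDiffAt_fst.prodMk (contDiffAt_snd.prodMk hz)
  have dW₀ : ∀ t Y, |t| < r₀ → |Y| < r₀ → ∀ e : ℝ × ℝ,
      fderiv ℝ W₀ (t, Y) e = fderiv ℝ f (t, Y, η t Y) (e.1, e.2, fderiv ℝ u (t, Y) e) := by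
    intro t Y ht hY e
    exact hasFDerivAt_graph (f := f) (su t Y ht hY).differentiableAt
      (sfam t Y _ ht hY (D.mem t Y ht hY).2.2).1.differentiableAt e
  let W : ℝ × ℝ → ℝ := fun z => s * W₀ z
  have sW : SmoothNear W 0 := (smoothNear_const s _).mul (sW₀ 0 0 z0 z0)
  have dW : ∀ t Y, |t| < r₀ → |Y| < r₀ → ∀ e : ℝ × ℝ,
      fderiv ℝ W (t, Y) e = s * fderiv ℝ f (t, Y, η t Y) (e.1, e.2, fderiv ℝ u (t, Y) e) := by
    intro t Y ht hY e
    rw [← dW₀ t Y ht hY, fderiv_const_mul (sW₀ t Y ht hY).differentiableAt]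
    rfl
  have zz : ((0 : ℝ), (0 : ℝ), η 0 0) = 0 := by rw [η0]; rfl
  have uX : fderiv ℝ u (0, 0) (0, 1) = 0 := by
    have := dh 0 0 z0 z0 (0, 1)
    rw [zz, clm_triple_apply, hX] at this
    simpa [hY.ne'] using this
  have W0 : W 0 = 0 := by
    change s * f (0, 0, η 0 0) = 0
    rw [zz, f0, mul_zero]
  have WX : fderiv ℝ W 0 (0, 1) = 0 := by
    have := dW 0 0 z0 z0 (0, 1)
    rw [uX, zz, fX, mul_zero] at this
    exact this
  -- Implicit differentiation gives η_t = -h_t / h_Y, with subscript Y for the vertical derivative.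
  -- Since h_Y = c l f_Y, the vertical derivative of f cancels from f_t + f_Y η_t.
  have Wt : fderiv ℝ W 0 (1, 0) = s * (-τ / l) := by
    have h1 := dW 0 0 z0 z0 (1, 0)
    have h2 := dh 0 0 z0 z0 (1, 0)
    rw [zz, clm_triple_apply] at h1 h2
    simp only [one_mul, zero_mul, add_zero] at h1 h2
    have h3 : fderiv ℝ W 0 (1, 0) = _ := h1
    rw [h3, hτdef, ht1]
    rw [ht2, hYf] at h2
    have h4 : dirD (1, 0) (gMc (0, 1, 0) (0, 0, 1) X.toFun) 0
        + fderiv ℝ u (0, 0) (1, 0) * (l * fderiv ℝ f 0 (0, 0, 1)) = 0 := by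
      refine (mul_eq_zero.1 (?_ : c * _ = 0)).resolve_left hc0
      linear_combination h2
    field_simp
    linear_combination h4
  have WXX : 0 < fderiv ℝ (fderiv ℝ W) 0 (0, 1) (0, 1) := by
    have hline : HasDerivAt (fun Y : ℝ => ((0 : ℝ), Y)) ((0 : ℝ), (1 : ℝ)) 0 :=
      (hasDerivAt_const _ _).prodMk (hasDerivAt_id _)
    have hline2 : deriv (fun Y : ℝ => ((0 : ℝ), Y)) = fun _ => ((0 : ℝ), (1 : ℝ)) := by
      funext Y
      exact ((hasDerivAt_const Y _).prodMk (hasDerivAt_id Y)).deriv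
    have h1 := iteratedDeriv_two_comp_curve (g := W) (γ := fun Y : ℝ => ((0 : ℝ), Y)) (a := 0)
      (smoothNear_of_contDiff (by fun_prop) _) sW
    rw [hline2] at h1
    simp only [deriv_const, map_zero, add_zero] at h1
    have h1' : iteratedDeriv 2 (fun Y => W (0, Y)) 0 = fderiv ℝ (fderiv ℝ W) 0 (0, 1) (0, 1) := h1
    rw [← h1']
    -- This parametrises the `MCNC` of M_0. The second derivative formula is used with the two
    -- functions exchanged, hence with ratio 1 / l.
    let γ : ℝ → Plane := fun Y => A (Y, η 0 Y)
    have hball : ∀ᶠ Y in 𝓝 (0 : ℝ), |Y| < r₀ := by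
      filter_upwards [Metric.ball_mem_nhds (0 : ℝ) hr₀] with s hs
      simpa using hs
    have sη : SmoothNear (fun Y => (Y, η 0 Y)) (0 : ℝ) := by
      filter_upwards [hball] with Y hY
      exact contDiffAt_id.prodMk (ContDiffAt.comp (g := u) Y (su 0 Y z0 hY).contDiffAt
        (contDiffAt_const.prodMk contDiffAt_id))
    have sγ : SmoothNear γ 0 := SmoothNear.comp (g := A) (smoothNear_of_contDiff A.contDiff _) sη
    have γ0 : γ 0 = 0 := by
      have : ((0 : ℝ), (0 : ℝ)) = 0 := rfl
      simp [γ, η0, this]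
    have ηt : Tendsto (fun Y => (Y, η 0 Y)) (𝓝 (0 : ℝ)) (𝓝 (0 : Plane)) := by
      have := sη.contDiffAt.continuousAt
      rwa [ContinuousAt, η0] at this
    have hγ : IsCurveParam (mcncFun x.toFun) 0 γ := by
      refine ⟨sγ, γ0, ?_, ?_⟩
      · have h2 := A.hasFDerivAt.comp_hasDerivAt (0 : ℝ) sη.differentiableAt.hasDerivAt
        have h3 : deriv γ 0 = _ := h2.deriv
        rw [h3]
        intro h4
        have h5 : HasDerivAt (fun Y => (Y, η 0 Y)) ((1 : ℝ), deriv (fun Y => η 0 Y) 0) 0 :=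
          (hasDerivAt_id _).prodMk
            (SmoothNear.differentiableAt (by
              filter_upwards [sη] with y hy using contDiffAt_snd.comp y hy)).hasDerivAt
        have h6 := hAinj _ h4
        rw [h5.deriv] at h6
        simpa using congrArg Prod.fst h6
      · filter_upwards [ηt.eventually eH, hball] with Y h2 h3
        rw [hη 0 Y z0 h3] at h2
        exact (mul_eq_zero.1 h2).resolve_left hc0
    have h2 : (fun Y => W (0, Y)) =ᶠ[𝓝 0] fun Y => s * ldFun x.toFun (γ Y) := by
      filter_upwards [ηt.eventually eδ] with Y h2
      rw [h2]
    rw [h2.iteratedDeriv_eq, iteratedDeriv_const_mul_field,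
      hγ.iteratedDeriv_two (l := 1 / l) sH sδ (fun e => by rw [hl]; field_simp)]
    have hker : fderiv ℝ (ldFun x.toFun) 0 (deriv γ 0) = 0 := by
      have := hγ.fderiv_deriv sH
      rw [hl] at this
      exact (mul_eq_zero.1 this).resolve_left hl0
    have h3 := hQ _ hγ.2.2.1 hker
    set a := fderiv ℝ (fderiv ℝ (ldFun x.toFun)) 0 (deriv γ 0) (deriv γ 0)
    set b := fderiv ℝ (fderiv ℝ (mcncFun x.toFun)) 0 (deriv γ 0) (deriv γ 0)
    -- Passing from H along the `LD` to δ along the `MCNC` reverses the sign and divides by l²; this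
    -- is why `FoldContact` asks for a negative quantity.
    have h4 : s * (a - 1 / l * b) = -(s * l * (b - l * a)) / l ^ 2 := by field_simp; ring
    rw [h4]
    exact div_pos (neg_pos.2 h3) (sq_pos_of_ne_zero hl0)
  obtain ⟨r, hr, hrr₀, ε, hε, hεr₀, F0, Fneg, Fpos⟩ :=
    exists_fold sW W0 WX WXX hσ (by rw [Wt]; exact hσv) hr₀
  have hsub : Ioo (-ε) ε ×ˢ Ioo (-r) r ⊆ Ioo (-r₀) r₀ ×ˢ Ioo (-r₀) r₀ :=
    prod_mono (Ioo_subset_Ioo (by linarith) hεr₀.le) (Ioo_subset_Ioo (by linarith) hrr₀.le)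
  have hsec : ∀ {θ : ℝ → ℝ → ℝ}, ContDiffOn ℝ ∞ (fun z : ℝ × ℝ => θ z.1 z.2)
      (Ioo (-r₀) r₀ ×ˢ Ioo (-r₀) r₀) → ∀ t, |t| < ε → ContDiffOn ℝ ∞ (θ t) (Ioo (-r) r) := by
    intro θ hθ t ht
    refine hθ.comp (f := fun Y : ℝ => (t, Y)) (by fun_prop) fun Y hY => hsub ⟨abs_lt.1 ht, hY⟩
  have member : ∀ t Y Z, |t| < r₀ → |Y| < r₀ → |Z| < ρ →
      (ldFun (X.slice t) (A (Y, Z)) = f (t, Y, Z) ∧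
        c * mcncFun (X.slice t) (A (Y, Z)) = h (t, Y, Z) ∧
        lplFun (X.slice t) (A (Y, Z)) = pencilDisc f h k (t, Y, Z)) ∧
      (∀ e, fderiv ℝ (ldFun (X.slice t)) (A (Y, Z)) (A e) = fderiv ℝ f (t, Y, Z) (0, e)) ∧
      (∀ e, c * fderiv ℝ (mcncFun (X.slice t)) (A (Y, Z)) (A e) =
        fderiv ℝ h (t, Y, Z) (0, e)) ∧
      (∀ e, fderiv ℝ (lplFun (X.slice t)) (A (Y, Z)) (A e) =
        fderiv ℝ (pencilDisc f h k) (t, Y, Z) (0, e)) ∧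
      SmoothNear (ldFun (X.slice t)) (A (Y, Z)) ∧ SmoothNear (mcncFun (X.slice t)) (A (Y, Z)) ∧
      SmoothNear (lplFun (X.slice t)) (A (Y, Z)) := by
    intro t Y Z ht hY hZ
    have hsX := (D.prop t Y Z ht hY hZ).1
    have hm := fam_member hc hsX
    obtain ⟨s1, s2, s3⟩ := sfam t Y Z ht hY hZ
    have sS : SmoothNear (X.slice t) (A (Y, Z)) :=
      SmoothNear.comp (g := X.toFun) (f := fun q : Plane => (t, q)) hsX
        (smoothNear_of_contDiff (by fun_prop) _)
    refine ⟨hm.self_of_nhds,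
      (smoothNear_member (z := (t, Y, Z)) s1 (hm.mono fun q hq => hq.1)).2, fun e => ?_,
      (smoothNear_member (z := (t, Y, Z)) (s1.pencilDisc s2 s3) (hm.mono fun q hq => hq.2.2)).2,
      sS.ldFun, sS.mcncFun, sS.lplFun⟩
    rw [← (smoothNear_member (z := (t, Y, Z)) (φ := fun q => c * mcncFun (X.slice t) q) s2
      (hm.mono fun q hq => hq.2.1)).2 e, fderiv_const_mul sS.mcncFun.differentiableAt]
    rfl
  have pic : ∀ t, |t| < ε → LocalPicture (X.slice t) A r ρ (α t) (β t) (η t) := by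
    intro t htε
    have ht := htε.trans hεr₀
    refine ⟨?_, ?_, ?_, hsec D.smooth_ld t htε, hsec D.smooth_lpl t htε, hsec D.smooth_mcnc t htε,
      fun Y hY => D.mem t Y ht (hY.trans hrr₀), fun Y Z hY hZ => ?_, fun Y Z hY hZ => ?_,
      fun Y Z hY hZ => ?_, fun Y Z hY hZ => ?_, fun Y hY => D.order_pos t Y ht (hY.trans hrr₀),
      fun Y hY => D.order_neg t Y ht (hY.trans hrr₀),
      fun Y hY => D.order_zero t Y ht (hY.trans hrr₀)⟩
    · rintro q ⟨Y, Z, hY, hZ, rfl⟩ h0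
      have h1 := (member t Y Z ht (hY.trans hrr₀) hZ).2.1 (0, 1)
      have h2 := D.ld_pos t Y Z ht (hY.trans hrr₀) hZ
      rw [h0] at h1
      exact h2.ne h1
    · rintro q ⟨Y, Z, hY, hZ, rfl⟩ h0
      have h1 := (member t Y Z ht (hY.trans hrr₀) hZ).2.2.2.1 (0, 1)
      have h2 := D.lpl_neg t Y Z ht (hY.trans hrr₀) hZ
      rw [h0] at h1
      exact h2.ne' h1
    · rintro q ⟨Y, Z, hY, hZ, rfl⟩ h0
      have h1 := (member t Y Z ht (hY.trans hrr₀) hZ).2.2.1 (0, 1)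
      have h2 := D.mcnc_pos t Y Z ht (hY.trans hrr₀) hZ
      rw [h0] at h1
      refine h2.ne ?_
      rw [← h1]
      simp
    · rw [← D.ld_iff t Y Z ht (hY.trans hrr₀) hZ, ← (member t Y Z ht (hY.trans hrr₀) hZ).1.1]
      rfl
    · rw [← D.lpl_iff t Y Z ht (hY.trans hrr₀) hZ, ← (member t Y Z ht (hY.trans hrr₀) hZ).1.2.2]
      rfl
    · rw [← D.mcnc_iff t Y Z ht (hY.trans hrr₀) hZ, ← (member t Y Z ht (hY.trans hrr₀) hZ).1.2.1]
      exact ⟨fun h => by rw [show mcncFun (X.slice t) (A (Y, Z)) = 0 from h, mul_zero],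
        fun h => (mul_eq_zero.1 h).resolve_left hc0⟩
    · rw [← D.pos_iff t Y Z ht (hY.trans hrr₀) hZ, ← (member t Y Z ht (hY.trans hrr₀) hZ).1.1]
  have sgn : ∀ t Y, |t| < r₀ → |Y| < r₀ → (0 < W₀ (t, Y) ↔ α t Y < η t Y) ∧
      (W₀ (t, Y) = 0 ↔ η t Y = α t Y) := fun t Y ht hY =>
    ⟨D.pos_iff t Y _ ht hY (D.mem t Y ht hY).2.2, D.ld_iff t Y _ ht hY (D.mem t Y ht hY).2.2⟩
  have sgn_neg : ∀ t Y, |t| < r₀ → |Y| < r₀ → (W₀ (t, Y) < 0 ↔ η t Y < α t Y) := by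
    intro t Y ht hY
    obtain ⟨h1, h2⟩ := sgn t Y ht hY
    rw [← not_le, ← not_le, not_iff_not, le_iff_lt_or_eq, le_iff_lt_or_eq, h1,
      eq_comm (a := (0 : ℝ)), h2, eq_comm (a := η t Y)]
  have pos_of : ∀ t Y, |t| < r₀ → |Y| < r₀ → 0 < W (t, Y) → 0 < s * (η t Y - α t Y) := by
    intro t Y ht hY hW
    change 0 < s * W₀ (t, Y) at hW
    rcases hs with rfl | rfl
    · have := (sgn t Y ht hY).1.1 (by linarith); linarith
    · have := (sgn_neg t Y ht hY).1 (by linarith); linarith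
  have neg_of : ∀ t Y, |t| < r₀ → |Y| < r₀ → W (t, Y) < 0 → s * (η t Y - α t Y) < 0 := by
    intro t Y ht hY hW
    change s * W₀ (t, Y) < 0 at hW
    rcases hs with rfl | rfl
    · have := (sgn_neg t Y ht hY).1 (by linarith); linarith
    · have := (sgn t Y ht hY).1.1 (by linarith); linarith
  have zero_of : ∀ t Y, |t| < r₀ → |Y| < r₀ → W (t, Y) = 0 → η t Y = α t Y := by
    intro t Y ht hY hW
    exact (sgn t Y ht hY).2.1 ((mul_eq_zero.1 hW).resolve_left hs0)
  have ne_of : ∀ {a b : ℝ}, 0 < s * (a - b) ∨ s * (a - b) < 0 → a ≠ b := by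
    rintro a b h rfl
    simp at h
  refine ⟨r, ρ, ε, hr, hrr₀.trans hr₀κ, hρ, hρκ, hε, hεr₀.trans hr₀κ, α, β, η,
    D.smooth_ld.mono hsub, D.smooth_lpl.mono hsub, D.smooth_mcnc.mono hsub, pic,
    ⟨α0, β0, η0, fun Y hY hY0 => pos_of 0 Y z0 (hY.trans hrr₀) (F0 Y hY hY0)⟩,
    fun t htε hσt => ?_, fun t htε hσt => ?_⟩
  · have ht := htε.trans hεr₀
    have hpos : ∀ Y, |Y| < r → 0 < s * (η t Y - α t Y) := fun Y hY =>
      pos_of t Y ht (hY.trans hrr₀) (Fneg t htε hσt Y hY)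
    refine ⟨hpos, (pic t htε).inter fun q => ⟨fun h => h.elim, ?_⟩⟩
    rintro ⟨Y, hY, he, -⟩
    exact absurd he (ne_of (Or.inl (hpos Y hY)))
  · have ht := htε.trans hεr₀
    obtain ⟨a, b, ha, hab, hb, hout, hin, Wa, Wb, da, db⟩ := Fpos t htε hσt
    have har : |a| < r := abs_lt.2 ⟨ha, by linarith⟩
    have hbr : |b| < r := abs_lt.2 ⟨by linarith, hb⟩
    have hout' : ∀ Y, |Y| < r → Y < a ∨ b < Y → 0 < s * (η t Y - α t Y) := fun Y hY hc =>
      pos_of t Y ht (hY.trans hrr₀) (hout Y hY hc)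
    have hin' : ∀ Y, a < Y → Y < b → s * (η t Y - α t Y) < 0 := fun Y h1 h2 =>
      neg_of t Y ht ((abs_lt.2 ⟨by linarith, by linarith⟩ : |Y| < r).trans hrr₀) (hin Y h1 h2)
    have ea := zero_of t a ht (har.trans hrr₀) Wa
    have eb := zero_of t b ht (hbr.trans hrr₀) Wb
    obtain ⟨i1, i2, i3⟩ := (pic t htε).inter (S := {A (a, α t a), A (b, α t b)}) (by
      intro q
      constructor
      · rintro (rfl | rfl)
        · exact ⟨a, har, ea, rfl⟩
        · exact ⟨b, hbr, eb, rfl⟩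
      · rintro ⟨Y, hY, he, rfl⟩
        rcases lt_trichotomy Y a with h1 | h1 | h1
        · exact absurd he (ne_of (Or.inl (hout' Y hY (Or.inl h1))))
        · exact Or.inl (by rw [h1])
        · rcases lt_trichotomy Y b with h2 | h2 | h2
          · exact absurd he (ne_of (Or.inr (hin' Y h1 h2)))
          · exact Or.inr (by rw [h2]; rfl)
          · exact absurd he (ne_of (Or.inl (hout' Y hY (Or.inr h2)))))
    -- A vector killed by both differentials is tangent to the `MCNC`, so the differential of δ on
    -- it is a multiple of the X-derivative of W. A simple zero of W is thus a transverse crossing.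
    have order : ∀ Y, |Y| < r → η t Y = α t Y → fderiv ℝ W (t, Y) (0, 1) ≠ 0 →
        contactOrder (ldFun (X.slice t)) (mcncFun (X.slice t)) (A (Y, α t Y)) = 1 ∧
        contactOrder (lplFun (X.slice t)) (mcncFun (X.slice t)) (A (Y, α t Y)) = 1 ∧
        contactOrder (ldFun (X.slice t)) (lplFun (X.slice t)) (A (Y, α t Y)) = 2 := by
      intro Y hYr he hdY
      have hY := hYr.trans hrr₀
      have hm := (D.mem t Y ht hY).1
      have hq : A (Y, α t Y) ∈ box A r ρ := ⟨Y, _, hYr, hm, rfl⟩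
      obtain ⟨⟨m1, m2, m3⟩, d1, d2, d3, s1, s2, s3⟩ := member t Y (α t Y) ht hY hm
      have v1 : f (t, Y, α t Y) = 0 := (D.ld_iff t Y _ ht hY hm).2 rfl
      have v2 : h (t, Y, α t Y) = 0 := (D.mcnc_iff t Y _ ht hY hm).2 he.symm
      have w1 : ldFun (X.slice t) (A (Y, α t Y)) = 0 := m1.trans v1
      have w2 : mcncFun (X.slice t) (A (Y, α t Y)) = 0 :=
        (mul_eq_zero.1 (m2.trans v2)).resolve_left hc0
      have w3 : lplFun (X.slice t) (A (Y, α t Y)) = 0 := by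
        rw [lplFun_eq, w1, w2]; ring
      have tr : ∀ e, fderiv ℝ (ldFun (X.slice t)) (A (Y, α t Y)) e = 0 →
          fderiv ℝ (mcncFun (X.slice t)) (A (Y, α t Y)) e = 0 → e = 0 := by
        intro e he1 he2
        obtain ⟨⟨e1, e2⟩, rfl⟩ := A.surjective e
        rw [d1, clm_triple_apply] at he1
        have he3 := d2 (e1, e2)
        rw [he2, mul_zero, clm_triple_apply] at he3
        have h1 := dW t Y ht hY (0, 1)
        have h2 := dh t Y ht hY (0, 1)
        rw [he, clm_triple_apply] at h1 h2
        have hp1 := D.ld_pos t Y _ ht hY hm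
        have hp2 := D.mcnc_pos t Y _ ht hY hm
        set fX' := fderiv ℝ f (t, Y, α t Y) (0, 1, 0)
        set fY' := fderiv ℝ f (t, Y, α t Y) (0, 0, 1)
        set hX' := fderiv ℝ h (t, Y, α t Y) (0, 1, 0)
        set hY' := fderiv ℝ h (t, Y, α t Y) (0, 0, 1)
        set v := fderiv ℝ u (t, Y) (0, 1)
        have e2v : e2 = v * e1 := by
          have : hY' * (e2 - v * e1) = 0 := by
            linear_combination -he3 - e1 * h2
          linarith [(mul_eq_zero.1 this).resolve_left hp2.ne']
        have e10 : e1 = 0 := by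
          refine (mul_eq_zero.1 (?_ : fderiv ℝ W (t, Y) (0, 1) * e1 = 0)).resolve_left hdY
          rw [h1]
          rw [e2v] at he1
          linear_combination s * he1
        rw [e2v, e10, mul_zero]
        exact map_zero A
      refine ⟨contactOrder_eq_one s1 s2 w1 w2 ((pic t htε).ld_regular _ hq) tr,
        contactOrder_eq_one s3 s2 w3 w2 ((pic t htε).lpl_regular _ hq) ?_,
        contactOrder_sq_eq_two s1 s2 w1 w2 ((pic t htε).ld_regular _ hq) tr
          (lplFun_eq_sq _ _)⟩
      -- At the common point the differential of the `LPL` function is 4κ dδ with κ ≠ 0, so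
      -- transversality to the `LD` passes to the `LPL`.
      intro e he1 he2
      refine tr e ?_ he2
      obtain ⟨e, rfl⟩ := A.surjective e
      obtain ⟨s1', s2', s3'⟩ := sfam t Y (α t Y) ht hY hm
      rw [d3, fderiv_pencilDisc s1' s2' s3' v1 v2] at he1
      rw [d1]
      exact (mul_eq_zero.1 he1).resolve_left
        (mul_ne_zero four_ne_zero (D.prop t Y _ ht hY hm).2.ne)
    refine ⟨a, b, ha, hab, hb, hout', hin', i1, i2, i3, ?_⟩
    rintro q (rfl | rfl)
    · exact order a har ea da
    · exact order b hbr eb db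


/-! Invariance under changes of parameters, and the sign of the second fundamental form. -/

/-- The `LPL` function is H² on the `LD`, so contact above 2 is tangency of H to the `LD`. The case
l = 0, where dH vanishes, is included. -/
theorem degenerateContact_iff (x : LocalParam) :
    DegenerateContact x ↔ ldFun x.toFun 0 = 0 ∧ fderiv ℝ (ldFun x.toFun) 0 ≠ 0 ∧
      mcncFun x.toFun 0 = 0 ∧
      ∃ l : ℝ, ∀ e, fderiv ℝ (mcncFun x.toFun) 0 e = l * fderiv ℝ (ldFun x.toFun) 0 e := by
  refine and_congr_right fun h0 => and_congr_right fun hd => ?_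
  exact two_lt_contactOrder_sq_iff x.smooth.ldFun x.smooth.mcncFun h0 hd (lplFun_eq_sq _ _)

theorem FoldContact.degenerateContact {x : LocalParam} {s : ℝ}
    (h : FoldContact s (ldFun x.toFun) (mcncFun x.toFun)) : DegenerateContact x :=
  let ⟨h0, hd, hH, l, hl, _⟩ := h
  (degenerateContact_iff x).2 ⟨h0, hd, hH, l, hl⟩

theorem fderiv_mul_of_eq_zero {E : Type*} [NormedAddCommGroup E] [NormedSpace ℝ E] {a b : E → ℝ}
    {z : E} (ha : DifferentiableAt ℝ a z) (hb : DifferentiableAt ℝ b z) (h0 : b z = 0) (e : E) :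
    fderiv ℝ (fun q => a q * b q) z e = a z * fderiv ℝ b z e := by
  rw [fderiv_fun_mul ha hb]
  simp [h0]

theorem fderiv_pair {F : Type*} [NormedAddCommGroup F] [NormedSpace ℝ F] (f : Plane → F)
    (q : Plane) (a b : ℝ) : fderiv ℝ f q (a, b) = a • dirD (1, 0) f q + b • dirD (0, 1) f q := by
  rw [show ((a, b) : Plane) = a • (1, 0) + b • (0, 1) by ext <;> simp, map_add, map_smul, map_smul]
  rfl

/-- The jacobian determinant. -/
def jac (h : Plane → Plane) (q : Plane) : ℝ :=
  (dirD (1, 0) h q).1 * (dirD (0, 1) h q).2 - (dirD (1, 0) h q).2 * (dirD (0, 1) h q).1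

theorem SmoothNear.fst {E F G : Type*} [NormedAddCommGroup E] [NormedSpace ℝ E]
    [NormedAddCommGroup F] [NormedSpace ℝ F] [NormedAddCommGroup G] [NormedSpace ℝ G]
    {f : E → F × G} {a : E} (hf : SmoothNear f a) : SmoothNear (fun z => (f z).1) a :=
  hf.mono fun _ h => contDiffAt_fst.comp _ h

theorem SmoothNear.snd {E F G : Type*} [NormedAddCommGroup E] [NormedSpace ℝ E]
    [NormedAddCommGroup F] [NormedSpace ℝ F] [NormedAddCommGroup G] [NormedSpace ℝ G]
    {f : E → F × G} {a : E} (hf : SmoothNear f a) : SmoothNear (fun z => (f z).2) a :=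
  hf.mono fun _ h => contDiffAt_snd.comp _ h

theorem SmoothNear.jac {h : Plane → Plane} {q : Plane} (hh : SmoothNear h q) :
    SmoothNear (jac h) q :=
  ((hh.dirD _).fst.mul (hh.dirD _).snd).sub ((hh.dirD _).snd.mul (hh.dirD _).fst)

theorem forms_comp {x : Plane → R31} {h : Plane → Plane} {q : Plane} (hx : SmoothNear x (h q))
    (hh : SmoothNear h q) :
    ldFun (fun p => x (h p)) q = jac h q ^ 2 * ldFun x (h q) ∧
    mcncFun (fun p => x (h p)) q = jac h q ^ 3 * mcncFun x (h q) ∧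
    kapFun (fun p => x (h p)) q = jac h q ^ 4 * kapFun x (h q) :=
  forms_reparam (a' := ((1, 0) : Plane)) (b' := (0, 1)) hx hh
    (hh.dirD _).fst.differentiableAt (hh.dirD _).snd.differentiableAt
    (hh.dirD _).fst.differentiableAt (hh.dirD _).snd.differentiableAt
    (.of_forall fun y => by ext <;> simp) (.of_forall fun y => by ext <;> simp)

theorem SmoothNear.eventually {E F : Type*} [NormedAddCommGroup E] [NormedSpace ℝ E]
    [NormedAddCommGroup F] [NormedSpace ℝ F] {f : E → F} {a : E} (h : SmoothNear f a) :
    ∀ᶠ z in 𝓝 a, SmoothNear f z := eventually_eventually_nhds.2 h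

theorem InverseDiffeoGerms.symm {h k : Plane → Plane} (hi : InverseDiffeoGerms h k) :
    InverseDiffeoGerms k h :=
  let ⟨h1, h2, h3, h4, h5, h6⟩ := hi
  ⟨h2, h1, h4, h3, h6, h5⟩

theorem InverseDiffeoGerms.fderiv_comp {h k : Plane → Plane} (hi : InverseDiffeoGerms h k)
    (e : Plane) : fderiv ℝ k 0 (fderiv ℝ h 0 e) = e := by
  obtain ⟨sh, sk, h0, k0, -, hkh⟩ := hi
  have h1 : HasFDerivAt (fun q => k (h q)) ((fderiv ℝ k 0).comp (fderiv ℝ h 0)) 0 := by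
    have := sk.differentiableAt.hasFDerivAt
    rw [← h0] at this
    have h2 := this.comp 0 sh.differentiableAt.hasFDerivAt
    rw [h0] at h2
    exact h2
  have h2 : (fun q => k (h q)) =ᶠ[𝓝 0] id := hkh
  have h3 := h2.fderiv_eq (𝕜 := ℝ)
  rw [h1.fderiv, fderiv_id] at h3
  exact congrArg (fun L : Plane →L[ℝ] Plane => L e) h3

theorem InverseDiffeoGerms.jac_ne_zero {h k : Plane → Plane} (hi : InverseDiffeoGerms h k) :
    jac h 0 ≠ 0 := by
  intro hj
  have hinj : ∀ e, fderiv ℝ h 0 e = 0 → e = 0 := fun e he => by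
    rw [← hi.fderiv_comp e, he, map_zero]
  have key : ∀ a b : ℝ, a • dirD (1, 0) h 0 + b • dirD (0, 1) h 0 = 0 → a = 0 ∧ b = 0 := by
    intro a b hab
    have := hinj (a, b) ((fderiv_pair h 0 a b).trans hab)
    simpa using this
  rw [jac] at hj
  set p := dirD (1, 0) h 0
  set q := dirD (0, 1) h 0
  -- Vanishing of the determinant makes the combinations of Cramer's rule zero; independence then
  -- annihilates both coordinates of `p`.
  have k1 := key q.2 (-p.2) (by ext <;> simp <;> linarith)
  have k2 := key q.1 (-p.1) (by ext <;> simp <;> linarith)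
  have hp : p = 0 := by
    ext
    · simpa using k2.2
    · simpa using k1.2
  have := key 1 0 (by simp [hp])
  simp at this

/-! ### Degenerate and fold contacts under changes of parameters. -/

section Invariance

variable {x y : LocalParam} {h k : Plane → Plane}

theorem forms_of_reparam (hi : InverseDiffeoGerms h k)
    (hy : ∀ᶠ q in 𝓝 (0 : Plane), y.toFun q = x.toFun (h q)) :
    ∀ᶠ q in 𝓝 (0 : Plane), ldFun y.toFun q = jac h q ^ 2 * ldFun x.toFun (h q) ∧
      mcncFun y.toFun q = jac h q ^ 3 * mcncFun x.toFun (h q) ∧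
      kapFun y.toFun q = jac h q ^ 4 * kapFun x.toFun (h q) := by
  have e : y.toFun =ᶠ[𝓝 0] fun q => x.toFun (h q) := hy
  filter_upwards [ldFun_congr e, mcncFun_congr e, kapFun_congr e, hi.1.eventually,
    (hi.1.tendsto_zero hi.2.2.1).eventually x.smooth.eventually] with q h1 h2 h3 h4 h5
  rw [h1, h2, h3]
  exact forms_comp h5 h4

theorem fderiv_forms_of_reparam (hi : InverseDiffeoGerms h k)
    (hy : ∀ᶠ q in 𝓝 (0 : Plane), y.toFun q = x.toFun (h q))
    (h0 : ldFun x.toFun 0 = 0) (hH : mcncFun x.toFun 0 = 0) (e : Plane) :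
    fderiv ℝ (ldFun y.toFun) 0 e = jac h 0 ^ 2 * fderiv ℝ (ldFun x.toFun) 0 (fderiv ℝ h 0 e) ∧
    fderiv ℝ (mcncFun y.toFun) 0 e =
      jac h 0 ^ 3 * fderiv ℝ (mcncFun x.toFun) 0 (fderiv ℝ h 0 e) := by
  have sJ := hi.1.jac
  have main : ∀ {φ φ' : Plane → ℝ} {n : ℕ}, SmoothNear φ 0 → φ 0 = 0 →
      (∀ᶠ q in 𝓝 (0 : Plane), φ' q = jac h q ^ n * φ (h q)) →
      fderiv ℝ φ' 0 e = jac h 0 ^ n * fderiv ℝ φ 0 (fderiv ℝ h 0 e) := by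
    intro φ φ' n sφ hφ he
    have he' : φ' =ᶠ[𝓝 0] fun q => jac h q ^ n * φ (h q) := he
    rw [he'.fderiv_eq]
    have sc : SmoothNear (fun q => φ (h q)) 0 := sφ.comp_zero hi.1 hi.2.2.1
    rw [fderiv_mul_of_eq_zero (sJ.differentiableAt.fun_pow n) sc.differentiableAt
      (by rw [hi.2.2.1, hφ])]
    have h1 : HasFDerivAt φ (fderiv ℝ φ 0) (h 0) := by
      rw [hi.2.2.1]; exact sφ.differentiableAt.hasFDerivAt
    have h2 : fderiv ℝ (fun q => φ (h q)) 0 = _ :=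
      (h1.comp 0 hi.1.differentiableAt.hasFDerivAt).fderiv
    rw [h2]
    rfl
  have hf := forms_of_reparam hi hy
  exact ⟨main x.smooth.ldFun h0 (hf.mono fun q hq => hq.1),
    main x.smooth.mcncFun hH (hf.mono fun q hq => hq.2.1)⟩

theorem fderiv_ld_ne_zero_of_reparam (hi : InverseDiffeoGerms h k)
    (hy : ∀ᶠ q in 𝓝 (0 : Plane), y.toFun q = x.toFun (h q))
    (h0 : ldFun x.toFun 0 = 0) (hH : mcncFun x.toFun 0 = 0)
    (hd : fderiv ℝ (ldFun x.toFun) 0 ≠ 0) : fderiv ℝ (ldFun y.toFun) 0 ≠ 0 := by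
  intro hc
  refine hd (ContinuousLinearMap.ext fun e => ?_)
  have h1 := (fderiv_forms_of_reparam hi hy h0 hH (fderiv ℝ k 0 e)).1
  rw [hc, hi.symm.fderiv_comp] at h1
  have h2 := (mul_eq_zero.1 h1.symm).resolve_left (pow_ne_zero 2 hi.jac_ne_zero)
  simpa using h2

/-- Where δ = H = 0, the derivatives of the factors J² and J³ do not matter, and the ratio l is
multiplied by J³ / J² = J. -/
theorem DegenerateContact.of_reparam (hx : DegenerateContact x) (hi : InverseDiffeoGerms h k)
    (hy : ∀ᶠ q in 𝓝 (0 : Plane), y.toFun q = x.toFun (h q)) : DegenerateContact y := by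
  obtain ⟨h0, hd, hH, l, hl⟩ := (degenerateContact_iff x).1 hx
  have hf := (forms_of_reparam hi hy).self_of_nhds
  have hJ := hi.jac_ne_zero
  refine (degenerateContact_iff y).2 ⟨by rw [hf.1, hi.2.2.1, h0, mul_zero],
    fderiv_ld_ne_zero_of_reparam hi hy h0 hH hd, by rw [hf.2.1, hi.2.2.1, hH, mul_zero],
    jac h 0 * l, fun e => ?_⟩
  obtain ⟨h1, h2⟩ := fderiv_forms_of_reparam hi hy h0 hH e
  rw [h1, h2, hl]
  ring

/-- The ratio l is multiplied by J, and the second derivative of H along the transported curve k ∘ γ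
by J³. Their product gets J⁴ > 0, so the sign s does not depend on the orientation of the
parameters. -/
theorem FoldContact.of_reparam {s : ℝ} (hx : FoldContact s (ldFun x.toFun) (mcncFun x.toFun))
    (hi : InverseDiffeoGerms h k) (hy : ∀ᶠ q in 𝓝 (0 : Plane), y.toFun q = x.toFun (h q)) :
    FoldContact s (ldFun y.toFun) (mcncFun y.toFun) := by
  have hall := hx.exists_forall x.smooth.ldFun x.smooth.mcncFun
  obtain ⟨h0, hd, hH, l, hl, γ, hγ, hs⟩ := hx
  have hf := (forms_of_reparam hi hy).self_of_nhds
  have hfe := forms_of_reparam hi hy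
  have hJ := hi.jac_ne_zero
  have γt : Tendsto γ (𝓝 0) (𝓝 0) := by
    have := hγ.1.contDiffAt.continuousAt
    rwa [ContinuousAt, hγ.2.1] at this
  have skγ : SmoothNear (fun a => k (γ a)) 0 :=
    SmoothNear.comp (by rw [hγ.2.1]; exact hi.2.1) hγ.1
  have kγ0 : k (γ 0) = 0 := by rw [hγ.2.1, hi.2.2.2.1]
  have kγt : Tendsto (fun a => k (γ a)) (𝓝 0) (𝓝 0) := by
    have := skγ.contDiffAt.continuousAt
    rwa [ContinuousAt, kγ0] at this
  have hinv : ∀ᶠ a in 𝓝 (0 : ℝ), h (k (γ a)) = γ a := γt.eventually hi.2.2.2.2.1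
  refine ⟨by rw [hf.1, hi.2.2.1, h0, mul_zero],
    fderiv_ld_ne_zero_of_reparam hi hy h0 hH hd, by rw [hf.2.1, hi.2.2.1, hH, mul_zero],
    jac h 0 * l, fun e => ?_, fun a => k (γ a), ⟨skγ, kγ0, ?_, ?_⟩, ?_⟩
  · obtain ⟨h1, h2⟩ := fderiv_forms_of_reparam hi hy h0 hH e
    rw [h1, h2, hl]
    ring
  · have h1 : HasFDerivAt k (fderiv ℝ k 0) (γ 0) := by
      rw [hγ.2.1]; exact hi.2.1.differentiableAt.hasFDerivAt
    have h2 : deriv (fun a => k (γ a)) 0 = _ :=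
      (h1.comp_hasDerivAt 0 hγ.1.differentiableAt.hasDerivAt).deriv
    rw [h2]
    intro hc
    apply hγ.2.2.1
    rw [← hi.symm.fderiv_comp (deriv γ 0), hc, map_zero]
  · filter_upwards [kγt.eventually hfe, hinv, hγ.2.2.2] with a h1 h2 h3
    rw [h1.1, h2, h3, mul_zero]
  · have e1 : (fun a => mcncFun y.toFun (k (γ a))) =ᶠ[𝓝 0]
        fun a => jac h (k (γ a)) ^ 3 * mcncFun x.toFun (γ a) := by
      filter_upwards [kγt.eventually hfe, hinv] with a h1 h2
      rw [h1.2.1, h2]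
    obtain ⟨hj, -⟩ := hall γ hγ
    have sw := hγ.smoothNear_comp x.smooth.mcncFun
    have sJ : SmoothNear (fun a => jac h (k (γ a))) 0 :=
      SmoothNear.comp (by rw [kγ0]; exact hi.1.jac) skγ
    have sJ3 : SmoothNear (fun a => jac h (k (γ a)) ^ 3) 0 := sJ.mono fun _ h => h.pow 3
    have le : ((2 : ℕ) : WithTop ℕ∞) ≤ ∞ := ENat.LEInfty.out
    rw [e1.iteratedDeriv_eq, iteratedDeriv_fun_mul (sJ3.contDiffAt.of_le le)
      (sw.contDiffAt.of_le le)]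
    -- H vanishes to second order along the curve, so Leibniz leaves J³ times its second derivative.
    have w0 := hj 0 (by norm_num)
    have w1 := hj 1 (by norm_num)
    simp only [Finset.sum_range_succ, w0, w1]
    simp only [Finset.range_zero, Finset.sum_empty, iteratedDeriv_zero, kγ0]
    have hJ4 : 0 < jac h 0 ^ 4 := by positivity
    have := mul_neg_of_pos_of_neg hJ4 hs
    norm_num at w0 ⊢
    linarith

end Invariance

/-- The germ `x ∘ h`. -/
def LocalParam.comp (x : LocalParam) {h k : Plane → Plane} (hi : InverseDiffeoGerms h k) :
    LocalParam where
  toFun q := x.toFun (h q)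
  smooth := x.smooth.comp_zero hi.1 hi.2.2.1
  immersion := by
    have h1 : HasFDerivAt x.toFun (fderiv ℝ x.toFun 0) (h 0) := by
      rw [hi.2.2.1]; exact x.smooth.differentiableAt.hasFDerivAt
    have h2 : fderiv ℝ (fun q => x.toFun (h q)) 0 = _ :=
      (h1.comp 0 hi.1.differentiableAt.hasFDerivAt).fderiv
    rw [h2]
    refine x.immersion.comp fun a b hab => ?_
    have hab' : fderiv ℝ h 0 a = fderiv ℝ h 0 b := hab
    rw [← hi.fderiv_comp a, hab', hi.fderiv_comp b]

theorem LocalParam.comp_equiv (x : LocalParam) {h k : Plane → Plane}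
    (hi : InverseDiffeoGerms h k) : x ≈ x.comp hi :=
  ⟨h, k, hi, .of_forall fun _ => rfl⟩

theorem inverseDiffeoGerms_linear (A : Plane ≃L[ℝ] Plane) : InverseDiffeoGerms A A.symm :=
  ⟨smoothNear_of_contDiff A.contDiff _, smoothNear_of_contDiff A.symm.contDiff _, map_zero _,
    map_zero _, .of_forall fun _ => A.apply_symm_apply _, .of_forall fun _ => A.symm_apply_apply _⟩

/-- At the origin, the vector `x_u` is orthogonal to the surface. -/
def Normalized (x : LocalParam) : Prop :=
  mink (du x.toFun 0) (du x.toFun 0) = 0 ∧ mink (du x.toFun 0) (dv x.toFun 0) = 0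

/-- A degenerate first fundamental form has a kernel vector, and `A` sends the first basis vector to
it. Unless the first row (E, F) is zero, (-F, E) is such a vector. -/
theorem exists_normalized {x : LocalParam} (h0 : ldFun x.toFun 0 = 0) :
    ∃ A : Plane ≃L[ℝ] Plane, Normalized (x.comp (inverseDiffeoGerms_linear A)) := by
  set E := coeffE x.toFun 0 with hE
  set F := coeffF x.toFun 0 with hF
  set G := coeffG x.toFun 0 with hG
  have hd : F ^ 2 - E * G = 0 := h0
  obtain ⟨p, q, hpq, h1, h2⟩ : ∃ p q : ℝ, (p ≠ 0 ∨ q ≠ 0) ∧ p * E + q * F = 0 ∧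
      p * F + q * G = 0 := by
    by_cases hz : E = 0 ∧ F = 0
    · exact ⟨1, 0, Or.inl one_ne_zero, by simp [hz.1], by simp [hz.2]⟩
    · refine ⟨-F, E, ?_, by ring, by linarith⟩
      by_contra! hc
      exact hz ⟨hc.2, neg_eq_zero.1 hc.1⟩
  obtain ⟨A, hA⟩ := exists_conformal hpq
  refine ⟨A, ?_⟩
  have hder : ∀ e, fderiv ℝ (x.comp (inverseDiffeoGerms_linear A)).toFun 0 e =
      fderiv ℝ x.toFun 0 (A e) := by
    intro e
    have h1 : HasFDerivAt x.toFun (fderiv ℝ x.toFun 0) (A 0) := by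
      rw [map_zero]; exact x.smooth.differentiableAt.hasFDerivAt
    have h2 : fderiv ℝ (fun q => x.toFun (A q)) 0 = _ := (h1.comp 0 A.hasFDerivAt).fderiv
    change fderiv ℝ (fun q => x.toFun (A q)) 0 e = _
    rw [h2]
    rfl
  have hlin : ∀ a b : ℝ, fderiv ℝ x.toFun 0 (a, b) =
      a • du x.toFun 0 + b • dv x.toFun 0 := fderiv_pair x.toFun 0
  have hu : du (x.comp (inverseDiffeoGerms_linear A)).toFun 0 =
      p • du x.toFun 0 + q • dv x.toFun 0 := by
    rw [du, hder, hA, hlin]; simp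
  have hv : dv (x.comp (inverseDiffeoGerms_linear A)).toFun 0 =
      (-q) • du x.toFun 0 + p • dv x.toFun 0 := by
    rw [dv, hder, hA, hlin]; simp
  have hE' : mink (du x.toFun 0) (du x.toFun 0) = E := rfl
  have hF' : mink (du x.toFun 0) (dv x.toFun 0) = F := rfl
  have hG' : mink (dv x.toFun 0) (dv x.toFun 0) = G := rfl
  constructor
  · rw [hu, mink_comb, hE', hF', hG']
    linear_combination p * h1 + q * h2
  · rw [hu, hv, mink_comb, hE', hF', hG']
    linear_combination -q * h1 + p * h2

theorem dirD_mink {E : Type*} [NormedAddCommGroup E] [NormedSpace ℝ E] {X Y : E → R31} {z : E}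
    (hX : DifferentiableAt ℝ X z) (hY : DifferentiableAt ℝ Y z) (e : E) :
    dirD e (fun y => mink (X y) (Y y)) z = mink (dirD e X z) (Y z) + mink (X z) (dirD e Y z) := by
  have cX := hasFDerivAt_pi'.1 hX.hasFDerivAt
  have cY := hasFDerivAt_pi'.1 hY.hasFDerivAt
  have h := (((cX 0).mul (cY 0)).add ((cX 1).mul (cY 1))).sub ((cX 2).mul (cY 2))
  have h2 : fderiv ℝ (fun y => mink (X y) (Y y)) z = _ := h.fderiv
  rw [dirD, h2]
  simp [mink, dirD]
  ring

/-- A vector transverse to the surface. -/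
theorem exists_transverse (x : LocalParam) :
    ∃ N : R31, mink (mcross (du x.toFun 0) (dv x.toFun 0)) N ≠ 0 := by
  by_contra! hc
  set P := du x.toFun 0 with hP
  set Q := dv x.toFun 0 with hQ
  have h0 := hc ![1, 0, 0]
  have h1 := hc ![0, 1, 0]
  have h2 := hc ![0, 0, 1]
  simp [mink, mcross] at h0 h1 h2
  have key : ∀ a b : ℝ, a • P + b • Q = 0 → a = 0 ∧ b = 0 := by
    intro a b hab
    have : ((a, b) : Plane) = 0 := x.immersion (by
      rw [map_zero]
      exact (fderiv_pair x.toFun 0 a b).trans hab)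
    simpa using this
  -- If all 2 × 2 minors vanish, then P_j Q_i = Q_j P_i for all i, j, which is a linear relation
  -- between `P` and `Q` for each i.
  have k : ∀ i, P i = 0 := by
    intro i
    have := key (Q i) (-P i) (by
      ext j
      fin_cases i <;> fin_cases j <;> simp <;> linarith)
    simpa using this.2
  have := key 1 0 (by ext j; simp [k])
  simp at this

/-- A vector of the tangent plane of a degenerate surface is orthogonal to its kernel. -/
theorem mink_eq_zero_of_det {P Q N w : R31} (hPP : mink P P = 0) (hPQ : mink P Q = 0)
    (hN : mink (mcross P Q) N ≠ 0) (hw : mink (mcross P Q) w = 0) : mink P w = 0 := by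
  -- Cramer's rule for w in the frame P, Q, N, paired with P.
  have : mink (mcross P Q) N * mink P w = mink (mcross P Q) w * mink P N
      + mink (mcross w Q) N * mink P P + mink (mcross P w) N * mink P Q := by
    simp [mink, mcross]; ring
  rw [hw, hPP, hPQ] at this
  simpa [hN] using this

/-- The 2-jet at the origin of a normalized surface with degenerate contact. -/
theorem Normalized.facts {x : LocalParam} (hn : Normalized x) (hd : DegenerateContact x) :
    mink (dv x.toFun 0) (dv x.toFun 0) ≠ 0 ∧ fderiv ℝ (ldFun x.toFun) 0 (1, 0) = 0 ∧
    fderiv ℝ (ldFun x.toFun) 0 (0, 1) ≠ 0 ∧ kapFun x.toFun 0 < 0 := by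
  obtain ⟨N, hN⟩ := exists_transverse x
  obtain ⟨h0, hδ, hH, -⟩ := (degenerateContact_iff x).1 hd
  obtain ⟨hE, hF⟩ := hn
  have su : SmoothNear (du x.toFun) 0 := x.smooth.dirD _
  have sv : SmoothNear (dv x.toFun) 0 := x.smooth.dirD _
  have sE := su.mink su
  have sF := su.mink sv
  have sG := sv.mink sv
  -- As E = F = 0 at the origin, only -G dE survives in the differential of F² - EG.
  have hder : ∀ e, fderiv ℝ (ldFun x.toFun) 0 e =
      -(mink (dv x.toFun 0) (dv x.toFun 0) * (2 * mink (du x.toFun 0) (dirD e (du x.toFun) 0))) := by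
    intro e
    have h1 := (sF.differentiableAt.hasFDerivAt.pow 2).sub
      (sE.differentiableAt.hasFDerivAt.mul sG.differentiableAt.hasFDerivAt)
    have h2 : fderiv ℝ (ldFun x.toFun) 0 = _ := h1.fderiv
    have h3 := dirD_mink su.differentiableAt su.differentiableAt e
    rw [dirD] at h3
    rw [h2]
    simp [hE, hF, h3]
    left
    simp [mink]; ring
  have hG : mink (dv x.toFun 0) (dv x.toFun 0) ≠ 0 := by
    intro hG
    exact hδ (ContinuousLinearMap.ext fun e => by rw [hder, hG]; simp)
  have hL : mink (mcross (du x.toFun 0) (dv x.toFun 0)) (du (du x.toFun) 0) = 0 := by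
    have : mcncFun x.toFun 0 = mink (mcross (du x.toFun 0) (dv x.toFun 0)) (du (du x.toFun) 0)
        * mink (dv x.toFun 0) (dv x.toFun 0)
        - 2 * coeffM x.toFun 0 * mink (du x.toFun 0) (dv x.toFun 0)
        + coeffN x.toFun 0 * mink (du x.toFun 0) (du x.toFun 0) := rfl
    rw [hH, hE, hF] at this
    have h2 : mink (mcross (du x.toFun 0) (dv x.toFun 0)) (du (du x.toFun) 0)
        * mink (dv x.toFun 0) (dv x.toFun 0) = 0 := by linarith
    exact (mul_eq_zero.1 h2).resolve_right hG
  have h1 : fderiv ℝ (ldFun x.toFun) 0 (1, 0) = 0 := by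
    rw [hder]
    have : mink (du x.toFun 0) (dirD (1, 0) (du x.toFun) 0) = 0 := mink_eq_zero_of_det hE hF hN hL
    rw [this]; ring
  have h2 : fderiv ℝ (ldFun x.toFun) 0 (0, 1) ≠ 0 :=
    (clm_plane_ne_zero.1 hδ).resolve_left (fun h => h h1)
  refine ⟨hG, h1, h2, ?_⟩
  -- If M = 0, then x_uv is tangent to the surface, hence orthogonal to the kernel vector x_u, and
  -- the v-derivative of δ vanishes as well.
  have hM : mink (mcross (du x.toFun 0) (dv x.toFun 0)) (dv (du x.toFun) 0) ≠ 0 := by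
    intro hM
    apply h2
    rw [hder]
    have : mink (du x.toFun 0) (dirD (0, 1) (du x.toFun) 0) = 0 := mink_eq_zero_of_det hE hF hN hM
    rw [this]; ring
  have hk : kapFun x.toFun 0 = mink (mcross (du x.toFun 0) (dv x.toFun 0)) (du (du x.toFun) 0)
      * coeffN x.toFun 0 - mink (mcross (du x.toFun 0) (dv x.toFun 0)) (dv (du x.toFun) 0) ^ 2 := rfl
  rw [hk, hL]
  have := sq_pos_of_ne_zero hM
  linarith

/-- The sign of κ does not depend on the parametrisation, because κ has the even weight J⁴. In a
normalised one L = 0 and M ≠ 0, so κ = -M². -/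
theorem DegenerateContact.kapFun_neg {x : LocalParam} (hd : DegenerateContact x) :
    kapFun x.toFun 0 < 0 := by
  obtain ⟨A, hA⟩ := exists_normalized hd.1
  have hy : ∀ᶠ q in 𝓝 (0 : Plane), (x.comp (inverseDiffeoGerms_linear A)).toFun q = x.toFun (A q) :=
    .of_forall fun _ => rfl
  have h1 := (hA.facts (hd.of_reparam (inverseDiffeoGerms_linear A) hy)).2.2.2
  rw [(forms_of_reparam (inverseDiffeoGerms_linear A) hy).self_of_nhds.2.2, map_zero] at h1
  by_contra hc
  exact absurd h1 (not_lt.2 (mul_nonneg (by positivity) (not_lt.1 hc)))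


/-! Perturbations of a surface in a fixed direction. -/

section Perturb

variable {E : Type*} [NormedAddCommGroup E] [NormedSpace ℝ E]

/-- Reads a directional derivative of a polynomial off its expansion on a line; degree four suffices
for every polynomial used below. -/
theorem dirD_of_expansion {p : E → ℝ} {z a : E} (hp : DifferentiableAt ℝ p z) {c₀ c₁ c₂ c₃ c₄ : ℝ}
    (h : ∀ s : ℝ, p (z + s • a) = c₀ + c₁ * s + s ^ 2 * (c₂ + c₃ * s + c₄ * s ^ 2)) :
    dirD a p z = c₁ := by
  rw [dirD, ← hp.lineDeriv_eq_fderiv, lineDeriv]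
  simp only [h]
  have h1 := (((hasDerivAt_id (0 : ℝ)).const_mul c₁).const_add c₀).add
    (((hasDerivAt_id (0 : ℝ)).fun_pow 2).mul ((((hasDerivAt_id (0 : ℝ)).const_mul c₃).const_add c₂).add
      (((hasDerivAt_id (0 : ℝ)).fun_pow 2).const_mul c₄)))
  refine (HasDerivAt.deriv h1).trans ?_
  simp

/-- Moving a family by a scalar function times a constant vector. -/
def push (X : E → R31) (p : E → ℝ) (N : R31) (z : E) : R31 := X z + p z • N

theorem SmoothNear.smul_const {p : E → ℝ} {z : E} (hp : SmoothNear p z) (N : R31) :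
    SmoothNear (fun z => p z • N) z :=
  hp.mono fun _ h => h.smul contDiffAt_const

theorem SmoothNear.push {X : E → R31} {z : E} (hX : SmoothNear X z) {p : E → ℝ}
    (hp : SmoothNear p z) (N : R31) : SmoothNear (push X p N) z :=
  SmoothNear.add hX (hp.smul_const N)

theorem dirD_push {X : E → R31} {z : E} (hX : SmoothNear X z) {p : E → ℝ} (hp : SmoothNear p z)
    (N : R31) (a : E) : dirD a (push X p N) =ᶠ[𝓝 z] push (dirD a X) (dirD a p) N := by
  filter_upwards [hX.eventually_differentiableAt, hp.eventually_differentiableAt] with y h1 h2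
  have h3 : DifferentiableAt ℝ (fun z => p z • N) y := h2.smul_const N
  have h4 : dirD a (fun z => p z • N) y = dirD a p y • N := by
    rw [dirD, fderiv_smul_const h2]; rfl
  exact (dirD_add h1 h3 a).trans (by rw [h4]; rfl)

theorem dirD_dirD_push {X : E → R31} {z : E} (hX : SmoothNear X z) {p : E → ℝ}
    (hp : SmoothNear p z) (N : R31) (a b : E) :
    dirD b (dirD a (push X p N)) z = dirD b (dirD a X) z + dirD b (dirD a p) z • N := by
  rw [(dirD_congr (dirD_push hX hp N a) b).eq_of_nhds]
  exact (dirD_push (hX.dirD a) (hp.dirD a) N b).eq_of_nhds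

theorem gLd_push {X : E → R31} {z : E} (hX : SmoothNear X z) {p : E → ℝ} (hp : SmoothNear p z)
    (N : R31) (a b : E) : gLd a b (push X p N) z =
      ldForm (dirD a X z + dirD a p z • N) (dirD b X z + dirD b p z • N) := by
  rw [gLd, (dirD_push hX hp N a).eq_of_nhds, (dirD_push hX hp N b).eq_of_nhds]; rfl

theorem gMc_push {X : E → R31} {z : E} (hX : SmoothNear X z) {p : E → ℝ} (hp : SmoothNear p z)
    (N : R31) (a b : E) : gMc a b (push X p N) z =
      mcForm (dirD a X z + dirD a p z • N) (dirD b X z + dirD b p z • N)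
        (dirD a (dirD a X) z + dirD a (dirD a p) z • N)
        (dirD b (dirD a X) z + dirD b (dirD a p) z • N)
        (dirD b (dirD b X) z + dirD b (dirD b p) z • N) := by
  rw [gMc, (dirD_push hX hp N a).eq_of_nhds, (dirD_push hX hp N b).eq_of_nhds,
    dirD_dirD_push hX hp, dirD_dirD_push hX hp, dirD_dirD_push hX hp]; rfl

theorem mcForm_push (P Q R S T N : R31) (r s t : ℝ) :
    mcForm P Q (R + r • N) (S + s • N) (T + t • N) = mcForm P Q R S T
      + mink (mcross P Q) N * (r * mink Q Q - 2 * s * mink P Q + t * mink P P) := by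
  simp [mcForm, mink]; ring

theorem continuous_jets_push {X : E → R31} (hX : SmoothNear X 0) {p : E → ℝ} (hp : SmoothNear p 0)
    (N : R31) : Continuous fun (ε : ℝ) (k : ℕ) =>
      iteratedFDeriv ℝ k (push X (fun z => ε * p z) N) 0 := by
  refine continuous_pi fun k => ?_
  -- Each jet of the perturbed map is affine in ε.
  have e : ∀ ε : ℝ, iteratedFDeriv ℝ k (push X (fun z => ε * p z) N) 0 =
      iteratedFDeriv ℝ k X 0 + ε • iteratedFDeriv ℝ k (fun z => p z • N) 0 := by
    intro ε
    have h1 : push X (fun z => ε * p z) N = X + ε • (fun z => p z • N) := by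
      funext z; simp [push, mul_smul]
    have c1 : ContDiffAt ℝ k X 0 := hX.contDiffAt.of_le (by exact_mod_cast le_top)
    have c2 : ContDiffAt ℝ k (fun z => p z • N) 0 :=
      (hp.smul_const N).contDiffAt.of_le (by exact_mod_cast le_top)
    have c3 : ContDiffAt ℝ k (ε • fun z => p z • N) 0 := c2.const_smul ε
    rw [h1, iteratedFDeriv_add_apply c1 c3, iteratedFDeriv_const_smul_apply c2]
  simp only [e]
  fun_prop

end Perturb

/-! Generic one-parameter families. -/

theorem dirD_fst_eq_deriv {f : ℝ × Plane → ℝ} (hf : DifferentiableAt ℝ f 0) :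
    dirD (1, 0) f 0 = deriv (fun t => f (t, 0)) 0 := by
  rw [dirD, ← hf.lineDeriv_eq_fderiv, lineDeriv]
  congr 1
  funext t
  simp

/-- The speed at which the `MCNC` and the `LD` move apart in the family `X`, if the tangent
directions of their defining functions at the origin have the ratio `l`. -/
def splitting (l : ℝ) (X : ℝ × Plane → R31) : ℝ :=
  dirD (1, 0) (gMc (0, 1, 0) (0, 0, 1) X) 0 - l * dirD (1, 0) (gLd (0, 1, 0) (0, 0, 1) X) 0

theorem continuous_splitting (x : LocalParam) (l : ℝ) :
    Continuous fun X : Deformation x => splitting l X.toFun :=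
  (((vecJetCont_deformation x).gMc _ _).dirD _).continuous.sub
    ((((vecJetCont_deformation x).gLd _ _).dirD _).continuous.const_mul l)

/-- `t` times a quadratic form. -/
def tQuad (c : Fin 3 → ℝ) (z : ℝ × Plane) : ℝ :=
  z.1 * (c 0 * z.2.1 ^ 2 + c 1 * z.2.1 * z.2.2 + c 2 * z.2.2 ^ 2)

theorem contDiff_tQuad (c : Fin 3 → ℝ) : ContDiff ℝ ∞ (tQuad c) := by
  unfold tQuad; fun_prop

theorem dirD_tQuad (c : Fin 3 → ℝ) (e : Plane) : dirD (0, e) (tQuad c) = fun z =>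
    z.1 * (2 * c 0 * z.2.1 * e.1 + c 1 * (z.2.1 * e.2 + e.1 * z.2.2) + 2 * c 2 * z.2.2 * e.2) := by
  funext z
  refine dirD_of_expansion (c₀ := tQuad c z)
    (c₂ := z.1 * (c 0 * e.1 ^ 2 + c 1 * e.1 * e.2 + c 2 * e.2 ^ 2)) (c₃ := 0) (c₄ := 0)
    ((contDiff_tQuad c).differentiable (by simp) z) fun s => ?_
  simp [tQuad]; ring

theorem dirD_dirD_tQuad (c : Fin 3 → ℝ) (e e' : Plane) (z : ℝ × Plane) :
    dirD (0, e') (dirD (0, e) (tQuad c)) z =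
      z.1 * (2 * c 0 * e.1 * e'.1 + c 1 * (e'.1 * e.2 + e.1 * e'.2) + 2 * c 2 * e.2 * e'.2) := by
  rw [dirD_tQuad]
  refine dirD_of_expansion (c₀ := z.1 * (2 * c 0 * z.2.1 * e.1 + c 1 * (z.2.1 * e.2 + e.1 * z.2.2)
    + 2 * c 2 * z.2.2 * e.2)) (c₂ := 0) (c₃ := 0) (c₄ := 0) (by fun_prop) fun s => ?_
  simp; ring

/-- `splitting` sees the two functions only on the t-axis. There the first slice derivatives of
`tQuad c` vanish, so δ is unchanged, while its second slice derivatives are t times constants and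
enter H linearly. -/
theorem splitting_push {X : ℝ × Plane → R31} (hX : SmoothNear X 0) (l : ℝ) (c : Fin 3 → ℝ)
    (N : R31) : splitting l (push X (tQuad c) N) = splitting l X +
      mink (mcross (dirD (0, 1, 0) X 0) (dirD (0, 0, 1) X 0)) N *
        (2 * c 0 * mink (dirD (0, 0, 1) X 0) (dirD (0, 0, 1) X 0)
          - 2 * c 1 * mink (dirD (0, 1, 0) X 0) (dirD (0, 0, 1) X 0)
          + 2 * c 2 * mink (dirD (0, 1, 0) X 0) (dirD (0, 1, 0) X 0)) := by
  have hp : ∀ z, SmoothNear (tQuad c) z := fun z => smoothNear_of_contDiff (contDiff_tQuad c) z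
  have hX' := hX.push (hp 0) N
  have hc : ContinuousAt (fun t : ℝ => (t, (0 : Plane))) 0 := by fun_prop
  have hne : ∀ᶠ t in 𝓝 (0 : ℝ), SmoothNear X (t, 0) := by
    exact hc.eventually (eventually_eventually_nhds.2 hX)
  have d0 : ∀ (t : ℝ) (e : Plane), dirD (0, e) (tQuad c) (t, 0) = 0 := by
    intro t e; rw [dirD_tQuad]; simp
  have e1 : (fun t : ℝ => gLd (0, 1, 0) (0, 0, 1) (push X (tQuad c) N) (t, 0)) =ᶠ[𝓝 0]
      fun t => gLd (0, 1, 0) (0, 0, 1) X (t, 0) := by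
    filter_upwards [hne] with t ht
    rw [gLd_push ht (hp _), d0, d0]; simp [gLd]
  let B : ℝ × Plane → ℝ := fun z => mink (mcross (dirD (0, 1, 0) X z) (dirD (0, 0, 1) X z)) N *
        (2 * c 0 * mink (dirD (0, 0, 1) X z) (dirD (0, 0, 1) X z)
          - 2 * c 1 * mink (dirD (0, 1, 0) X z) (dirD (0, 0, 1) X z)
          + 2 * c 2 * mink (dirD (0, 1, 0) X z) (dirD (0, 1, 0) X z))
  have e2 : (fun t : ℝ => gMc (0, 1, 0) (0, 0, 1) (push X (tQuad c) N) (t, 0)) =ᶠ[𝓝 0]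
      fun t => gMc (0, 1, 0) (0, 0, 1) X (t, 0) + t * B (t, 0) := by
    filter_upwards [hne] with t ht
    rw [gMc_push ht (hp _), d0, d0, zero_smul, add_zero, add_zero, mcForm_push,
      dirD_dirD_tQuad, dirD_dirD_tQuad, dirD_dirD_tQuad]
    simp only [gMc, B]; ring
  have hA := hX.dirD ((0, 1, 0) : ℝ × Plane)
  have hB := hX.dirD ((0, 0, 1) : ℝ × Plane)
  have hBd : DifferentiableAt ℝ B 0 := by
    have := ((hA.mcross hB).mink (smoothNear_const N 0)).mul
      ((((smoothNear_const (2 * c 0) 0).mul (hB.mink hB)).sub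
      ((smoothNear_const (2 * c 1) 0).mul (hA.mink hB))).add
      ((smoothNear_const (2 * c 2) 0).mul (hA.mink hA)))
    exact this.differentiableAt
  have hl : DifferentiableAt ℝ (fun t : ℝ => (t, (0 : Plane))) 0 := by fun_prop
  have dB : DifferentiableAt ℝ (fun t : ℝ => B (t, 0)) 0 :=
    DifferentiableAt.comp (g := B) (0 : ℝ) hBd hl
  have dM : DifferentiableAt ℝ (fun t : ℝ => gMc (0, 1, 0) (0, 0, 1) X (t, 0)) 0 :=
    DifferentiableAt.comp (g := gMc (0, 1, 0) (0, 0, 1) X) (0 : ℝ) (hX.gMc _ _).differentiableAt hl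
  have d2 : deriv (fun t : ℝ => gMc (0, 1, 0) (0, 0, 1) X (t, 0) + t * B (t, 0)) 0 =
      deriv (fun t : ℝ => gMc (0, 1, 0) (0, 0, 1) X (t, 0)) 0 + B 0 := by
    have := (dM.hasDerivAt.add ((hasDerivAt_id (0 : ℝ)).mul dB.hasDerivAt)).deriv
    refine Eq.trans this ?_
    simp [Prod.mk_zero_zero]
  rw [splitting, dirD_fst_eq_deriv (hX'.gMc _ _).differentiableAt,
    dirD_fst_eq_deriv (hX'.gLd _ _).differentiableAt, e1.deriv_eq, e2.deriv_eq, d2, splitting,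
    dirD_fst_eq_deriv (hX.gMc _ _).differentiableAt,
    dirD_fst_eq_deriv (hX.gLd _ _).differentiableAt]
  simp only [B]; ring

/-- The family `X + ε p N`. -/
def Deformation.push {x : LocalParam} (X : Deformation x) (c : Fin 3 → ℝ) (N : R31) (ε : ℝ) :
    Deformation x where
  toFun := MinkowskiSurface.push X.toFun (fun z => ε * tQuad c z) N
  smooth := X.smooth.push ((smoothNear_const ε 0).mul (smoothNear_of_contDiff (contDiff_tQuad c) 0)) N
  at_zero := by
    filter_upwards [X.at_zero] with q hq
    simp [MinkowskiSurface.push, tQuad, hq]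

theorem Deformation.continuous_push {x : LocalParam} (X : Deformation x) (c : Fin 3 → ℝ) (N : R31) :
    Continuous (X.push c N) :=
  continuous_induced_rng.2 (continuous_jets_push X.smooth
    (smoothNear_of_contDiff (contDiff_tQuad c) 0) N)

theorem Deformation.push_zero {x : LocalParam} (X : Deformation x) (c : Fin 3 → ℝ) (N : R31) :
    X.push c N 0 = X := by
  cases X
  simp only [Deformation.push]
  congr 1
  funext z
  simp [MinkowskiSurface.push]

theorem Deformation.slice_zero {x : LocalParam} (X : Deformation x) :
    X.slice 0 =ᶠ[𝓝 0] x.toFun := X.at_zero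

theorem Deformation.dirD_zero {x : LocalParam} (X : Deformation x) (e : Plane) :
    dirD (0, e) X.toFun 0 = dirD e x.toFun 0 := by
  rw [← (dirD_congr X.slice_zero e).eq_of_nhds]
  exact (dirD_slice (z := 0) X.smooth.differentiableAt e).symm

/-- A family with zero splitting is pushed along a transverse vector by ε times `tQuad c`. The
coefficients c = (G, -F, E) turn the bracket of `splitting_push` into 2(E² + F² + G²), positive
because E = F = G = 0 would make dδ vanish. -/
theorem dense_splitting_ne_zero (x : LocalParam) (hd : fderiv ℝ (ldFun x.toFun) 0 ≠ 0) (l : ℝ) :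
    Dense {X : Deformation x | splitting l X.toFun ≠ 0} := by
  intro X
  by_cases h0 : splitting l X.toFun ≠ 0
  · exact subset_closure h0
  rw [not_not] at h0
  obtain ⟨N, hN⟩ := exists_transverse x
  let P := du x.toFun 0
  let Q := dv x.toFun 0
  let c : Fin 3 → ℝ := ![mink Q Q, -mink P Q, mink P P]
  have hK : 0 < mink Q Q ^ 2 + mink P Q ^ 2 + mink P P ^ 2 := by
    by_contra hcon
    have h1 : mink Q Q = 0 := by nlinarith [sq_nonneg (mink Q Q), sq_nonneg (mink P Q), sq_nonneg (mink P P)]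
    have h2 : mink P Q = 0 := by nlinarith [sq_nonneg (mink Q Q), sq_nonneg (mink P Q), sq_nonneg (mink P P)]
    have h3 : mink P P = 0 := by nlinarith [sq_nonneg (mink Q Q), sq_nonneg (mink P Q), sq_nonneg (mink P P)]
    apply hd
    have sP : SmoothNear (du x.toFun) 0 := x.smooth.dirD (1, 0)
    have sQ : SmoothNear (dv x.toFun) 0 := x.smooth.dirD (0, 1)
    have e : ldFun x.toFun = fun q => mink (du x.toFun q) (dv x.toFun q) *
      mink (du x.toFun q) (dv x.toFun q) - mink (du x.toFun q) (du x.toFun q) *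
      mink (dv x.toFun q) (dv x.toFun q) := by
      funext q; simp only [ldFun, coeffE, coeffF, coeffG]; ring
    have h1' : mink (dv x.toFun 0) (dv x.toFun 0) = 0 := h1
    have h2' : mink (du x.toFun 0) (dv x.toFun 0) = 0 := h2
    have h3' : mink (du x.toFun 0) (du x.toFun 0) = 0 := h3
    refine ContinuousLinearMap.ext fun v => ?_
    rw [e, fderiv_fun_sub ((sP.mink sQ).mul (sP.mink sQ)).differentiableAt
      ((sP.mink sP).mul (sQ.mink sQ)).differentiableAt, _root_.sub_apply,
      fderiv_mul_of_eq_zero (sP.mink sQ).differentiableAt (sP.mink sQ).differentiableAt h2',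
      fderiv_mul_of_eq_zero (sP.mink sP).differentiableAt (sQ.mink sQ).differentiableAt h1', h2', h3']
    simp
  have hs : ∀ ε : ℝ, splitting l (X.push c N ε).toFun =
      ε * (2 * mink (mcross P Q) N * (mink Q Q ^ 2 + mink P Q ^ 2 + mink P P ^ 2)) := by
    intro ε
    have e : (fun z => ε * tQuad c z) = tQuad (ε • c) := by
      funext z; simp [tQuad]; ring
    simp only [Deformation.push, e]
    rw [splitting_push X.smooth, h0, X.dirD_zero, X.dirD_zero]
    simp only [c, Pi.smul_apply, smul_eq_mul, Matrix.cons_val]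
    change 0 + mink (mcross P Q) N * (2 * (ε * mink Q Q) * mink Q Q
      - 2 * (ε * -mink P Q) * mink P Q + 2 * (ε * mink P P) * mink P P) = _
    ring
  have ht : Tendsto (X.push c N) (𝓝[≠] 0) (𝓝 X) := by
    have := (X.continuous_push c N).tendsto 0
    rw [X.push_zero] at this
    exact this.mono_left nhdsWithin_le_nhds
  refine mem_closure_of_tendsto ht ?_
  filter_upwards [self_mem_nhdsWithin] with ε hε
  rw [hs]
  exact mul_ne_zero hε (mul_ne_zero (mul_ne_zero two_ne_zero hN) hK.ne')

/-- The inverse function theorem for x followed by a linear left inverse of its differential. It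
serves to show that a change of parameters between two deformations of x is the identity at t = 0.
-/
theorem LocalParam.eventually_left_inverse (x : LocalParam) :
    ∃ g : R31 → Plane, ∀ᶠ q in 𝓝 (0 : Plane), g (x.toFun q) = q := by
  obtain ⟨L, hL⟩ := LinearMap.exists_leftInverse_of_injective (fderiv ℝ x.toFun 0).toLinearMap
    (LinearMap.ker_eq_bot.2 x.immersion)
  let L' : R31 →L[ℝ] Plane := LinearMap.toContinuousLinearMap L
  have hs : HasStrictFDerivAt x.toFun (fderiv ℝ x.toFun 0) 0 :=
    x.smooth.contDiffAt.hasStrictFDerivAt (by simp)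
  have hc : HasStrictFDerivAt (fun q => L' (x.toFun q))
      ((ContinuousLinearEquiv.refl ℝ Plane : Plane ≃L[ℝ] Plane) : Plane →L[ℝ] Plane) 0 := by
    have h1 := L'.hasStrictFDerivAt.comp (0 : Plane) hs
    have h2 : L'.comp (fderiv ℝ x.toFun 0) =
        ((ContinuousLinearEquiv.refl ℝ Plane : Plane ≃L[ℝ] Plane) : Plane →L[ℝ] Plane) :=
      ContinuousLinearMap.ext fun e => LinearMap.congr_fun hL e
    rw [← h2]; exact h1
  exact ⟨fun y => hc.localInverse _ _ _ (L' y), hc.eventually_left_inverse⟩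

theorem Deformation.forms_zero {x : LocalParam} (X : Deformation x) :
    (fun q => gLd (0, 1, 0) (0, 0, 1) X.toFun (0, q)) =ᶠ[𝓝 0] ldFun x.toFun ∧
    (fun q => gMc (0, 1, 0) (0, 0, 1) X.toFun (0, q)) =ᶠ[𝓝 0] mcncFun x.toFun := by
  have hc : ContinuousAt (fun q : Plane => ((0 : ℝ), q)) 0 := by fun_prop
  have hX : ∀ᶠ q in 𝓝 (0 : Plane), SmoothNear X.toFun (0, q) :=
    hc.eventually (eventually_eventually_nhds.2 X.smooth)
  constructor
  · filter_upwards [hX, ldFun_congr X.slice_zero] with q h1 h2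
    rw [← h2]; exact (forms_slice h1).1.symm
  · filter_upwards [hX, mcncFun_congr X.slice_zero] with q h1 h2
    rw [← h2]; exact (forms_slice h1).2.1.symm

/-- Since ψ is the identity at t = 0, the jacobian factor is 1 at the origin. Where δ and H vanish,
moving the parameters with velocity w adds dδ(w) and dH(w) to the two t-derivatives; these cancel in
the splitting because dH = l dδ. -/
theorem splitting_eq_of_sameFamily {x : LocalParam} {X Y : Deformation x} (h : SameFamily X Y)
    (h0 : ldFun x.toFun 0 = 0) (hH : mcncFun x.toFun 0 = 0) {l : ℝ}
    (hl : ∀ e, fderiv ℝ (mcncFun x.toFun) 0 e = l * fderiv ℝ (ldFun x.toFun) 0 e) :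
    splitting l Y.toFun = splitting l X.toFun := by
  obtain ⟨ψ, hψ, ψ0, hY⟩ := h
  have hc : Tendsto (fun q : Plane => ((0 : ℝ), q)) (𝓝 0) (𝓝 0) :=
    (by fun_prop : Continuous fun q : Plane => ((0 : ℝ), q)).tendsto' 0 0 rfl
  have hψt : Tendsto (fun q => ψ (0, q)) (𝓝 0) (𝓝 0) := (hψ.tendsto_zero ψ0).comp hc
  have hid : (fun q => ψ (0, q)) =ᶠ[𝓝 0] id := by
    obtain ⟨g, hg⟩ := x.eventually_left_inverse
    filter_upwards [hc.eventually hY, Y.at_zero, hψt.eventually X.at_zero, hg, hψt.eventually hg]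
      with q h1 h2 h3 h4 h5
    rw [h2, h3] at h1
    rw [← h5, ← h1, h4]; rfl
  have hψ0e : ∀ e : Plane, dirD (0, e) ψ 0 = e := by
    intro e
    rw [← dirD_slice (z := 0) hψ.differentiableAt e]
    have := (dirD_congr hid e).eq_of_nhds
    refine Eq.trans this ?_
    simp [dirD]
  let Ψ : ℝ × Plane → ℝ × Plane := fun z => (z.1, ψ z)
  have hΨ0 : Ψ 0 = 0 := by simp [Ψ, ψ0]
  have sΨ : ∀ {z}, ContDiffAt ℝ ∞ ψ z → ContDiffAt ℝ ∞ Ψ z := fun h => contDiffAt_fst.prodMk h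
  have hΨ : SmoothNear Ψ 0 := hψ.mono fun _ h => sΨ h
  have hΨd : ∀ {z a}, DifferentiableAt ℝ ψ z → dirD a Ψ z = (a.1, dirD a ψ z) := by
    intro z a hz
    have : fderiv ℝ Ψ z = _ := (hasFDerivAt_fst.prodMk hz.hasFDerivAt).fderiv
    rw [dirD, this]; rfl
  let a : ℝ × Plane := (0, 1, 0)
  let b : ℝ × Plane := (0, 0, 1)
  let p := fun z => (dirD a ψ z).1
  let q := fun z => (dirD a ψ z).2
  let r := fun z => (dirD b ψ z).1
  let s := fun z => (dirD b ψ z).2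
  let J := fun z => p z * s z - q z * r z
  have hp : SmoothNear p 0 := (hψ.dirD a).fst
  have hq : SmoothNear q 0 := (hψ.dirD a).snd
  have hr : SmoothNear r 0 := (hψ.dirD b).fst
  have hs : SmoothNear s 0 := (hψ.dirD b).snd
  have hJ : DifferentiableAt ℝ J 0 := ((hp.mul hs).sub (hq.mul hr)).differentiableAt
  have hJ0 : J 0 = 1 := by
    simp only [J, p, q, r, s, a, b, hψ0e]; norm_num
  have dec : ∀ (u v : ℝ), ((0 : ℝ), u, v) = u • a + v • b := by
    intro u v; simp [a, b]
  have forms : ∀ᶠ z in 𝓝 (0 : ℝ × Plane),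
      gLd a b Y.toFun z = J z ^ 2 * gLd a b X.toFun (Ψ z) ∧
      gMc a b Y.toFun z = J z ^ 3 * gMc a b X.toFun (Ψ z) := by
    have e : Y.toFun =ᶠ[𝓝 0] fun z => X.toFun (Ψ z) := hY
    filter_upwards [(hΨ.tendsto_zero hΨ0).eventually (eventually_eventually_nhds.2 X.smooth),
      eventually_eventually_nhds.2 hΨ, eventually_eventually_nhds.2 hψ,
      hp.eventually_differentiableAt, hq.eventually_differentiableAt,
      hr.eventually_differentiableAt, hs.eventually_differentiableAt, gLd_congr e a b,
      gMc_congr e a b] with z h1 h2 h3 h4 h5 h6 h7 h8 h9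
    have h3' : ∀ᶠ y in 𝓝 z, DifferentiableAt ℝ ψ y := SmoothNear.eventually_differentiableAt h3
    have := forms_reparam (a := a) (b := b) (a' := a) (b' := b) h1 h2 h4 h5 h6 h7
      (h3'.mono fun y hy => by rw [hΨd hy, ← dec])
      (h3'.mono fun y hy => by rw [hΨd hy, ← dec])
    rw [h8, h9]
    exact ⟨this.1, this.2.1⟩
  let w := dirD (1, 0) ψ 0
  -- The exponent n is irrelevant: f vanishes at the origin, so only the value J(0) = 1 of the
  -- factor enters.
  have hderiv : ∀ {f : ℝ × Plane → ℝ} {φ : Plane → ℝ} {g : ℝ × Plane → ℝ} (n : ℕ),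
      SmoothNear f 0 → (fun q => f (0, q)) =ᶠ[𝓝 0] φ → φ 0 = 0 →
      g =ᶠ[𝓝 0] (fun z => J z ^ n * f (Ψ z)) →
      dirD (1, 0) g 0 = dirD (1, 0) f 0 + dirD w φ 0 := by
    intro f φ g n hf hφ hφ0 hg
    have hf0 : f 0 = 0 := hφ.eq_of_nhds.trans hφ0
    have h1 : dirD (1, 0) (fun z => f (Ψ z)) 0 =
        (1 : ℝ) • dirD (1, 0) f (Ψ 0) + (1 : ℝ) • dirD (0, w) f (Ψ 0) := by
      refine dirD_comp (by rw [hΨ0]; exact hf.differentiableAt) hΨ.differentiableAt _ ?_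
      rw [hΨd hψ.differentiableAt]
      simp [w]
    rw [hΨ0, one_smul, one_smul] at h1
    have h2 : DifferentiableAt ℝ (fun z => f (Ψ z)) 0 := (hf.comp_zero hΨ hΨ0).differentiableAt
    rw [(dirD_congr hg _).eq_of_nhds, dirD,
      fderiv_mul_of_eq_zero (hJ.fun_pow n) h2 (by rw [hΨ0, hf0]), hJ0, one_pow, one_mul]
    rw [dirD] at h1
    rw [h1, ← (dirD_congr hφ w).eq_of_nhds,
      ← dirD_slice (z := (0 : ℝ × Plane)) hf.differentiableAt w]
    rfl
  rw [splitting, splitting,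
    hderiv 3 (X.smooth.gMc a b) X.forms_zero.2 hH (forms.mono fun z h => h.2),
    hderiv 2 (X.smooth.gLd a b) X.forms_zero.1 h0 (forms.mono fun z h => h.1)]
  have : dirD w (mcncFun x.toFun) 0 = l * dirD w (ldFun x.toFun) 0 := hl w
  rw [this]; ring

/-! ### From the family to the germ at t = 0. -/

theorem exists_forall_mem_box (A : Plane ≃L[ℝ] Plane) {P : Plane → Prop} (h : ∀ᶠ q in 𝓝 0, P q) :
    ∃ κ > 0, ∀ r ρ, r < κ → ρ < κ → ∀ q ∈ box A r ρ, P q := by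
  have hA : Tendsto (fun z : ℝ × Plane => A z.2) (𝓝 0) (𝓝 0) :=
    (A.continuous.comp continuous_snd).tendsto' 0 0 (by simp)
  obtain ⟨κ, hκ, hb⟩ := exists_box_of_eventually (hA.eventually h)
  refine ⟨κ, hκ, ?_⟩
  rintro r ρ hr hρ q ⟨X, Y, hX, hY, rfl⟩
  exact hb 0 X Y (by simpa using hκ.le) (by linarith) (by linarith)

theorem LocalPicture.congr {x y : Plane → R31} {A : Plane ≃L[ℝ] Plane} {r ρ : ℝ} {α β η : ℝ → ℝ}
    (h : LocalPicture x A r ρ α β η) (e : ∀ q ∈ box A r ρ, x =ᶠ[𝓝 q] y) :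
    LocalPicture y A r ρ α β η := by
  have hm : ∀ X Y, |X| < r → |Y| < ρ → A (X, Y) ∈ box A r ρ := fun X Y h1 h2 => ⟨X, Y, h1, h2, rfl⟩
  refine ⟨fun q hq => ?_, fun q hq => ?_, fun q hq => ?_, h.smooth_ld, h.smooth_lpl, h.smooth_mcnc,
    h.mem_box, fun X Y h1 h2 => ?_, fun X Y h1 h2 => ?_, fun X Y h1 h2 => ?_, fun X Y h1 h2 => ?_,
    h.order_pos, h.order_neg, h.order_zero⟩
  · rw [← (ldFun_congr (e q hq)).fderiv_eq]; exact h.ld_regular q hq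
  · rw [← (lplFun_congr (e q hq)).fderiv_eq]; exact h.lpl_regular q hq
  · rw [← (mcncFun_congr (e q hq)).fderiv_eq]; exact h.mcnc_regular q hq
  · rw [← h.ld_iff X Y h1 h2]
    simp only [LD, mem_ofPred_eq, (ldFun_congr (e _ (hm X Y h1 h2))).eq_of_nhds]
  · rw [← h.lpl_iff X Y h1 h2]
    simp only [LPL, mem_ofPred_eq, (lplFun_congr (e _ (hm X Y h1 h2))).eq_of_nhds]
  · rw [← h.mcnc_iff X Y h1 h2]
    simp only [MCNC, mem_ofPred_eq, (mcncFun_congr (e _ (hm X Y h1 h2))).eq_of_nhds]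
  · rw [← h.lorentzian_iff X Y h1 h2, (ldFun_congr (e _ (hm X Y h1 h2))).eq_of_nhds]

theorem Bifurcates.configuration {x : LocalParam} {X : Deformation x} {s σ : ℝ}
    (h : Bifurcates X s σ) : Configuration x.toFun s := by
  obtain ⟨A, hA⟩ := h
  refine ⟨A, fun κ hκ => ?_⟩
  -- The slice at t = 0 agrees with x only near the origin, so the boxes must also be small enough
  -- for that.
  obtain ⟨κ', hκ', hb⟩ := exists_forall_mem_box A (eventually_eventually_nhds.2 X.slice_zero)
  obtain ⟨r, ρ, ε, hr, hrκ, hρ, hρκ, hε, -, α, β, η, -, -, -, hp, h0, -, -⟩ :=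
    hA (min κ κ') (lt_min hκ hκ')
  obtain ⟨h1, h2, h3, h4⟩ := h0
  refine ⟨r, ρ, hr, hrκ.trans_le (min_le_left _ _), hρ, hρκ.trans_le (min_le_left _ _),
    α 0, β 0, η 0, ?_, h1, h2, h3, h4⟩
  exact (hp 0 (by simpa using hε)).congr
    (hb r ρ (hrκ.trans_le (min_le_right _ _)) (hρκ.trans_le (min_le_right _ _)))

/-- The constant family. -/
def Deformation.const (x : LocalParam) : Deformation x where
  toFun := fun z => x.toFun z.2
  smooth := by
    have h2 : SmoothNear (fun z : ℝ × Plane => z.2) 0 := .of_forall fun _ => contDiffAt_snd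
    exact x.smooth.comp_zero h2 rfl
  at_zero := .of_forall fun _ => rfl

/-- The fold condition passes to every parametrisation of the germ. The generic families are those
with nonzero splitting, and any one of them already exhibits the configuration at t = 0. -/
theorem contactBifurcation_of_fold {s : ℝ} (hs : s = 1 ∨ s = -1) {x : LocalParam}
    (hfold : FoldContact s (ldFun x.toFun) (mcncFun x.toFun)) :
    ContactBifurcation s (Quotient.mk paramSetoid x) := by
  intro y hy
  obtain ⟨h, k, hi, hyx⟩ : x ≈ y := Quotient.exact hy.symm
  have hf := hfold.of_reparam hi hyx
  have sφ := y.smooth.ldFun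
  have sψ := y.smooth.mcncFun
  obtain ⟨h0, hd, hH, l, hl, -⟩ := (foldContact_iff sφ sψ).1 hf
  have hκ : kapFun y.toFun 0 < 0 := hf.degenerateContact.kapFun_neg
  have hb : ∀ X : Deformation y, splitting l X.toFun ≠ 0 →
      ∃ σ : ℝ, (σ = 1 ∨ σ = -1) ∧ Bifurcates X s σ :=
    fun X hX => bifurcates_of_fold X hs hf hκ hl hX
  have hden := dense_splitting_ne_zero y hd l
  refine ⟨hf.contactOrder_sq_eq_four sφ sψ (lplFun_eq_sq _ _), hf.contactOrder_eq_two sφ sψ, ?_, ?_⟩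
  · have : Nonempty (Deformation y) := ⟨.const y⟩
    obtain ⟨X, hX⟩ := hden.nonempty
    obtain ⟨σ, -, hσ⟩ := hb X hX
    exact hσ.configuration
  · refine ⟨{X | splitting l X.toFun ≠ 0}, isOpen_ne.preimage (continuous_splitting y l), hden,
      fun X hX Y hXY => ?_, hb⟩
    change splitting l Y.toFun ≠ 0
    rw [splitting_eq_of_sameFamily hXY h0 hH hl]
    exact hX

/-! Perturbation of degenerate contacts to contacts of order four. -/

section Axes

variable {f g : Plane → ℝ}

theorem fderiv_fst_eq_deriv (hf : DifferentiableAt ℝ f 0) :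
    fderiv ℝ f 0 (1, 0) = deriv (fun u => f (u, 0)) 0 := by
  rw [← hf.lineDeriv_eq_fderiv, lineDeriv]
  congr 1
  funext t
  simp

theorem fderiv_snd_eq_deriv (hf : DifferentiableAt ℝ f 0) :
    fderiv ℝ f 0 (0, 1) = deriv (fun v => f (0, v)) 0 := by
  rw [← hf.lineDeriv_eq_fderiv, lineDeriv]
  congr 1
  funext t
  simp

theorem fderiv_fderiv_fst_eq_deriv (hf : SmoothNear f 0) :
    fderiv ℝ (fderiv ℝ f) 0 (1, 0) (1, 0) = deriv (deriv fun u => f (u, 0)) 0 := by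
  let γ : ℝ → Plane := fun u => (u, 0)
  have h : ∀ u, HasDerivAt γ (1, 0) u := fun u => (hasDerivAt_id u).prodMk (hasDerivAt_const u 0)
  have h1 : deriv γ = fun _ => (1, 0) := funext fun u => (h u).deriv
  have hγ : SmoothNear γ 0 := smoothNear_of_contDiff (by fun_prop) 0
  have := iteratedDeriv_two_comp_curve (g := f) (γ := γ) (a := 0) hγ hf
  rw [h1, deriv_const, map_zero, add_zero, iteratedDeriv_succ, iteratedDeriv_one] at this
  exact this.symm

theorem fderiv_snd_of_eq_add (hf : DifferentiableAt ℝ f 0) (hg : DifferentiableAt ℝ g 0) {B : ℝ → ℝ}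
    (hB : DifferentiableAt ℝ B 0) (h : ∀ᶠ v in 𝓝 (0 : ℝ), g (0, v) = f (0, v) + v * B v) :
    fderiv ℝ g 0 (0, 1) = fderiv ℝ f 0 (0, 1) + B 0 := by
  have hl : DifferentiableAt ℝ (fun t : ℝ => ((0 : ℝ), t)) 0 := by fun_prop
  have d : DifferentiableAt ℝ (fun t : ℝ => f (0, t)) 0 :=
    DifferentiableAt.comp (g := f) (0 : ℝ) hf hl
  rw [fderiv_snd_eq_deriv hf, fderiv_snd_eq_deriv hg, EventuallyEq.deriv_eq h]
  refine ((d.hasDerivAt.add ((hasDerivAt_id (0 : ℝ)).mul hB.hasDerivAt)).deriv).trans ?_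
  simp

theorem fderiv_fst_of_eq_add (hf : DifferentiableAt ℝ f 0) (hg : DifferentiableAt ℝ g 0) {B : ℝ → ℝ}
    (hB : DifferentiableAt ℝ B 0) (h : ∀ᶠ u in 𝓝 (0 : ℝ), g (u, 0) = f (u, 0) + u * B u) :
    fderiv ℝ g 0 (1, 0) = fderiv ℝ f 0 (1, 0) + B 0 := by
  have hl : DifferentiableAt ℝ (fun t : ℝ => (t, (0 : ℝ))) 0 := by fun_prop
  have d : DifferentiableAt ℝ (fun t : ℝ => f (t, 0)) 0 :=
    DifferentiableAt.comp (g := f) (0 : ℝ) hf hl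
  rw [fderiv_fst_eq_deriv hf, fderiv_fst_eq_deriv hg, EventuallyEq.deriv_eq h]
  refine ((d.hasDerivAt.add ((hasDerivAt_id (0 : ℝ)).mul hB.hasDerivAt)).deriv).trans ?_
  simp

/-- With its first-order companions, this compares jets of two functions from an explicit difference
on an axis: only the factor left after dividing by a power of the variable is evaluated. -/
theorem fderiv_fderiv_fst_of_eq_add (hf : SmoothNear f 0) (hg : SmoothNear g 0) {B : ℝ → ℝ}
    (hB : ContDiffAt ℝ 2 B 0) (h : ∀ᶠ u in 𝓝 (0 : ℝ), g (u, 0) = f (u, 0) + u ^ 2 * B u) :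
    fderiv ℝ (fderiv ℝ g) 0 (1, 0) (1, 0) = fderiv ℝ (fderiv ℝ f) 0 (1, 0) (1, 0) + 2 * B 0 := by
  have hγ : SmoothNear (fun u : ℝ => (u, (0 : ℝ))) 0 := smoothNear_of_contDiff (by fun_prop) 0
  have sf : SmoothNear (fun u : ℝ => f (u, 0)) 0 := hf.comp_zero hγ rfl
  rw [fderiv_fderiv_fst_eq_deriv hf, fderiv_fderiv_fst_eq_deriv hg,
    (EventuallyEq.deriv h).deriv_eq]
  have e : deriv (fun u => f (u, 0) + u ^ 2 * B u) =ᶠ[𝓝 0]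
      fun u => deriv (fun u => f (u, 0)) u + u * (2 * B u + u * deriv B u) := by
    filter_upwards [sf.eventually_differentiableAt, hB.eventually (by decide)] with u h1 h2
    have h3 := h2.differentiableAt (by decide)
    have h4 := h1.hasDerivAt.add (((hasDerivAt_id u).fun_pow 2).mul h3.hasDerivAt)
    refine h4.deriv.trans ?_
    simp; ring
  have hB1 : DifferentiableAt ℝ B 0 := hB.differentiableAt (by decide)
  have hB2 : DifferentiableAt ℝ (deriv B) 0 := by
    have h1 : ContDiffAt ℝ 1 (fderiv ℝ B) 0 := hB.fderiv_right (by norm_num)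
    have h2 : DifferentiableAt ℝ (fun u => fderiv ℝ B u 1) 0 :=
      (h1.clm_apply contDiffAt_const).differentiableAt (by decide)
    exact h2
  have hC : DifferentiableAt ℝ (fun u => 2 * B u + u * deriv B u) 0 := by fun_prop
  rw [e.deriv_eq]
  refine ((sf.deriv.differentiableAt.hasDerivAt.add
    ((hasDerivAt_id (0 : ℝ)).mul hC.hasDerivAt)).deriv).trans ?_
  simp

end Axes

/-! Smoothness of algebraic expressions in the Lorentzian product. -/

section

variable {E : Type*} [NormedAddCommGroup E] [NormedSpace ℝ E] {n : WithTop ℕ∞} {X Y : E → R31} {a : E}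

@[fun_prop]
theorem contDiffAt_mink (hX : ContDiffAt ℝ n X a) (hY : ContDiffAt ℝ n Y a) :
    ContDiffAt ℝ n (fun z => mink (X z) (Y z)) a := by
  rw [contDiffAt_pi] at hX hY
  unfold mink
  exact (((hX 0).mul (hY 0)).add ((hX 1).mul (hY 1))).sub ((hX 2).mul (hY 2))

@[fun_prop]
theorem contDiffAt_mcross (hX : ContDiffAt ℝ n X a) (hY : ContDiffAt ℝ n Y a) :
    ContDiffAt ℝ n (fun z => mcross (X z) (Y z)) a := by
  rw [contDiffAt_pi] at hX hY ⊢
  intro i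
  fin_cases i
  · exact ((hX 1).mul (hY 2)).sub ((hX 2).mul (hY 1))
  · exact ((hX 2).mul (hY 0)).sub ((hX 0).mul (hY 2))
  · exact (((hX 0).mul (hY 1)).sub ((hX 1).mul (hY 0))).neg

end

/-! Forms of a surface moved in the direction `N`. -/

/-- With the coefficient of `N` factored out of the change, its order of vanishing along an axis is
visible. -/
theorem ldForm_push_left (P Q N : R31) (α : ℝ) : ldForm (P + α • N) Q = ldForm P Q +
    α * (2 * mink P Q * mink N Q + α * mink N Q ^ 2
      - (2 * mink P N + α * mink N N) * mink Q Q) := by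
  simp [ldForm, mink]; ring

theorem ldForm_push_right (P Q N : R31) (β : ℝ) : ldForm P (Q + β • N) = ldForm P Q +
    β * (2 * mink P Q * mink P N + β * mink P N ^ 2
      - (2 * mink Q N + β * mink N N) * mink P P) := by
  simp [ldForm, mink]; ring

theorem mcForm_push_left (P Q R S T N : R31) (α ρ : ℝ) :
    mcForm (P + α • N) Q (R + ρ • N) S T = mcForm P Q R S T
      + ρ * (mink (mcross P Q) N * mink Q Q)
      + α * (mink (mcross N Q) R * mink Q Q - 2 * mink (mcross N Q) S * (mink P Q + α * mink N Q)
        - 2 * mink (mcross P Q) S * mink N Q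
        + mink (mcross N Q) T * (mink P P + 2 * α * mink P N + α ^ 2 * mink N N)
        + mink (mcross P Q) T * (2 * mink P N + α * mink N N)) := by
  simp [mcForm, mink, mcross]; ring

theorem mcForm_push_right (P Q R S T N : R31) (β σ : ℝ) :
    mcForm P (Q + β • N) R (S + σ • N) T = mcForm P Q R S T
      - 2 * σ * (mink (mcross P Q) N * (mink P Q + β * mink P N))
      + β * (mink (mcross P N) T * mink P P - 2 * mink (mcross P N) S * (mink P Q + β * mink P N)
        - 2 * mink (mcross P Q) S * mink P N
        + mink (mcross P N) R * (mink Q Q + 2 * β * mink Q N + β ^ 2 * mink N N)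
        + mink (mcross P Q) R * (2 * mink Q N + β * mink N N)) := by
  simp [mcForm, mink, mcross]; ring

/-- On the v-axis its gradient vanishes and its uu-derivative is 2εv, so it changes the v-derivative
of H. On the u-axis its gradient is of order u², too small to change dδ. -/
def cubicBump (ε : ℝ) (z : Plane) : ℝ := ε * (z.1 ^ 2 * z.2)

/-- On the u-axis its uu-derivative 12εu² changes the second derivative of H, while its gradient
4εu³ leaves the 2-jet of δ along the axis alone. -/
def quarticBump (ε : ℝ) (z : Plane) : ℝ := ε * z.1 ^ 4

theorem contDiff_cubicBump (ε : ℝ) : ContDiff ℝ ∞ (cubicBump ε) := by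
  unfold cubicBump; fun_prop

theorem contDiff_quarticBump (ε : ℝ) : ContDiff ℝ ∞ (quarticBump ε) := by
  unfold quarticBump; fun_prop

theorem dirD_cubicBump (ε : ℝ) (a : Plane) :
    dirD a (cubicBump ε) = fun z => ε * (2 * z.1 * z.2 * a.1 + z.1 ^ 2 * a.2) := by
  funext z
  refine dirD_of_expansion (c₀ := cubicBump ε z) (c₂ := ε * (a.1 ^ 2 * z.2 + 2 * z.1 * a.1 * a.2))
    (c₃ := ε * (a.1 ^ 2 * a.2)) (c₄ := 0)
    ((contDiff_cubicBump ε).differentiable (by simp) z) fun s => ?_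
  simp [cubicBump]; ring

theorem dirD_dirD_cubicBump (ε : ℝ) (a b z : Plane) : dirD b (dirD a (cubicBump ε)) z =
    ε * (2 * z.2 * a.1 * b.1 + 2 * z.1 * (a.1 * b.2 + a.2 * b.1)) := by
  rw [dirD_cubicBump]
  refine dirD_of_expansion (c₀ := ε * (2 * z.1 * z.2 * a.1 + z.1 ^ 2 * a.2))
    (c₂ := ε * (2 * b.1 * b.2 * a.1 + b.1 ^ 2 * a.2)) (c₃ := 0) (c₄ := 0)
    (by fun_prop) fun s => ?_
  simp; ring

theorem dirD_quarticBump (ε : ℝ) (a : Plane) :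
    dirD a (quarticBump ε) = fun z => ε * (4 * z.1 ^ 3 * a.1) := by
  funext z
  refine dirD_of_expansion (c₀ := quarticBump ε z) (c₂ := ε * (6 * z.1 ^ 2 * a.1 ^ 2))
    (c₃ := ε * (4 * z.1 * a.1 ^ 3)) (c₄ := ε * a.1 ^ 4)
    ((contDiff_quarticBump ε).differentiable (by simp) z) fun s => ?_
  simp [quarticBump]; ring

theorem dirD_dirD_quarticBump (ε : ℝ) (a b z : Plane) : dirD b (dirD a (quarticBump ε)) z =
    ε * (12 * z.1 ^ 2 * a.1 * b.1) := by
  rw [dirD_quarticBump]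
  refine dirD_of_expansion (c₀ := ε * (4 * z.1 ^ 3 * a.1))
    (c₂ := ε * (12 * z.1 * b.1 ^ 2 * a.1)) (c₃ := ε * (4 * b.1 ^ 3 * a.1)) (c₄ := 0)
    (by fun_prop) fun s => ?_
  simp; ring

section Bumps

variable {x : Plane → R31}

theorem SmoothNear.eventually_axes (hx : SmoothNear x 0) :
    (∀ᶠ u in 𝓝 (0 : ℝ), SmoothNear x (u, 0)) ∧ ∀ᶠ v in 𝓝 (0 : ℝ), SmoothNear x (0, v) := by
  have c1 : ContinuousAt (fun t : ℝ => (t, (0 : ℝ))) 0 := by fun_prop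
  have c2 : ContinuousAt (fun t : ℝ => ((0 : ℝ), t)) 0 := by fun_prop
  exact ⟨c1.eventually (eventually_eventually_nhds.2 hx),
    c2.eventually (eventually_eventually_nhds.2 hx)⟩

theorem contDiffAt_dirD_axes (hx : SmoothNear x 0) (a : Plane) :
    ContDiffAt ℝ 2 (fun u : ℝ => dirD a x (u, 0)) 0 ∧ ContDiffAt ℝ 2 (fun v : ℝ => dirD a x (0, v)) 0 := by
  have h : ContDiffAt ℝ 2 (dirD a x) 0 := (hx.dirD a).contDiffAt.of_le ENat.LEInfty.out
  exact ⟨ContDiffAt.comp (g := dirD a x) (0 : ℝ) h (by fun_prop),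
    ContDiffAt.comp (g := dirD a x) (0 : ℝ) h (by fun_prop)⟩

/-- The effect of a cubic perturbation. -/
theorem forms_cubicBump (hx : SmoothNear x 0) (N : R31) (ε : ℝ) :
    fderiv ℝ (ldFun (push x (cubicBump ε) N)) 0 (1, 0) = fderiv ℝ (ldFun x) 0 (1, 0) ∧
    fderiv ℝ (ldFun (push x (cubicBump ε) N)) 0 (0, 1) = fderiv ℝ (ldFun x) 0 (0, 1) ∧
    fderiv ℝ (mcncFun (push x (cubicBump ε) N)) 0 (1, 0) = fderiv ℝ (mcncFun x) 0 (1, 0)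
      - 4 * ε * (mink (mcross (du x 0) (dv x 0)) N * mink (du x 0) (dv x 0)) ∧
    fderiv ℝ (mcncFun (push x (cubicBump ε) N)) 0 (0, 1) = fderiv ℝ (mcncFun x) 0 (0, 1)
      + 2 * ε * (mink (mcross (du x 0) (dv x 0)) N * mink (dv x 0) (dv x 0)) := by
  have hp : ∀ z, SmoothNear (cubicBump ε) z := smoothNear_of_contDiff (contDiff_cubicBump ε)
  have hy := hx.push (hp 0) N
  have ha : ∀ a, ContDiffAt ℝ 2 (fun u : ℝ => dirD a x (u, 0)) 0 := fun a => (contDiffAt_dirD_axes hx a).1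
  have hb : ∀ a, ContDiffAt ℝ 2 (fun v : ℝ => dirD a x (0, v)) 0 := fun a => (contDiffAt_dirD_axes hx a).2
  have hda : ∀ a b, ContDiffAt ℝ 2 (fun u : ℝ => dirD a (dirD b x) (u, 0)) 0 :=
    fun a b => (contDiffAt_dirD_axes (hx.dirD b) a).1
  have A1 := ha (1, 0)
  have A2 := ha (0, 1)
  have B1 := hb (1, 0)
  have B2 := hb (0, 1)
  have A11 := hda (1, 0) (1, 0)
  have A12 := hda (0, 1) (1, 0)
  have A22 := hda (0, 1) (0, 1)
  refine ⟨?_, ?_, ?_, ?_⟩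
  · rw [fderiv_fst_of_eq_add hx.ldFun.differentiableAt hy.ldFun.differentiableAt (B := fun u =>
      ε * u * (2 * mink (dirD (1, 0) x (u, 0)) (dirD (0, 1) x (u, 0)) * mink (dirD (1, 0) x (u, 0)) N
        + ε * u ^ 2 * mink (dirD (1, 0) x (u, 0)) N ^ 2
        - (2 * mink (dirD (0, 1) x (u, 0)) N + ε * u ^ 2 * mink N N)
          * mink (dirD (1, 0) x (u, 0)) (dirD (1, 0) x (u, 0))))]
    · simp
    · refine ContDiffAt.differentiableAt (n := 2) ?_ (by decide)
      fun_prop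
    · filter_upwards [hx.eventually_axes.1] with u hu
      rw [ldFun_eq, gLd_push hu (hp _), dirD_cubicBump, dirD_cubicBump]
      simp only [mul_zero, mul_one, add_zero, zero_add, zero_smul, ldForm_push_right, ldFun_eq, gLd]
      ring
  · rw [fderiv_snd_of_eq_add hx.ldFun.differentiableAt hy.ldFun.differentiableAt (B := fun v => 0)]
    · simp
    · fun_prop
    · filter_upwards [hx.eventually_axes.2] with v hv
      rw [ldFun_eq, gLd_push hv (hp _), dirD_cubicBump, dirD_cubicBump]
      simp [ldFun_eq, gLd]
  · rw [fderiv_fst_of_eq_add hx.mcncFun.differentiableAt hy.mcncFun.differentiableAt (B := fun u =>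
      -(4 * ε) * (mink (mcross (dirD (1, 0) x (u, 0)) (dirD (0, 1) x (u, 0))) N
        * (mink (dirD (1, 0) x (u, 0)) (dirD (0, 1) x (u, 0)) + ε * u ^ 2 * mink (dirD (1, 0) x (u, 0)) N))
      + ε * u * (mink (mcross (dirD (1, 0) x (u, 0)) N) (dirD (0, 1) (dirD (0, 1) x) (u, 0))
          * mink (dirD (1, 0) x (u, 0)) (dirD (1, 0) x (u, 0))
        - 2 * mink (mcross (dirD (1, 0) x (u, 0)) N) (dirD (0, 1) (dirD (1, 0) x) (u, 0))
          * (mink (dirD (1, 0) x (u, 0)) (dirD (0, 1) x (u, 0)) + ε * u ^ 2 * mink (dirD (1, 0) x (u, 0)) N)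
        - 2 * mink (mcross (dirD (1, 0) x (u, 0)) (dirD (0, 1) x (u, 0))) (dirD (0, 1) (dirD (1, 0) x) (u, 0))
          * mink (dirD (1, 0) x (u, 0)) N
        + mink (mcross (dirD (1, 0) x (u, 0)) N) (dirD (1, 0) (dirD (1, 0) x) (u, 0))
          * (mink (dirD (0, 1) x (u, 0)) (dirD (0, 1) x (u, 0))
            + 2 * (ε * u ^ 2) * mink (dirD (0, 1) x (u, 0)) N + (ε * u ^ 2) ^ 2 * mink N N)
        + mink (mcross (dirD (1, 0) x (u, 0)) (dirD (0, 1) x (u, 0))) (dirD (1, 0) (dirD (1, 0) x) (u, 0))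
          * (2 * mink (dirD (0, 1) x (u, 0)) N + ε * u ^ 2 * mink N N)))]
    · simp [du, dv, dirD, Prod.mk_zero_zero]; ring
    · refine ContDiffAt.differentiableAt (n := 2) ?_ (by decide)
      fun_prop
    · filter_upwards [hx.eventually_axes.1] with u hu
      rw [mcncFun_eq, gMc_push hu (hp _), dirD_dirD_cubicBump, dirD_dirD_cubicBump,
        dirD_dirD_cubicBump, dirD_cubicBump, dirD_cubicBump]
      simp only [mul_zero, mul_one, add_zero, zero_add, zero_smul, mcForm_push_right,
        mcncFun_eq, gMc]
      ring
  · rw [fderiv_snd_of_eq_add hx.mcncFun.differentiableAt hy.mcncFun.differentiableAt (B := fun v =>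
      2 * ε * (mink (mcross (dirD (1, 0) x (0, v)) (dirD (0, 1) x (0, v))) N
        * mink (dirD (0, 1) x (0, v)) (dirD (0, 1) x (0, v))))]
    · simp [du, dv, dirD, Prod.mk_zero_zero]
    · refine ContDiffAt.differentiableAt (n := 2) ?_ (by decide)
      fun_prop
    · filter_upwards [hx.eventually_axes.2] with v hv
      rw [mcncFun_eq, gMc_push hv (hp _), dirD_dirD_cubicBump, dirD_dirD_cubicBump,
        dirD_dirD_cubicBump, dirD_cubicBump, dirD_cubicBump, mcForm_push]
      simp only [mul_zero, mul_one, zero_mul, add_zero, zero_smul, zero_pow two_ne_zero,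
        mcncFun_eq, gMc]
      ring

/-- The effect of a quartic perturbation. -/
theorem forms_quarticBump (hx : SmoothNear x 0) (N : R31) (ε : ℝ) :
    (fderiv ℝ (ldFun (push x (quarticBump ε) N)) 0 = fderiv ℝ (ldFun x) 0 ∧
    fderiv ℝ (mcncFun (push x (quarticBump ε) N)) 0 = fderiv ℝ (mcncFun x) 0) ∧
    fderiv ℝ (fderiv ℝ (ldFun (push x (quarticBump ε) N))) 0 (1, 0) (1, 0) =
      fderiv ℝ (fderiv ℝ (ldFun x)) 0 (1, 0) (1, 0) ∧
    fderiv ℝ (fderiv ℝ (mcncFun (push x (quarticBump ε) N))) 0 (1, 0) (1, 0) =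
      fderiv ℝ (fderiv ℝ (mcncFun x)) 0 (1, 0) (1, 0)
      + 24 * ε * (mink (mcross (du x 0) (dv x 0)) N * mink (dv x 0) (dv x 0)) := by
  have hp : ∀ z, SmoothNear (quarticBump ε) z := smoothNear_of_contDiff (contDiff_quarticBump ε)
  have hy := hx.push (hp 0) N
  have ha : ∀ a, ContDiffAt ℝ 2 (fun u : ℝ => dirD a x (u, 0)) 0 :=
    fun a => (contDiffAt_dirD_axes hx a).1
  have hda : ∀ a b, ContDiffAt ℝ 2 (fun u : ℝ => dirD a (dirD b x) (u, 0)) 0 :=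
    fun a b => (contDiffAt_dirD_axes (hx.dirD b) a).1
  have A1 := ha (1, 0)
  have A2 := ha (0, 1)
  have A11 := hda (1, 0) (1, 0)
  have A12 := hda (0, 1) (1, 0)
  have A22 := hda (0, 1) (0, 1)
  -- The change of δ on the u-axis is divisible by u³, so its quotient by u² still vanishes at 0.
  obtain ⟨BL, hBL0, hBL, eL⟩ : ∃ B : ℝ → ℝ, B 0 = 0 ∧ ContDiffAt ℝ 2 B 0 ∧ ∀ᶠ u in 𝓝 (0 : ℝ),
      ldFun (push x (quarticBump ε) N) (u, 0) = ldFun x (u, 0) + u ^ 2 * B u := by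
    refine ⟨fun u => 4 * ε * u *
      (2 * mink (dirD (1, 0) x (u, 0)) (dirD (0, 1) x (u, 0)) * mink N (dirD (0, 1) x (u, 0))
        + 4 * ε * u ^ 3 * mink N (dirD (0, 1) x (u, 0)) ^ 2
        - (2 * mink (dirD (1, 0) x (u, 0)) N + 4 * ε * u ^ 3 * mink N N)
          * mink (dirD (0, 1) x (u, 0)) (dirD (0, 1) x (u, 0))), by simp, by fun_prop, ?_⟩
    filter_upwards [hx.eventually_axes.1] with u hu
    rw [ldFun_eq, gLd_push hu (hp _), dirD_quarticBump, dirD_quarticBump]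
    simp only [mul_zero, mul_one, add_zero, zero_smul, ldForm_push_left, ldFun_eq, gLd]
    ring
  obtain ⟨BM, hBM0, hBM, eM⟩ : ∃ B : ℝ → ℝ,
      B 0 = 12 * ε * (mink (mcross (du x 0) (dv x 0)) N * mink (dv x 0) (dv x 0)) ∧
      ContDiffAt ℝ 2 B 0 ∧ ∀ᶠ u in 𝓝 (0 : ℝ),
      mcncFun (push x (quarticBump ε) N) (u, 0) = mcncFun x (u, 0) + u ^ 2 * B u := by
    refine ⟨fun u => 12 * ε * (mink (mcross (dirD (1, 0) x (u, 0)) (dirD (0, 1) x (u, 0))) N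
          * mink (dirD (0, 1) x (u, 0)) (dirD (0, 1) x (u, 0)))
      + 4 * ε * u * (mink (mcross N (dirD (0, 1) x (u, 0))) (dirD (1, 0) (dirD (1, 0) x) (u, 0))
          * mink (dirD (0, 1) x (u, 0)) (dirD (0, 1) x (u, 0))
        - 2 * mink (mcross N (dirD (0, 1) x (u, 0))) (dirD (0, 1) (dirD (1, 0) x) (u, 0))
          * (mink (dirD (1, 0) x (u, 0)) (dirD (0, 1) x (u, 0))
            + 4 * ε * u ^ 3 * mink N (dirD (0, 1) x (u, 0)))
        - 2 * mink (mcross (dirD (1, 0) x (u, 0)) (dirD (0, 1) x (u, 0)))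
          (dirD (0, 1) (dirD (1, 0) x) (u, 0)) * mink N (dirD (0, 1) x (u, 0))
        + mink (mcross N (dirD (0, 1) x (u, 0))) (dirD (0, 1) (dirD (0, 1) x) (u, 0))
          * (mink (dirD (1, 0) x (u, 0)) (dirD (1, 0) x (u, 0))
            + 2 * (4 * ε * u ^ 3) * mink (dirD (1, 0) x (u, 0)) N + (4 * ε * u ^ 3) ^ 2 * mink N N)
        + mink (mcross (dirD (1, 0) x (u, 0)) (dirD (0, 1) x (u, 0)))
          (dirD (0, 1) (dirD (0, 1) x) (u, 0))
          * (2 * mink (dirD (1, 0) x (u, 0)) N + 4 * ε * u ^ 3 * mink N N)), ?_, by fun_prop, ?_⟩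
    · simp [du, dv, dirD, Prod.mk_zero_zero]
    filter_upwards [hx.eventually_axes.1] with u hu
    rw [mcncFun_eq, gMc_push hu (hp _), dirD_dirD_quarticBump, dirD_dirD_quarticBump,
      dirD_dirD_quarticBump, dirD_quarticBump, dirD_quarticBump]
    simp only [mul_zero, mul_one, add_zero, zero_smul, mcForm_push_left, mcncFun_eq, gMc]
    ring
  have hv : ∀ᶠ v in 𝓝 (0 : ℝ), ldFun (push x (quarticBump ε) N) (0, v) = ldFun x (0, v) + v * 0 ∧
      mcncFun (push x (quarticBump ε) N) (0, v) = mcncFun x (0, v) + v * 0 := by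
    filter_upwards [hx.eventually_axes.2] with v hv
    rw [ldFun_eq, gLd_push hv (hp _), mcncFun_eq, gMc_push hv (hp _), dirD_dirD_quarticBump,
      dirD_dirD_quarticBump, dirD_dirD_quarticBump, dirD_quarticBump, dirD_quarticBump]
    simp [ldFun_eq, gLd, mcncFun_eq, gMc]
  have sL := hx.ldFun
  have sM := hx.mcncFun
  have pL := hy.ldFun
  have pM := hy.mcncFun
  refine ⟨⟨?_, ?_⟩, ?_, ?_⟩
  · refine ContinuousLinearMap.ext fun e => ?_
    rw [clm_plane_apply, clm_plane_apply (fderiv ℝ (ldFun x) 0),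
      fderiv_fst_of_eq_add sL.differentiableAt pL.differentiableAt (B := fun u => u * BL u)
        (differentiableAt_id.mul (hBL.differentiableAt (by decide)))
        (eL.mono fun u h => by rw [h]; ring),
      fderiv_snd_of_eq_add sL.differentiableAt pL.differentiableAt (B := fun _ => 0)
        (by fun_prop) (hv.mono fun v h => h.1)]
    simp
  · refine ContinuousLinearMap.ext fun e => ?_
    rw [clm_plane_apply, clm_plane_apply (fderiv ℝ (mcncFun x) 0),
      fderiv_fst_of_eq_add sM.differentiableAt pM.differentiableAt (B := fun u => u * BM u)
        (differentiableAt_id.mul (hBM.differentiableAt (by decide)))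
        (eM.mono fun u h => by rw [h]; ring),
      fderiv_snd_of_eq_add sM.differentiableAt pM.differentiableAt (B := fun _ => 0)
        (by fun_prop) (hv.mono fun v h => h.2)]
    simp
  · rw [fderiv_fderiv_fst_of_eq_add sL pL hBL eL, hBL0]; ring
  · rw [fderiv_fderiv_fst_of_eq_add sM pM hBM eM, hBM0]; ring

end Bumps

/-! Density of the contacts of order four. -/

theorem dirD_push_of_eq_zero {x : Plane → R31} (hx : SmoothNear x 0) {p : Plane → ℝ}
    (hp : SmoothNear p 0) (h0 : ∀ a, dirD a p 0 = 0) (N : R31) (a : Plane) :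
    dirD a (push x p N) 0 = dirD a x 0 := by
  rw [(dirD_push hx hp N a).eq_of_nhds, push, h0, zero_smul, add_zero]

/-- The parametrisation `x + p N`. -/
def LocalParam.push (x : LocalParam) (p : Plane → ℝ) (hp : SmoothNear p 0)
    (h0 : ∀ a, dirD a p 0 = 0) (N : R31) : LocalParam where
  toFun := MinkowskiSurface.push x.toFun p N
  smooth := x.smooth.push hp N
  immersion := by
    have : fderiv ℝ (MinkowskiSurface.push x.toFun p N) 0 = fderiv ℝ x.toFun 0 :=
      ContinuousLinearMap.ext fun a => dirD_push_of_eq_zero x.smooth hp h0 N a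
    rw [this]
    exact x.immersion

def LocalParam.cubic (x : LocalParam) (N : R31) (ε : ℝ) : LocalParam :=
  x.push (cubicBump ε) (smoothNear_of_contDiff (contDiff_cubicBump ε) 0)
    (fun a => by rw [dirD_cubicBump]; simp) N

def LocalParam.quartic (x : LocalParam) (N : R31) (ε : ℝ) : LocalParam :=
  x.push (quarticBump ε) (smoothNear_of_contDiff (contDiff_quarticBump ε) 0)
    (fun a => by rw [dirD_quarticBump]; simp) N

/-- The condition on a small perturbation `y ε` of `x` at `ε = 0` persists. -/
theorem exists_ne_zero_mem {x : LocalParam} {y : ℝ → LocalParam} (hy : Continuous y)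
    (h0 : y 0 = x) {U : Set LocalParam} (hU : IsOpen U) (hx : x ∈ U) : ∃ ε ≠ 0, y ε ∈ U := by
  have h1 : ∀ᶠ ε in 𝓝[≠] (0 : ℝ), y ε ∈ U :=
    (hy.tendsto 0).mono_left nhdsWithin_le_nhds (hU.mem_nhds (by rwa [h0]))
  obtain ⟨ε, h2, h3⟩ := (h1.and self_mem_nhdsWithin).exists
  exact ⟨ε, h3, h2⟩

theorem LocalParam.exists_cubic_mem (x : LocalParam) (N : R31) {U : Set LocalParam} (hU : IsOpen U)
    (hx : x ∈ U) : ∃ ε ≠ 0, x.cubic N ε ∈ U := by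
  refine exists_ne_zero_mem (x := x) (continuous_induced_rng.2 ?_) ?_ hU hx
  · exact continuous_jets_push (p := fun z => z.1 ^ 2 * z.2) x.smooth
      (smoothNear_of_contDiff (by fun_prop) 0) N
  · cases x
    simp only [LocalParam.cubic, LocalParam.push]
    congr 1
    funext z
    simp [MinkowskiSurface.push, cubicBump]

theorem LocalParam.exists_quartic_mem (x : LocalParam) (N : R31) {U : Set LocalParam}
    (hU : IsOpen U) (hx : x ∈ U) : ∃ ε ≠ 0, x.quartic N ε ∈ U := by
  refine exists_ne_zero_mem (x := x) (continuous_induced_rng.2 ?_) ?_ hU hx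
  · exact continuous_jets_push (p := fun z => z.1 ^ 4) x.smooth
      (smoothNear_of_contDiff (by fun_prop) 0) N
  · cases x
    simp only [LocalParam.quartic, LocalParam.push]
    congr 1
    funext z
    simp [MinkowskiSurface.push, quarticBump]

/-- A contact of which the 1-jets are in normal form. -/
theorem degenerateContact_of_axes {x : LocalParam} (hn : Normalized x)
    (hu : fderiv ℝ (ldFun x.toFun) 0 (1, 0) = 0) (hv : fderiv ℝ (ldFun x.toFun) 0 (0, 1) ≠ 0)
    (h0 : mcncFun x.toFun 0 = 0) (hm : fderiv ℝ (mcncFun x.toFun) 0 (1, 0) = 0) :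
    DegenerateContact x := by
  refine (degenerateContact_iff x).2 ⟨?_, fun h => hv (by rw [h]; rfl), h0,
    fderiv ℝ (mcncFun x.toFun) 0 (0, 1) / fderiv ℝ (ldFun x.toFun) 0 (0, 1), fun e => ?_⟩
  · obtain ⟨h1, h2⟩ := hn
    simp only [ldFun, coeffE, coeffF, h1, h2]
    ring
  · rw [clm_plane_apply _ e, clm_plane_apply (fderiv ℝ (ldFun x.toFun) 0) e, hu, hm]
    field_simp
    ring

theorem foldContact_of_axes {f g : Plane → ℝ} (sf : SmoothNear f 0) (sg : SmoothNear g 0)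
    (f0 : f 0 = 0) (g0 : g 0 = 0) (hu : fderiv ℝ f 0 (1, 0) = 0) (hm : fderiv ℝ g 0 (1, 0) = 0)
    (hv : fderiv ℝ f 0 (0, 1) ≠ 0) {l s : ℝ} (hl : fderiv ℝ g 0 (0, 1) = l * fderiv ℝ f 0 (0, 1))
    (hs : s * l * (fderiv ℝ (fderiv ℝ g) 0 (1, 0) (1, 0)
      - l * fderiv ℝ (fderiv ℝ f) 0 (1, 0) (1, 0)) < 0) : FoldContact s f g := by
  refine (foldContact_iff sf sg).2 ⟨f0, fun h => hv (by rw [h]; rfl), g0, l, fun e => ?_,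
    fun e he h => ?_⟩
  · rw [clm_plane_apply _ e, clm_plane_apply (fderiv ℝ f 0) e, hu, hm, hl]
    ring
  · rw [clm_plane_apply, hu] at h
    have h2 : e.2 = 0 := by simpa [hv] using h
    have h1 : e.1 ≠ 0 := fun h1 => he (Prod.ext h1 h2)
    have h3 : e = e.1 • ((1, 0) : Plane) := by ext <;> simp [h2]
    rw [h3]
    simp only [map_smul, _root_.smul_apply, smul_eq_mul]
    have := sq_pos_of_ne_zero h1
    nlinarith

/-- The contacts of order four are dense. -/
theorem exists_foldContact_mem {x : LocalParam} (hn : Normalized x) (hd : DegenerateContact x)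
    {U : Set LocalParam} (hU : IsOpen U) (hx : x ∈ U) : ∃ y ∈ U, ∃ s : ℝ, (s = 1 ∨ s = -1) ∧
      FoldContact s (ldFun y.toFun) (mcncFun y.toFun) := by
  -- The cubic perturbation achieves l ≠ 0. It adds a multiple of F to the u-derivative of H, which
  -- is zero in a normalised parametrisation, so the contact stays degenerate.
  have step : ∃ y ∈ U, Normalized y ∧ DegenerateContact y ∧
      fderiv ℝ (mcncFun y.toFun) 0 (0, 1) ≠ 0 := by
    by_cases h : fderiv ℝ (mcncFun x.toFun) 0 (0, 1) ≠ 0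
    · exact ⟨x, hx, hn, hd, h⟩
    rw [not_not] at h
    obtain ⟨N, hN⟩ := exists_transverse x
    obtain ⟨ε, hε, hy⟩ := x.exists_cubic_mem N hU hx
    obtain ⟨hG, hu, hv, -⟩ := hn.facts hd
    obtain ⟨-, -, hH, l, hl⟩ := (degenerateContact_iff x).1 hd
    obtain ⟨e1, e2, e3, e4⟩ := forms_cubicBump x.smooth N ε
    have ha : ∀ a, dirD a (x.cubic N ε).toFun 0 = dirD a x.toFun 0 := 
      dirD_push_of_eq_zero x.smooth (smoothNear_of_contDiff (contDiff_cubicBump ε) 0)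
        (fun a => by rw [dirD_cubicBump]; simp) N
    have hn' : Normalized (x.cubic N ε) := by
      obtain ⟨h1, h2⟩ := hn
      have k1 : du (x.cubic N ε).toFun 0 = du x.toFun 0 := ha _
      have k2 : dv (x.cubic N ε).toFun 0 = dv x.toFun 0 := ha _
      exact ⟨by rw [k1]; exact h1, by rw [k1, k2]; exact h2⟩
    have hH' : mcncFun (x.cubic N ε).toFun 0 = mcncFun x.toFun 0 := by
      refine (gMc_push x.smooth (smoothNear_of_contDiff (contDiff_cubicBump ε) 0) N _ _).trans ?_
      rw [dirD_dirD_cubicBump, dirD_dirD_cubicBump, dirD_dirD_cubicBump, dirD_cubicBump,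
        dirD_cubicBump]
      simp [mcncFun_eq, gMc]
    refine ⟨_, hy, hn', degenerateContact_of_axes hn' (e1.trans hu) (e2.trans_ne hv)
      (hH'.trans hH) (e3.trans ?_), e4.trans_ne ?_⟩
    · rw [hl, hu, hn.2]; ring
    · rw [h, zero_add]
      exact mul_ne_zero (mul_ne_zero two_ne_zero hε) (mul_ne_zero hN hG)
  clear hx hn hd
  obtain ⟨x, hx, hn, hd, hm⟩ := step
  obtain ⟨hG, hu, hv, -⟩ := hn.facts hd
  obtain ⟨h0, -, hH, l, hl⟩ := (degenerateContact_iff x).1 hd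
  have hl0 : l ≠ 0 := by
    rintro rfl
    exact hm (by rw [hl]; ring)
  -- The quartic perturbation keeps the values and differentials of δ and H at the origin, hence l,
  -- and makes the second derivative of H along the `LD` nonzero.
  obtain ⟨y, hy, h0', hH', hd1, hd2, hw⟩ : ∃ y ∈ U, ldFun y.toFun 0 = 0 ∧ mcncFun y.toFun 0 = 0 ∧
      fderiv ℝ (ldFun y.toFun) 0 = fderiv ℝ (ldFun x.toFun) 0 ∧
      fderiv ℝ (mcncFun y.toFun) 0 = fderiv ℝ (mcncFun x.toFun) 0 ∧
      fderiv ℝ (fderiv ℝ (mcncFun y.toFun)) 0 (1, 0) (1, 0)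
        - l * fderiv ℝ (fderiv ℝ (ldFun y.toFun)) 0 (1, 0) (1, 0) ≠ 0 := by
    by_cases h : fderiv ℝ (fderiv ℝ (mcncFun x.toFun)) 0 (1, 0) (1, 0)
        - l * fderiv ℝ (fderiv ℝ (ldFun x.toFun)) 0 (1, 0) (1, 0) ≠ 0
    · exact ⟨x, hx, h0, hH, rfl, rfl, h⟩
    rw [not_not] at h
    obtain ⟨N, hN⟩ := exists_transverse x
    obtain ⟨ε, hε, hy⟩ := x.exists_quartic_mem N hU hx
    obtain ⟨⟨e1, e2⟩, e3, e4⟩ := forms_quarticBump x.smooth N ε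
    have sb := smoothNear_of_contDiff (contDiff_quarticBump ε) 0
    refine ⟨_, hy, ((gLd_push x.smooth sb N _ _).trans ?_).trans h0,
      ((gMc_push x.smooth sb N _ _).trans ?_).trans hH,
      e1, e2, ?_⟩
    · rw [dirD_quarticBump, dirD_quarticBump]
      simp [ldFun_eq, gLd]
    · rw [dirD_dirD_quarticBump, dirD_dirD_quarticBump, dirD_dirD_quarticBump,
        dirD_quarticBump, dirD_quarticBump]
      simp [mcncFun_eq, gMc]
    · have : fderiv ℝ (fderiv ℝ (mcncFun (x.quartic N ε).toFun)) 0 (1, 0) (1, 0)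
          - l * fderiv ℝ (fderiv ℝ (ldFun (x.quartic N ε).toFun)) 0 (1, 0) (1, 0) =
          24 * ε * (mink (mcross (du x.toFun 0) (dv x.toFun 0)) N
            * mink (dv x.toFun 0) (dv x.toFun 0)) := by
        refine (congrArg₂ (fun a b => a - l * b) e4 e3).trans ?_
        linear_combination h
      rw [this]
      exact mul_ne_zero (mul_ne_zero (by norm_num) hε) (mul_ne_zero hN hG)
  have hfold : ∀ s : ℝ, s * l * (fderiv ℝ (fderiv ℝ (mcncFun y.toFun)) 0 (1, 0) (1, 0)
      - l * fderiv ℝ (fderiv ℝ (ldFun y.toFun)) 0 (1, 0) (1, 0)) < 0 →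
      FoldContact s (ldFun y.toFun) (mcncFun y.toFun) := fun s hs =>
    foldContact_of_axes y.smooth.ldFun y.smooth.mcncFun h0' hH' (by rw [hd1, hu])
      (by rw [hd2, hl, hu, mul_zero]) (by rwa [hd1]) (by rw [hd1, hd2, hl]) hs
  rcases lt_or_gt_of_ne (mul_ne_zero hl0 hw) with h | h
  · exact ⟨y, hy, 1, Or.inl rfl, hfold 1 (by linarith)⟩
  · exact ⟨y, hy, -1, Or.inr rfl, hfold (-1) (by linarith)⟩

/-- An open set of germs pulls back to an open set of parametrisations, where a normalised
representative can be perturbed to a fold contact. -/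
theorem dense_contactBifurcation :
    Dense {g : degenerateGerms | ContactBifurcation 1 g.1 ∨ ContactBifurcation (-1) g.1} := by
  rintro ⟨g, x, rfl, hx⟩
  rw [mem_closure_iff]
  rintro O hO hgO
  obtain ⟨W, hW, rfl⟩ := isOpen_induced_iff.1 hO
  obtain ⟨A, hA⟩ := exists_normalized hx.1
  have hi := inverseDiffeoGerms_linear A
  have hq : Quotient.mk paramSetoid (x.comp hi) = Quotient.mk paramSetoid x :=
    Quotient.sound (Setoid.symm (x.comp_equiv hi))
  have hU : IsOpen {y : LocalParam | Quotient.mk paramSetoid y ∈ W} :=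
    hW.preimage continuous_quotient_mk'
  have hmem : x.comp hi ∈ {y : LocalParam | Quotient.mk paramSetoid y ∈ W} := by
    change Quotient.mk paramSetoid (x.comp hi) ∈ W
    rw [hq]; exact hgO
  obtain ⟨y, hy, s, hs, hf⟩ := exists_foldContact_mem hA
    (hx.of_reparam hi (.of_forall fun _ => rfl)) hU hmem
  refine ⟨⟨Quotient.mk paramSetoid y, y, rfl, hf.degenerateContact⟩, hy, ?_⟩
  have := contactBifurcation_of_fold hs hf
  rcases hs with rfl | rfl
  · exact Or.inl this
  · exact Or.inr this

/-! Openness. -/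

/-- The second derivative of `f` at the origin along the vector `(a, b)`. -/
def hess (f : Plane → ℝ) (a b : ℝ) : ℝ :=
  a ^ 2 * dirD (1, 0) (dirD (1, 0) f) 0 + 2 * a * b * dirD (0, 1) (dirD (1, 0) f) 0
    + b ^ 2 * dirD (0, 1) (dirD (0, 1) f) 0

theorem fderiv_fderiv_eq_hess {f : Plane → ℝ} (hf : SmoothNear f 0) (a b : ℝ) :
    fderiv ℝ (fderiv ℝ f) 0 (a, b) (a, b) = hess f a b := by
  have key : ∀ v w : Plane, fderiv ℝ (fderiv ℝ f) 0 v w = dirD v (dirD w f) 0 := by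
    intro v w
    have : dirD w f = fun y => fderiv ℝ f y w := rfl
    rw [dirD, this, fderiv_clm_apply hf.fderiv.differentiableAt (differentiableAt_const _)]
    simp
  have e : ((a, b) : Plane) = a • (1, 0) + b • (0, 1) := by simp
  rw [e]
  simp only [map_add, map_smul, _root_.add_apply, _root_.smul_apply, smul_eq_mul, key, hess,
    dirD_comm hf (1, 0) (0, 1)]
  ring

/-- The second derivative of `g` along `f = 0`, if the two curves are tangent, up to factors which
vanish only for singular curves. -/
def tangency (f g : Plane → ℝ) : ℝ :=
  (dirD (1, 0) f 0 * dirD (1, 0) g 0 + dirD (0, 1) f 0 * dirD (0, 1) g 0) *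
    ((dirD (1, 0) f 0 ^ 2 + dirD (0, 1) f 0 ^ 2) * hess g (-dirD (0, 1) f 0) (dirD (1, 0) f 0)
      - (dirD (1, 0) f 0 * dirD (1, 0) g 0 + dirD (0, 1) f 0 * dirD (0, 1) g 0) *
        hess f (-dirD (0, 1) f 0) (dirD (1, 0) f 0))

theorem continuous_tangency {T : Type*} [TopologicalSpace T] {f g : T → Plane → ℝ}
    (hf : JetCont f) (hg : JetCont g) : Continuous fun τ => tangency (f τ) (g τ) := by
  have f1 := fun v => (hf.dirD v).continuous
  have g1 := fun v => (hg.dirD v).continuous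
  have f2 := fun v w => ((hf.dirD v).dirD w).continuous
  have g2 := fun v w => ((hg.dirD v).dirD w).continuous
  unfold tangency hess
  have := f1 (1, 0)
  have := f1 (0, 1)
  have := g1 (1, 0)
  have := g1 (0, 1)
  have := f2 (1, 0) (1, 0)
  have := f2 (1, 0) (0, 1)
  have := f2 (0, 1) (0, 1)
  have := g2 (1, 0) (1, 0)
  have := g2 (1, 0) (0, 1)
  have := g2 (0, 1) (0, 1)
  fun_prop

theorem tangency_congr {f g f' g' : Plane → ℝ} (hf : f =ᶠ[𝓝 0] f') (hg : g =ᶠ[𝓝 0] g') :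
    tangency f g = tangency f' g' := by
  have f1 := fun v => (dirD_congr hf v).eq_of_nhds
  have g1 := fun v => (dirD_congr hg v).eq_of_nhds
  have f2 := fun v w => (dirD_congr (dirD_congr hf v) w).eq_of_nhds
  have g2 := fun v w => (dirD_congr (dirD_congr hg v) w).eq_of_nhds
  simp only [tangency, hess, f1, g1, f2, g2]

/-- If dg = l df, the inner product of the gradients is l |df|², so `tangency` is |df|⁴ times l (g''
- l f'') on the kernel vector (-q, p). The detour avoids division by df and makes sense for all
germs, tangent or not. -/
theorem tangency_ne_zero_iff {f g : Plane → ℝ} (sf : SmoothNear f 0) (sg : SmoothNear g 0)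
    (f0 : f 0 = 0) (hd : fderiv ℝ f 0 ≠ 0) (g0 : g 0 = 0) {l : ℝ}
    (hl : ∀ e, fderiv ℝ g 0 e = l * fderiv ℝ f 0 e) :
    tangency f g ≠ 0 ↔ FoldContact 1 f g ∨ FoldContact (-1) f g := by
  set p := dirD (1, 0) f 0 with hp
  set q := dirD (0, 1) f 0 with hq
  have hn : p ^ 2 + q ^ 2 ≠ 0 := by
    intro h
    have h1 : p = 0 := by nlinarith [sq_nonneg p, sq_nonneg q]
    have h2 : q = 0 := by nlinarith [sq_nonneg p, sq_nonneg q]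
    exact (clm_plane_ne_zero.1 hd).elim (fun h => h h1) (fun h => h h2)
  have h1 : dirD (1, 0) g 0 = l * p := hl _
  have h2 : dirD (0, 1) g 0 = l * q := hl _
  have ht : tangency f g = (p ^ 2 + q ^ 2) ^ 2 * (l * (hess g (-q) p - l * hess f (-q) p)) := by
    rw [tangency, h1, h2, ← hp, ← hq]; ring
  rw [ht, mul_ne_zero_iff_left (pow_ne_zero 2 hn)]
  have hker : fderiv ℝ f 0 (-q, p) = 0 := by
    rw [clm_plane_apply]
    change -q * p + p * q = 0
    ring
  have he : ((-q, p) : Plane) ≠ 0 := by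
    intro h
    rw [Prod.ext_iff] at h
    apply hn
    have h3 : -q = 0 := h.1
    have h4 : p = 0 := h.2
    rw [neg_eq_zero.1 h3, h4]; norm_num
  have hfold : ∀ s : ℝ, FoldContact s f g ↔ s * (l * (hess g (-q) p - l * hess f (-q) p)) < 0 := by
    intro s
    rw [foldContact_iff sf sg, ← fderiv_fderiv_eq_hess sf, ← fderiv_fderiv_eq_hess sg]
    constructor
    · rintro ⟨-, -, -, l', hl', h⟩
      obtain rfl : l' = l := by
        obtain ⟨v, hv⟩ : ∃ v, fderiv ℝ f 0 v ≠ 0 := by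
          by_contra! hc
          exact hd (ContinuousLinearMap.ext fun v => by simpa using hc v)
        exact mul_right_cancel₀ hv ((hl' v).symm.trans (hl v))
      have := h _ he hker
      linarith
    · intro h
      refine ⟨f0, hd, g0, l, hl, fun e he' hfe => ?_⟩
      obtain ⟨c, rfl⟩ := exists_smul_of_ker hd hker hfe he
      have hc : c ≠ 0 := fun hc => he' (by simp [hc])
      have hc2 := sq_pos_of_ne_zero hc
      simp only [map_smul, _root_.smul_apply, smul_eq_mul]
      nlinarith
  rw [hfold, hfold]
  constructor
  · intro h
    rcases lt_or_gt_of_ne h with h | h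
    · left; linarith
    · right; linarith
  · rintro (h | h) h0
    · rw [h0] at h; simp at h
    · rw [h0] at h; simp at h

/-- A germ which bifurcates has a contact of order four. -/
theorem ContactBifurcation.foldContact {s : ℝ} {x : LocalParam}
    (h : ContactBifurcation s (Quotient.mk paramSetoid x)) (hd : DegenerateContact x) :
    FoldContact 1 (ldFun x.toFun) (mcncFun x.toFun) ∨
      FoldContact (-1) (ldFun x.toFun) (mcncFun x.toFun) := by
  obtain ⟨-, h2, ⟨A, hA⟩, -⟩ := h x rfl
  obtain ⟨r, ρ, hr, -, hρ, -, α, β, η, hp, -⟩ := hA 1 one_pos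
  obtain ⟨h0, hδ, hH, l, hl⟩ := (degenerateContact_iff x).1 hd
  -- Regularity of the `MCNC` at the origin excludes l = 0, which contact of order two alone would
  -- allow.
  have hm : (0 : Plane) ∈ box A r ρ := ⟨0, 0, by simpa using hr, by simpa using hρ, (map_zero A).symm⟩
  exact exists_foldContact x.smooth.ldFun x.smooth.mcncFun h0 hδ hH (hp.mcnc_regular 0 hm) hl h2

/-- Nonvanishing of `tangency` in some parametrisation is open in the quotient: the diffeomorphism
leading to that parametrisation is kept fixed, and composition with it is continuous on jets. On
degenerate germs the condition is a fold contact, hence independent of the parametrisation. -/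
theorem isOpen_contactBifurcation :
    IsOpen {g : degenerateGerms | ContactBifurcation 1 g.1 ∨ ContactBifurcation (-1) g.1} := by
  let W : Set SurfaceGerm := {g | ∃ x, Parametrizes x g ∧
    tangency (ldFun x.toFun) (mcncFun x.toFun) ≠ 0}
  have hW : IsOpen W := by
    refine isOpen_coinduced.2 (isOpen_iff_mem_nhds.2 ?_)
    rintro y ⟨x, hx, hne⟩
    obtain ⟨h, k, hi, hxy⟩ : y ≈ x := Quotient.exact hx.symm
    have hc : VecJetCont fun z : LocalParam => (z.comp hi).toFun :=
      fun i => (vecJetCont_localParam i).comp hi.1 hi.2.2.1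
    have hcont : Continuous fun z : LocalParam =>
        tangency (ldFun (z.comp hi).toFun) (mcncFun (z.comp hi).toFun) :=
      continuous_tangency (hc.gLd _ _) (hc.gMc _ _)
    have hy : tangency (ldFun (y.comp hi).toFun) (mcncFun (y.comp hi).toFun) ≠ 0 := by
      have e : x.toFun =ᶠ[𝓝 0] (y.comp hi).toFun := hxy
      rw [← tangency_congr (ldFun_congr e) (mcncFun_congr e)]
      exact hne
    filter_upwards [hcont.continuousAt.eventually_ne hy] with z hz
    exact ⟨z.comp hi, Quotient.sound (Setoid.symm (z.comp_equiv hi)), hz⟩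
  convert hW.preimage continuous_subtype_val using 1
  ext ⟨g, x, rfl, hd⟩
  constructor
  · intro h
    have hf := h.elim (fun h => h.foldContact hd) (fun h => h.foldContact hd)
    obtain ⟨h0, hδ, hH, l, hl⟩ := (degenerateContact_iff x).1 hd
    exact ⟨x, rfl, (tangency_ne_zero_iff x.smooth.ldFun x.smooth.mcncFun h0 hδ hH hl).2 hf⟩
  · rintro ⟨y, hy, hne⟩
    obtain ⟨h, k, hi, hyx⟩ : x ≈ y := Quotient.exact hy.symm
    obtain ⟨h0, hδ, hH, l, hl⟩ := (degenerateContact_iff y).1 (hd.of_reparam hi hyx)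
    have hf := (tangency_ne_zero_iff y.smooth.ldFun y.smooth.mcncFun h0 hδ hH hl).1 hne
    change ContactBifurcation 1 (Quotient.mk paramSetoid x) ∨
      ContactBifurcation (-1) (Quotient.mk paramSetoid x)
    have hq : Quotient.mk paramSetoid x = Quotient.mk paramSetoid y := hy.symm
    rw [hq]
    exact hf.imp (contactBifurcation_of_fold (Or.inl rfl)) (contactBifurcation_of_fold (Or.inr rfl))

/-! Examples. -/

/-- The plane spanned by the lightlike vector `(1, 0, 1)` and by `(0, 1, 0)`. -/
def lightPlane : Plane →L[ℝ] R31 := LinearMap.toContinuousLinearMap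
  { toFun := fun z => ![z.1, z.2, z.1]
    map_add' := fun a b => by ext i; fin_cases i <;> simp
    map_smul' := fun c a => by ext i; fin_cases i <;> simp }

theorem lightPlane_apply (z : Plane) : lightPlane z = ![z.1, z.2, z.1] := rfl

theorem dirD_lightPlane (a : Plane) : dirD a lightPlane = fun _ => ![a.1, a.2, a.1] := by
  funext z
  rw [dirD, ContinuousLinearMap.fderiv, lightPlane_apply]

theorem dirD_dirD_lightPlane (a b z : Plane) : dirD b (dirD a lightPlane) z = 0 := by
  rw [dirD_lightPlane, dirD]; simp

/-- The height of the examples over the plane, in the direction `(1, 0, -1)`. -/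
def height (c : ℝ) (z : Plane) : ℝ :=
  -(z.1 * z.2) + 2 / 3 * z.1 ^ 3 + z.1 ^ 2 * z.2 + c * z.1 ^ 4

theorem contDiff_height (c : ℝ) : ContDiff ℝ ∞ (height c) := by
  unfold height; fun_prop

theorem dirD_height_fst (c : ℝ) : dirD (1, 0) (height c) = fun z =>
    -z.2 + 2 * z.1 ^ 2 + 2 * z.1 * z.2 + 4 * c * z.1 ^ 3 := by
  funext z
  refine dirD_of_expansion (c₀ := height c z) (c₂ := 2 * z.1 + z.2 + 6 * c * z.1 ^ 2)
    (c₃ := 2 / 3 + 4 * c * z.1) (c₄ := c)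
    ((contDiff_height c).differentiable (by simp) z) fun s => ?_
  simp [height]; ring

theorem dirD_height_snd (c : ℝ) : dirD (0, 1) (height c) = fun z => -z.1 + z.1 ^ 2 := by
  funext z
  refine dirD_of_expansion (c₀ := height c z) (c₂ := 0) (c₃ := 0) (c₄ := 0)
    ((contDiff_height c).differentiable (by simp) z) fun s => ?_
  simp [height]; ring

theorem dirD_dirD_height (c : ℝ) (z : Plane) :
    dirD (1, 0) (dirD (1, 0) (height c)) z = 4 * z.1 + 2 * z.2 + 12 * c * z.1 ^ 2 ∧
    dirD (0, 1) (dirD (1, 0) (height c)) z = -1 + 2 * z.1 ∧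
    dirD (0, 1) (dirD (0, 1) (height c)) z = 0 := by
  rw [dirD_height_fst, dirD_height_snd]
  refine ⟨dirD_of_expansion (c₀ := -z.2 + 2 * z.1 ^ 2 + 2 * z.1 * z.2 + 4 * c * z.1 ^ 3)
      (c₂ := 2 + 12 * c * z.1) (c₃ := 4 * c) (c₄ := 0) (by fun_prop) fun s => ?_,
    dirD_of_expansion (c₀ := -z.2 + 2 * z.1 ^ 2 + 2 * z.1 * z.2 + 4 * c * z.1 ^ 3)
      (c₂ := 0) (c₃ := 0) (c₄ := 0) (by fun_prop) fun s => ?_,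
    dirD_of_expansion (c₀ := -z.1 + z.1 ^ 2)
      (c₂ := 0) (c₃ := 0) (c₄ := 0) (by fun_prop) fun s => ?_⟩
  · simp; ring
  · simp; ring
  · simp

/-- A graph over a lightlike plane. -/
def lightGraph (c : ℝ) : LocalParam where
  toFun := push lightPlane (height c) ![1, 0, -1]
  smooth := (smoothNear_of_contDiff lightPlane.contDiff 0).push
    (smoothNear_of_contDiff (contDiff_height c) 0) _
  immersion := by
    have h0 : ∀ a, dirD a (height c) 0 = 0 := by
      intro a
      rw [dirD, clm_plane_apply]
      have h1 := congrFun (dirD_height_fst c) 0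
      have h2 := congrFun (dirD_height_snd c) 0
      rw [dirD] at h1 h2
      rw [h1, h2]; simp
    have h : ∀ a, fderiv ℝ (push lightPlane (height c) ![1, 0, -1]) 0 a = ![a.1, a.2, a.1] := by
      intro a
      have := dirD_push_of_eq_zero (smoothNear_of_contDiff lightPlane.contDiff 0)
        (smoothNear_of_contDiff (contDiff_height c) 0) h0 ![1, 0, -1] a
      rw [dirD_lightPlane] at this
      exact this
    intro a b hab
    rw [h, h] at hab
    exact Prod.ext (by simpa using congrFun hab 0) (by simpa using congrFun hab 1)

theorem ldFun_lightGraph (c : ℝ) (z : Plane) : ldFun (lightGraph c).toFun z =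
    4 * (-z.1 + z.1 ^ 2) ^ 2 - 4 * (-z.2 + 2 * z.1 ^ 2 + 2 * z.1 * z.2 + 4 * c * z.1 ^ 3) := by
  refine (gLd_push (smoothNear_of_contDiff lightPlane.contDiff z)
    (smoothNear_of_contDiff (contDiff_height c) z) _ _ _).trans ?_
  rw [dirD_height_fst, dirD_height_snd, dirD_lightPlane, dirD_lightPlane]
  simp [ldForm, mink]; ring

theorem mcncFun_lightGraph (c : ℝ) (z : Plane) : mcncFun (lightGraph c).toFun z =
    -2 * (4 * z.1 + 2 * z.2 + 12 * c * z.1 ^ 2 - 4 * (-z.1 + z.1 ^ 2) * (-1 + 2 * z.1)) := by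
  refine (gMc_push (smoothNear_of_contDiff lightPlane.contDiff z)
    (smoothNear_of_contDiff (contDiff_height c) z) _ _ _).trans ?_
  obtain ⟨h1, h2, h3⟩ := dirD_dirD_height c z
  rw [h1, h2, h3, dirD_dirD_lightPlane, dirD_dirD_lightPlane, dirD_dirD_lightPlane,
    dirD_height_fst, dirD_height_snd, dirD_lightPlane, dirD_lightPlane]
  simp [mcForm, mink, mcross]; ring

/-- In `height`, the term -uv gives dδ ≠ 0, the cubic term in u cancels the u-derivative of H, and
u²v makes its v-derivative nonzero, with l = -1. The uu-derivative of H + δ is -(48c + 56), so c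
chooses the sign. -/
theorem foldContact_lightGraph {c s : ℝ} (h : s * (48 * c + 56) < 0) :
    FoldContact s (ldFun (lightGraph c).toFun) (mcncFun (lightGraph c).toFun) := by
  have sf := (lightGraph c).smooth.ldFun
  have sg := (lightGraph c).smooth.mcncFun
  have s0 : SmoothNear (fun _ : Plane => (0 : ℝ)) 0 := smoothNear_const 0 0
  have eL : ∀ u : ℝ, ldFun (lightGraph c).toFun (u, 0) =
      u ^ 2 * (-4 - 8 * u - 16 * c * u + 4 * u ^ 2) := by
    intro u; rw [ldFun_lightGraph]; ring
  have eM : ∀ u : ℝ, mcncFun (lightGraph c).toFun (u, 0) = u ^ 2 * (-24 * (c + 1) + 16 * u) := by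
    intro u; rw [mcncFun_lightGraph]; ring
  have dLu : fderiv ℝ (ldFun (lightGraph c).toFun) 0 (1, 0) = 0 := by
    rw [fderiv_fst_of_eq_add s0.differentiableAt sf.differentiableAt
      (B := fun u => u * (-4 - 8 * u - 16 * c * u + 4 * u ^ 2)) (by fun_prop)
      (.of_forall fun u => by rw [eL]; ring)]
    simp
  have dMu : fderiv ℝ (mcncFun (lightGraph c).toFun) 0 (1, 0) = 0 := by
    rw [fderiv_fst_of_eq_add s0.differentiableAt sg.differentiableAt
      (B := fun u => u * (-24 * (c + 1) + 16 * u)) (by fun_prop)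
      (.of_forall fun u => by rw [eM]; ring)]
    simp
  have dLv : fderiv ℝ (ldFun (lightGraph c).toFun) 0 (0, 1) = 4 := by
    rw [fderiv_snd_of_eq_add s0.differentiableAt sf.differentiableAt
      (B := fun _ => 4) (by fun_prop) (.of_forall fun v => by rw [ldFun_lightGraph]; ring)]
    simp
  have dMv : fderiv ℝ (mcncFun (lightGraph c).toFun) 0 (0, 1) = -4 := by
    rw [fderiv_snd_of_eq_add s0.differentiableAt sg.differentiableAt
      (B := fun _ => -4) (by fun_prop) (.of_forall fun v => by rw [mcncFun_lightGraph]; ring)]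
    simp
  have ddL : fderiv ℝ (fderiv ℝ (ldFun (lightGraph c).toFun)) 0 (1, 0) (1, 0) = -8 := by
    rw [fderiv_fderiv_fst_of_eq_add s0 sf (B := fun u => -4 - 8 * u - 16 * c * u + 4 * u ^ 2)
      (by fun_prop) (.of_forall fun u => by rw [eL]; ring)]
    simp; norm_num
  have ddM : fderiv ℝ (fderiv ℝ (mcncFun (lightGraph c).toFun)) 0 (1, 0) (1, 0) =
      -48 * (c + 1) := by
    rw [fderiv_fderiv_fst_of_eq_add s0 sg (B := fun u => -24 * (c + 1) + 16 * u)
      (by fun_prop) (.of_forall fun u => by rw [eM]; ring)]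
    simp; ring
  refine foldContact_of_axes sf sg (by rw [ldFun_lightGraph]; simp)
    (by rw [mcncFun_lightGraph]; simp) dLu dMu (by rw [dLv]; norm_num) (l := -1)
    (by rw [dLv, dMv]; norm_num) ?_
  rw [ddL, ddM]
  linarith

end MinkowskiSurface

end

theorem mainTheorem5 :
    GenericIn degenerateGerms
      (fun g => ContactBifurcation 1 g ∨ ContactBifurcation (-1) g) ∧
    (∃ g ∈ degenerateGerms, ContactBifurcation 1 g) ∧
    (∃ g ∈ degenerateGerms, ContactBifurcation (-1) g) := by
  refine ⟨⟨isOpen_contactBifurcation, dense_contactBifurcation⟩, ?_, ?_⟩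
  -- The values c = -2 and c = 0 lie on either side of the root -7/6 of 48c + 56.
  · have h : FoldContact 1 _ _ := foldContact_lightGraph (c := -2) (by norm_num)
    exact ⟨_, ⟨_, rfl, h.degenerateContact⟩, contactBifurcation_of_fold (Or.inl rfl) h⟩
  · have h : FoldContact (-1) _ _ := foldContact_lightGraph (c := 0) (by norm_num)
    exact ⟨_, ⟨_, rfl, h.degenerateContact⟩, contactBifurcation_of_fold (Or.inr rfl) h⟩
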